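/- **Theorem.** Let MALL be unit-free multiplicative-additive linear logic with cut, either with or without the binary mix rule. Formulas are built from literals $P, P^\perp$ by $\otimes$ (tensor), $\wp$ (par), $\&$ and $\oplus$; negation $(-)^\perp$ extends to all formulas by de Morgan duality; a sequent is a disjoint union of formula occurrences, which are tracked downwards through the rules $$\frac{}{P,P^\perp}\,\mathsf{ax}\quad \frac{\Gamma,A\quad B,\Delta}{\Gamma,A\otimes B,\Delta}\quad \frac{\Gamma,A,B}{\Gamma,A\wp B}\quad \frac{\Gamma,A\quad\Gamma,B}{\Gamma,A\& B}\quad \frac{\Gamma,A}{\Gamma,A\oplus B}\quad \frac{\Gamma,B}{\Gamma,A\oplus B}\quad \frac{\Gamma\quad\Delta}{\Gamma,\Delta}\,\mathsf{mix}\quad \frac{\Gamma,A\quad A^\perp,\Delta}{\Gamma,\Delta}\,\mathsf{cut}.$$ The premises of mix and of cut are unordered. *Proof nets.* Let MALL$^\star$ be the variant of MALL in which cuts are retained in sequents: sequents may also contain cuts, i.e. unordered pairs $A\star A^\perp$ in outermost position, the cut rule becomes "from $\Gamma,A$ and $A^\perp,\Delta$ infer $\Gamma,A\star A^\perp,\Delta$",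 and the $\&$-rule becomes "from $\Omega_1,\Gamma,A$ and $\Omega_2,\Gamma,B$ infer $\Omega_1,\Omega_2,\Gamma,A\& B$", where $\Omega_1,\Omega_2$ consist of cuts only and $\Gamma$ may contain cuts. Deleting all cuts from its sequents projects a MALL$^\star$ proof to a MALL proof. A linking on a sequent is a set of links (two-element sets of leaves). A MALL$^\star$ proof of $\Omega,\Gamma$ ($\Omega$ consisting of cuts, $\Gamma$ of formulas) defines a set of linkings on $\Omega,\Gamma$: one for each way of deleting one branch above every $\&$-rule, consisting of the links given by the remaining axioms. Such a set is called a proof net. A MALL proof $\Pi$ of $\Gamma$ translates to a proof net $\theta$ on $\Omega,\Gamma$ if $\Pi$ is the projection of a MALL$^\star$ proof of $\Omega,\Gamma$ that defines $\theta$. Two MALL proofs of $\Gamma$ have a common translation if, for some $\Omega$, both translate to the same proof net on $\Omega,\Gamma$. Proof-net equivalence is the smallest equivalence relation on MALL proofs that relates any two proofs with a common translation. *Rule commutations.* A rule commutation replaces, in an arbitrary subproof, one side of one of the following pairs by the other; both sides are proofs of the same sequent, the subproofs $\pi,\pi',\ldots$ immediately above the two rules are kept, and occurrences are tracked identically. Write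 $\rho(\pi)$ or $\rho(\pi,\pi')$ for the application of a rule to these subproofs, let $\mu,\nu$ range over instances of $\otimes$, mix and cut, $\rho,\sigma$ over instances of $\wp$, $\oplus_1$, $\oplus_2$, and $\alpha,\beta$ over instances of $\&$. On both sides of a pair, equal letters denote the rule instances that generate the same formula occurrence (respectively that cut the same formula, or are mix). 1. $\rho(\sigma(\pi))\leftrightarrow\sigma(\rho(\pi))$; 2. $\beta(\rho(\pi),\rho(\pi'))\leftrightarrow\rho(\beta(\pi,\pi'))$; 3. $\beta(\alpha(\pi_1,\pi_2),\alpha(\pi_3,\pi_4))\leftrightarrow\alpha(\beta(\pi_1,\pi_3),\beta(\pi_2,\pi_4))$; 4. $\mu(\pi,\rho(\pi'))\leftrightarrow\rho(\mu(\pi,\pi'))$, and symmetrically $\mu(\rho(\pi'),\pi)\leftrightarrow\rho(\mu(\pi',\pi))$; 5. $\mu(\pi,\beta(\pi',\pi''))\leftrightarrow\beta(\mu(\pi,\pi'),\mu(\pi,\pi''))$, and symmetrically with the premises of $\mu$ exchanged; 6. $\mu(\pi,\nu(\pi',\pi''))\leftrightarrow\nu(\mu(\pi,\pi'),\pi'')$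 and $\mu(\pi,\nu(\pi',\pi''))\leftrightarrow\nu(\pi',\mu(\pi,\pi''))$, and symmetrically with the premises of $\mu$ exchanged. Then for every sequent $\Gamma$: * two MALL proofs of $\Gamma$ are proof-net equivalent if and only if they can be converted into each other by a series of rule commutations; * (a) if two MALL proofs of $\Gamma$ translate to a common proof net, then they can be converted into each other by rule commutations; * (b) if two MALL proofs of $\Gamma$ differ by one rule commutation, then they translate to a common proof net. -/

import Mathlib

namespace MALL

universe u v

/-! ### Formulas, occurrences and sequents -/

/-- Unit-free MALL formulas over the propositional variables `V`. -/
inductive Formula (V : Type u) : Type u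
  | pos (P : V)
  | neg (P : V)
  | tensor (A B : Formula V)
  | par (A B : Formula V)
  | wth (A B : Formula V)
  | plus (A B : Formula V)

/-- Linear negation, by de Morgan duality. -/
def Formula.dual {V : Type u} : Formula V → Formula V
  | pos P => neg P
  | neg P => pos P
  | tensor A B => par A.dual B.dual
  | par A B => tensor A.dual B.dual
  | wth A B => plus A.dual B.dual
  | plus A B => wth A.dual B.dual

/-- The two arguments of a binary connective. -/
inductive Side
  | left
  | right

/-- The argument of `A α B` on side `d`. -/
def Side.pick {X : Type u} (d : Side) (A B : X) : X :=
  match d with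
  | left => A
  | right => B

/-- A root of the parse forest in which the vertices of a proof live: either the formula occurrence
with index `i` of the conclusion, or the argument `A` of the cut `A ⋆ A⊥` whose name is `c`.
(As `A ≠ A⊥`, the formula itself tells the two arguments of a cut apart, which are unordered.) -/
inductive Root (V : Type u) (ι : Type v) : Type (max u v)
  | concl (i : ι)
  | cut (c : ℕ) (A : Formula V)

/-- A vertex of the parse forest: a root and the path that leads from the root to the vertex, the
last step first. All occurrences in a proof are named by the vertex of the forest they track to,
so that the downward tracking of occurrences and of leaves through the rules is the identity. -/
structure Loc (V : Type u) (ι : Type v) : Type (max u v) where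
  root : Root V ι
  path : List Side

/-- The vertex of the argument on side `d` of the formula occurrence `a`. -/
def Loc.child {V : Type u} {ι : Type v} (d : Side) (a : Loc V ι) : Loc V ι :=
  ⟨a.root, d :: a.path⟩

/-- The argument `A` of the cut `A ⋆ A⊥` with name `c`. -/
def Loc.ofCut {V : Type u} {ι : Type v} (c : ℕ) (A : Formula V) : Loc V ι :=
  ⟨Root.cut c A, []⟩

/-- The set of names (at most one) of the cut to which a root belongs. -/
def Root.names {V : Type u} {ι : Type v} : Root V ι → Set ℕ
  | concl _ => ∅
  | cut c _ => {c}

/-- A MALL sequent: a disjoint union of formula occurrences. -/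
abbrev Sequent (V : Type u) (ι : Type v) : Type (max u v) :=
  Multiset (Loc V ι × Formula V)

/-- The sequent formed by a finite family `Γ` of formulas. -/
def Sequent.ofFamily {V : Type u} {ι : Type v} [Fintype ι] (Γ : ι → Formula V) : Sequent V ι :=
  (Finset.univ : Finset ι).val.map fun i => (⟨Root.concl i, []⟩, Γ i)

/-- No vertex of `Γ` belongs to a cut with name `c`. -/
def Sequent.Fresh {V : Type u} {ι : Type v} (c : ℕ) (Γ : Sequent V ι) : Prop :=
  ∀ x ∈ Γ, c ∉ x.1.root.names

/-! ### Proof trees and MALL proofs -/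

/-- Trees of rule instances. Each rule is marked with the vertex of the formula that it generates,
a cut with its name and its cut formula. In `ax a b` the variable is at `a`, its negation at `b`.
The premises of `tensor`, `wth` and `cut` are in the order of the arguments. -/
inductive Tree (V : Type u) (ι : Type v) : Type (max u v)
  | ax (a b : Loc V ι)
  | tensor (a : Loc V ι) (p q : Tree V ι)
  | par (a : Loc V ι) (p : Tree V ι)
  | wth (a : Loc V ι) (p q : Tree V ι)
  | plus (d : Side) (a : Loc V ι) (p : Tree V ι)
  | mix (p q : Tree V ι)
  | cut (c : ℕ) (A : Formula V) (p q : Tree V ι)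

variable {V : Type u} {ι : Type v}

/-- `Derives m t Γ`: the tree `t` is a proof of the sequent `Γ` in MALL (with cut), with the mix
rule if `m = true` and without it if `m = false`. The name `c` given to a cut is a bound name: it
only serves to name the occurrences of the two cut formulas in the premises. -/
inductive Derives (m : Bool) : Tree V ι → Sequent V ι → Prop
  | ax (a b : Loc V ι) (P : V) :
      Derives m (.ax a b) {(a, Formula.pos P), (b, Formula.neg P)}
  | tensor (a : Loc V ι) (A B : Formula V) (Γ Δ : Sequent V ι) (p q : Tree V ι) :
      Derives m p ((a.child .left, A) ::ₘ Γ) →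
      Derives m q ((a.child .right, B) ::ₘ Δ) →
      Derives m (.tensor a p q) ((a, A.tensor B) ::ₘ (Γ + Δ))
  | par (a : Loc V ι) (A B : Formula V) (Γ : Sequent V ι) (p : Tree V ι) :
      Derives m p ((a.child .left, A) ::ₘ (a.child .right, B) ::ₘ Γ) →
      Derives m (.par a p) ((a, A.par B) ::ₘ Γ)
  | wth (a : Loc V ι) (A B : Formula V) (Γ : Sequent V ι) (p q : Tree V ι) :
      Derives m p ((a.child .left, A) ::ₘ Γ) →
      Derives m q ((a.child .right, B) ::ₘ Γ) →
      Derives m (.wth a p q) ((a, A.wth B) ::ₘ Γ)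
  | plus (d : Side) (a : Loc V ι) (A B : Formula V) (Γ : Sequent V ι) (p : Tree V ι) :
      Derives m p ((a.child d, d.pick A B) ::ₘ Γ) →
      Derives m (.plus d a p) ((a, A.plus B) ::ₘ Γ)
  | mix (Γ Δ : Sequent V ι) (p q : Tree V ι) :
      m = true → Derives m p Γ → Derives m q Δ →
      Derives m (.mix p q) (Γ + Δ)
  | cut (c : ℕ) (A : Formula V) (Γ Δ : Sequent V ι) (p q : Tree V ι) :
      Sequent.Fresh c (Γ + Δ) →
      Derives m p ((Loc.ofCut c A, A) ::ₘ Γ) →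
      Derives m q ((Loc.ofCut c A.dual, A.dual) ::ₘ Δ) →
      Derives m (.cut c A p q) (Γ + Δ)

/-! ### Identity of proofs: names of cuts and the order of premises are immaterial -/

/-- Renaming of the cuts. -/
def Root.rename (π : Equiv.Perm ℕ) : Root V ι → Root V ι
  | concl i => concl i
  | cut c A => cut (π c) A

/-- Renaming of the cuts. -/
def Loc.rename (π : Equiv.Perm ℕ) (a : Loc V ι) : Loc V ι :=
  ⟨a.root.rename π, a.path⟩

/-- Renaming of the cuts, the bound names included. -/
def Tree.rename (π : Equiv.Perm ℕ) : Tree V ι → Tree V ι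
  | ax a b => ax (a.rename π) (b.rename π)
  | tensor a p q => tensor (a.rename π) (p.rename π) (q.rename π)
  | par a p => par (a.rename π) (p.rename π)
  | wth a p q => wth (a.rename π) (p.rename π) (q.rename π)
  | plus d a p => plus d (a.rename π) (p.rename π)
  | mix p q => mix (p.rename π) (q.rename π)
  | cut c A p q => cut (π c) A (p.rename π) (q.rename π)

/-- The names of cuts that are free in a MALL proof, that is, that occur in its conclusion. -/
def Tree.freeNames : Tree V ι → Set ℕ
  | ax a b => a.root.names ∪ b.root.names
  | tensor _ p q => p.freeNames ∪ q.freeNames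
  | par _ p => p.freeNames
  | wth _ p q => p.freeNames ∪ q.freeNames
  | plus _ _ p => p.freeNames
  | mix p q => p.freeNames ∪ q.freeNames
  | cut c _ p q => (p.freeNames ∪ q.freeNames) \ {c}

/-- Two trees denote the same MALL proof: the least congruence for which the premises of `mix` and
of `cut` are unordered and bound names of cuts may be renamed. -/
inductive Same : Tree V ι → Tree V ι → Prop
  | refl (p : Tree V ι) : Same p p
  | symm {p q : Tree V ι} : Same p q → Same q p
  | trans {p q r : Tree V ι} : Same p q → Same q r → Same p r
  | mix_swap (p q : Tree V ι) : Same (.mix p q) (.mix q p)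
  | cut_swap (c : ℕ) (A : Formula V) (p q : Tree V ι) : Same (.cut c A p q) (.cut c A.dual q p)
  | rename (π : Equiv.Perm ℕ) (p : Tree V ι) :
      (∀ c ∈ p.freeNames, π c = c) → Same p (p.rename π)
  | tensor {a : Loc V ι} {p p' q q' : Tree V ι} :
      Same p p' → Same q q' → Same (.tensor a p q) (.tensor a p' q')
  | par {a : Loc V ι} {p p' : Tree V ι} : Same p p' → Same (.par a p) (.par a p')
  | wth {a : Loc V ι} {p p' q q' : Tree V ι} :
      Same p p' → Same q q' → Same (.wth a p q) (.wth a p' q')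
  | plus {d : Side} {a : Loc V ι} {p p' : Tree V ι} :
      Same p p' → Same (.plus d a p) (.plus d a p')
  | mix {p p' q q' : Tree V ι} : Same p p' → Same q q' → Same (.mix p q) (.mix p' q')
  | cut {c : ℕ} {A : Formula V} {p p' q q' : Tree V ι} :
      Same p p' → Same q q' → Same (.cut c A p q) (.cut c A p' q')

/-- The trees that represent MALL proofs of `Γ`. -/
def RawProof [Fintype ι] (m : Bool) (Γ : ι → Formula V) : Type (max u v) :=
  {t : Tree V ι // Derives m t (Sequent.ofFamily Γ)}

/-- Identity of the represented proofs. -/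
instance RawProof.setoid [Fintype ι] (m : Bool) (Γ : ι → Formula V) : Setoid (RawProof m Γ) where
  r p q := Same p.1 q.1
  iseqv := ⟨fun p => .refl p.1, fun h => .symm h, fun h k => .trans h k⟩

/-- MALL proofs (with cut) of the sequent `Γ`, with mix iff `m = true`. -/
def Proof [Fintype ι] (m : Bool) (Γ : ι → Formula V) : Type (max u v) :=
  Quotient (RawProof.setoid m Γ)

/-! ### The rule commutations of MALL -/

/-- The rule commutations, each listed in one direction, as relations between trees. They are only
used between trees that are proofs of the same sequent, see `DifferByCommutation`, which yields the
usual side conditions. Variants that exchange the premises of `mix` or of `cut` need not be listed,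
as these premises are unordered. -/
inductive Comm : Tree V ι → Tree V ι → Prop
  | par_par (a b : Loc V ι) (p : Tree V ι) :
      Comm (.par b (.par a p)) (.par a (.par b p))
  | plus_plus (i j : Side) (a b : Loc V ι) (p : Tree V ι) :
      Comm (.plus j b (.plus i a p)) (.plus i a (.plus j b p))
  | tensor_tensor (a b : Loc V ι) (p q r : Tree V ι) :
      Comm (.tensor a p (.tensor b q r)) (.tensor b (.tensor a p q) r)
  | tensor_tensor_left (a b : Loc V ι) (p q r : Tree V ι) :
      Comm (.tensor a (.tensor b p q) r) (.tensor b (.tensor a p r) q)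
  | tensor_tensor_right (a b : Loc V ι) (p q r : Tree V ι) :
      Comm (.tensor a p (.tensor b q r)) (.tensor b q (.tensor a p r))
  | wth_wth (a b : Loc V ι) (p₁ p₂ p₃ p₄ : Tree V ι) :
      Comm (.wth b (.wth a p₁ p₂) (.wth a p₃ p₄)) (.wth a (.wth b p₁ p₃) (.wth b p₂ p₄))
  | plus_par (i : Side) (a b : Loc V ι) (p : Tree V ι) :
      Comm (.par b (.plus i a p)) (.plus i a (.par b p))
  | plus_wth (i : Side) (a b : Loc V ι) (p q : Tree V ι) :
      Comm (.wth b (.plus i a p) (.plus i a q)) (.plus i a (.wth b p q))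
  | par_wth (a b : Loc V ι) (p q : Tree V ι) :
      Comm (.wth b (.par a p) (.par a q)) (.par a (.wth b p q))
  | plus_tensor (i : Side) (a b : Loc V ι) (p q : Tree V ι) :
      Comm (.tensor a p (.plus i b q)) (.plus i b (.tensor a p q))
  | plus_tensor' (i : Side) (a b : Loc V ι) (p q : Tree V ι) :
      Comm (.tensor a (.plus i b q) p) (.plus i b (.tensor a q p))
  | par_tensor (a b : Loc V ι) (p q : Tree V ι) :
      Comm (.tensor a p (.par b q)) (.par b (.tensor a p q))
  | par_tensor' (a b : Loc V ι) (p q : Tree V ι) :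
      Comm (.tensor a (.par b q) p) (.par b (.tensor a q p))
  | wth_tensor (a b : Loc V ι) (p q r : Tree V ι) :
      Comm (.tensor a p (.wth b q r)) (.wth b (.tensor a p q) (.tensor a p r))
  | wth_tensor' (a b : Loc V ι) (p q r : Tree V ι) :
      Comm (.tensor a (.wth b q r) p) (.wth b (.tensor a q p) (.tensor a r p))
  | mix_mix (p q r : Tree V ι) :
      Comm (.mix p (.mix q r)) (.mix (.mix p q) r)
  | tensor_mix (b : Loc V ι) (p q r : Tree V ι) :
      Comm (.mix p (.tensor b q r)) (.tensor b (.mix p q) r)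
  | tensor_mix' (b : Loc V ι) (p q r : Tree V ι) :
      Comm (.mix p (.tensor b q r)) (.tensor b q (.mix p r))
  | plus_mix (i : Side) (b : Loc V ι) (p q : Tree V ι) :
      Comm (.mix p (.plus i b q)) (.plus i b (.mix p q))
  | par_mix (b : Loc V ι) (p q : Tree V ι) :
      Comm (.mix p (.par b q)) (.par b (.mix p q))
  | wth_mix (b : Loc V ι) (p q r : Tree V ι) :
      Comm (.mix p (.wth b q r)) (.wth b (.mix p q) (.mix p r))
  | cut_cut (c d : ℕ) (A B : Formula V) (p q r : Tree V ι) :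
      Comm (.cut c A p (.cut d B q r)) (.cut d B (.cut c A p q) r)
  | tensor_cut (c : ℕ) (A : Formula V) (b : Loc V ι) (p q r : Tree V ι) :
      Comm (.cut c A p (.tensor b q r)) (.tensor b (.cut c A p q) r)
  | tensor_cut' (c : ℕ) (A : Formula V) (b : Loc V ι) (p q r : Tree V ι) :
      Comm (.cut c A p (.tensor b q r)) (.tensor b q (.cut c A p r))
  | plus_cut (c : ℕ) (A : Formula V) (i : Side) (b : Loc V ι) (p q : Tree V ι) :
      Comm (.cut c A p (.plus i b q)) (.plus i b (.cut c A p q))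
  | par_cut (c : ℕ) (A : Formula V) (b : Loc V ι) (p q : Tree V ι) :
      Comm (.cut c A p (.par b q)) (.par b (.cut c A p q))
  | wth_cut (c : ℕ) (A : Formula V) (b : Loc V ι) (p q r : Tree V ι) :
      Comm (.cut c A p (.wth b q r)) (.wth b (.cut c A p q) (.cut c A p r))
  | cut_mix (c : ℕ) (B : Formula V) (p q r : Tree V ι) :
      Comm (.mix p (.cut c B q r)) (.cut c B (.mix p q) r)

/-- A rule commutation applied to one subproof. -/
inductive CommStep : Tree V ι → Tree V ι → Prop
  | here {p q : Tree V ι} : Comm p q → CommStep p q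
  | tensor_left {a : Loc V ι} {p p' q : Tree V ι} :
      CommStep p p' → CommStep (.tensor a p q) (.tensor a p' q)
  | tensor_right {a : Loc V ι} {p q q' : Tree V ι} :
      CommStep q q' → CommStep (.tensor a p q) (.tensor a p q')
  | par {a : Loc V ι} {p p' : Tree V ι} : CommStep p p' → CommStep (.par a p) (.par a p')
  | wth_left {a : Loc V ι} {p p' q : Tree V ι} :
      CommStep p p' → CommStep (.wth a p q) (.wth a p' q)
  | wth_right {a : Loc V ι} {p q q' : Tree V ι} :
      CommStep q q' → CommStep (.wth a p q) (.wth a p q')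
  | plus {d : Side} {a : Loc V ι} {p p' : Tree V ι} :
      CommStep p p' → CommStep (.plus d a p) (.plus d a p')
  | mix_left {p p' q : Tree V ι} : CommStep p p' → CommStep (.mix p q) (.mix p' q)
  | mix_right {p q q' : Tree V ι} : CommStep q q' → CommStep (.mix p q) (.mix p q')
  | cut_left {c : ℕ} {A : Formula V} {p p' q : Tree V ι} :
      CommStep p p' → CommStep (.cut c A p q) (.cut c A p' q)
  | cut_right {c : ℕ} {A : Formula V} {p q q' : Tree V ι} :
      CommStep q q' → CommStep (.cut c A p q) (.cut c A p q')

/-- Two MALL proofs of `Γ` differ by one rule commutation (used in either direction). -/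
def DifferByCommutation [Fintype ι] {m : Bool} {Γ : ι → Formula V} (x y : Proof m Γ) : Prop :=
  ∃ p q : RawProof m Γ, Quotient.mk _ p = x ∧ Quotient.mk _ q = y ∧
    (CommStep p.1 q.1 ∨ CommStep q.1 p.1)

/-- One proof can be converted into the other by a series of rule commutations. -/
def Interconvertible [Fintype ι] {m : Bool} {Γ : ι → Formula V} : Proof m Γ → Proof m Γ → Prop :=
  Relation.ReflTransGen DifferByCommutation

/-! ### Proofs in which the cuts are retained in the sequents, and proof nets -/

/-- A named occurrence of a cut; the cut formula `A ⋆ A⊥` is the unordered pair of `A` and `A⊥`. -/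
abbrev Cut (V : Type u) : Type u := ℕ × Sym2 (Formula V)

/-- `DerivesStar m t Ω Γ`: the tree `t` is a proof, in the variant MALL* of MALL in which cuts are
retained, of the sequent that is the disjoint union of the cuts `Ω` and the MALL formulas `Γ`.
In the rule for `wth`, the cuts in `Ω` are superimposed, those in `Ω₁` and `Ω₂` kept separate. -/
inductive DerivesStar (m : Bool) : Tree V ι → Multiset (Cut V) → Sequent V ι → Prop
  | ax (a b : Loc V ι) (P : V) :
      DerivesStar m (.ax a b) 0 {(a, Formula.pos P), (b, Formula.neg P)}
  | tensor (a : Loc V ι) (A B : Formula V) (Ω₁ Ω₂ : Multiset (Cut V)) (Γ Δ : Sequent V ι)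
      (p q : Tree V ι) :
      DerivesStar m p Ω₁ ((a.child .left, A) ::ₘ Γ) →
      DerivesStar m q Ω₂ ((a.child .right, B) ::ₘ Δ) →
      DerivesStar m (.tensor a p q) (Ω₁ + Ω₂) ((a, A.tensor B) ::ₘ (Γ + Δ))
  | par (a : Loc V ι) (A B : Formula V) (Ω : Multiset (Cut V)) (Γ : Sequent V ι) (p : Tree V ι) :
      DerivesStar m p Ω ((a.child .left, A) ::ₘ (a.child .right, B) ::ₘ Γ) →
      DerivesStar m (.par a p) Ω ((a, A.par B) ::ₘ Γ)
  | wth (a : Loc V ι) (A B : Formula V) (Ω₁ Ω₂ Ω : Multiset (Cut V)) (Γ : Sequent V ι)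
      (p q : Tree V ι) :
      DerivesStar m p (Ω₁ + Ω) ((a.child .left, A) ::ₘ Γ) →
      DerivesStar m q (Ω₂ + Ω) ((a.child .right, B) ::ₘ Γ) →
      DerivesStar m (.wth a p q) (Ω₁ + Ω₂ + Ω) ((a, A.wth B) ::ₘ Γ)
  | plus (d : Side) (a : Loc V ι) (A B : Formula V) (Ω : Multiset (Cut V)) (Γ : Sequent V ι)
      (p : Tree V ι) :
      DerivesStar m p Ω ((a.child d, d.pick A B) ::ₘ Γ) →
      DerivesStar m (.plus d a p) Ω ((a, A.plus B) ::ₘ Γ)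
  | mix (Ω₁ Ω₂ : Multiset (Cut V)) (Γ Δ : Sequent V ι) (p q : Tree V ι) :
      m = true → DerivesStar m p Ω₁ Γ → DerivesStar m q Ω₂ Δ →
      DerivesStar m (.mix p q) (Ω₁ + Ω₂) (Γ + Δ)
  | cut (c : ℕ) (A : Formula V) (Ω₁ Ω₂ : Multiset (Cut V)) (Γ Δ : Sequent V ι) (p q : Tree V ι) :
      Sequent.Fresh c (Γ + Δ) →
      DerivesStar m p Ω₁ ((Loc.ofCut c A, A) ::ₘ Γ) →
      DerivesStar m q Ω₂ ((Loc.ofCut c A.dual, A.dual) ::ₘ Δ) →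
      DerivesStar m (.cut c A p q) ((c, s(A, A.dual)) ::ₘ (Ω₁ + Ω₂)) (Γ + Δ)

/-- Deleting all cuts from the sequents turns a MALL* proof into a MALL proof. -/
theorem DerivesStar.derives {m : Bool} {t : Tree V ι} {Ω : Multiset (Cut V)} {Γ : Sequent V ι}
    (h : DerivesStar m t Ω Γ) : Derives m t Γ := by
  induction h with
  | ax a b P => exact .ax a b P
  | tensor a A B _ _ Γ Δ p q _ _ ihp ihq => exact .tensor a A B Γ Δ p q ihp ihq
  | par a A B _ Γ p _ ih => exact .par a A B Γ p ih
  | wth a A B _ _ _ Γ p q _ _ ihp ihq => exact .wth a A B Γ p q ihp ihq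
  | plus d a A B _ Γ p _ ih => exact .plus d a A B Γ p ih
  | mix _ _ Γ Δ p q hm _ _ ihp ihq => exact .mix Γ Δ p q hm ihp ihq
  | cut c A _ _ Γ Δ p q hc _ _ ihp ihq => exact .cut c A Γ Δ p q hc ihp ihq

/-- MALL* proofs of the sequent `Ω, Γ`, where distinct occurrences of cuts have distinct names. -/
structure StarProof [Fintype ι] (m : Bool) (Ω : Multiset (Cut V)) (Γ : ι → Formula V) :
    Type (max u v) where
  tree : Tree V ι
  names_nodup : (Ω.map Prod.fst).Nodup
  derives : DerivesStar m tree Ω (Sequent.ofFamily Γ)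

/-- The MALL proof to which a MALL* proof projects. -/
def StarProof.project [Fintype ι] {m : Bool} {Ω : Multiset (Cut V)} {Γ : ι → Formula V}
    (t : StarProof m Ω Γ) : Proof m Γ :=
  Quotient.mk _ ⟨t.tree, t.derives.derives⟩

/-- A linking: a set of links, which are unordered pairs of leaves. -/
abbrev Linking (V : Type u) (ι : Type v) : Type (max u v) := Set (Sym2 (Loc V ι))

/-- The set of linkings defined by a proof: one linking for each way to choose one of the premises
of every `wth` rule, consisting of the links of the remaining axioms. -/
def Tree.linkings : Tree V ι → Set (Linking V ι)
  | ax a b => {{s(a, b)}}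
  | tensor _ p q => Set.image2 (· ∪ ·) p.linkings q.linkings
  | par _ p => p.linkings
  | wth _ p q => p.linkings ∪ q.linkings
  | plus _ _ p => p.linkings
  | mix p q => Set.image2 (· ∪ ·) p.linkings q.linkings
  | cut _ _ p q => Set.image2 (· ∪ ·) p.linkings q.linkings

/-- The MALL proof `x` translates to the proof net `θ` on the MALL* sequent `Ω, Γ`. -/
def Translates [Fintype ι] {m : Bool} {Γ : ι → Formula V} (x : Proof m Γ)
    (Ω : Multiset (Cut V)) (θ : Set (Linking V ι)) : Prop :=
  ∃ t : StarProof m Ω Γ, t.tree.linkings = θ ∧ t.project = x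

/-- Two MALL proofs translate to a common proof net. -/
def CommonTranslation [Fintype ι] {m : Bool} {Γ : ι → Formula V} (x y : Proof m Γ) : Prop :=
  ∃ (Ω : Multiset (Cut V)) (θ : Set (Linking V ι)), Translates x Ω θ ∧ Translates y Ω θ

/-- Proof-net equivalence: the smallest equivalence relation that relates any two proofs with a
common translation. -/
def ProofNetEquivalent [Fintype ι] {m : Bool} {Γ : ι → Formula V} :
    Proof m Γ → Proof m Γ → Prop :=
  Relation.EqvGen CommonTranslation

end MALL

/-! Two adjacent rules can be exchanged unless the lower one consumes what the upper one generates,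
and an exchange does not alter the links that survive a choice of premises of the `wth` rules. Once
the cuts are retained under names, statement (b) is this observation together with a careful choice
of names. Statement (a) is a sequentialisation argument: a proof with retained cuts is determined,
up to commutations, by its conclusion and its linkings (`determined`).

For (a), let `s` and `t` be well-formed proofs with the same conclusion and linkings, and argue by
induction on a weight that commutations preserve. The retained cuts agree as well, since a cut shows
in the leaves below it (`cuts_eq`). The last rule of `t` is brought to the bottom of `s`, and then
the premises are compared. A `par`, `plus` or `wth` can be lowered through anything above which it
stands (`un_invert`, `wth_invert`); for `plus` the linkings reveal the chosen argument, and for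
`wth` the linkings of each premise are those that reach the corresponding argument
(`wth_linkings_left`, `wth_linkings_right`).

Suppose that `t` ends with a tensor, mix or cut `β`. Colour the leaves by the premise to which they
belong. Then every conclusion and every cut has one colour, apart from the one generated by `β`;
every link has one colour; and the linkings are all combinations of their restrictions to the two
colours (`supp_splits`). These properties pass to the subproofs of `s`, and an induction on `s`
rearranges each subproof. If it contains the occurrence or the cut generated by a tensor or cut `β`,
it becomes a proof with last rule `β` that separates the colours (`splitAt`); if all its conclusions
and cuts are coloured, it becomes a proof of one colour or a mix of two such proofs (`splitR`).

The hard case is a `wth` on `b` whose premises have become `β(p1, p2)` and `β(q1, q2)`, where `b`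
has the colour of `p1` and `q1`. To move `β` below the `wth`, `p2` and `q2` would have to be the
same proof. As all combinations of the restrictions occur, the choice made at `b` does not influence
the other colour (`wth_res_eq`); hence `p2` and `q2` have the same linkings, and they are
convertible by the induction hypothesis on the weight (`SplitAt.wth`).

For (b), choose representatives of the subproofs of a commutation in which all cuts have different
names (`exists_linear`). Where the commutation copies a subproof into both premises of a `wth`, the
copies keep their names and the rule superimposes their cuts. Both sides then have the same cuts and
linkings (`Comm.twin`), and this passes through the surrounding proof because names can always be
chosen afresh (`CommStep.twin`). As interconvertibility is an equivalence relation, (a) and (b) give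
the equivalence.

All occurrences are vertices of one parse forest, so that a sequent is a finite antichain and the
side conditions of the commutations become statements about finite sets. -/

namespace MALL

universe u v

variable {V : Type u} {ι : Type v}

open scoped Classical

noncomputable section

/-! ### The parse forest -/

/-- `x ≤ y` if the vertex `y` lies in the subtree of the parse forest with root `x`. -/
instance : PartialOrder (Loc V ι) where
  le x y := x.root = y.root ∧ x.path <:+ y.path
  le_refl x := ⟨rfl, List.suffix_refl _⟩
  le_trans _ _ _ h k := ⟨h.1.trans k.1, h.2.trans k.2⟩
  le_antisymm := by
    rintro ⟨r, l⟩ ⟨r', l'⟩ h k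
    obtain ⟨h1, h2⟩ := h
    have h3 := List.IsSuffix.eq_of_length_le h2 k.2.length_le
    dsimp only at h1 h3
    rw [h1, h3]

theorem Loc.le_def {x y : Loc V ι} : x ≤ y ↔ x.root = y.root ∧ x.path <:+ y.path := Iff.rfl

theorem Loc.root_eq_of_le {x y : Loc V ι} (h : x ≤ y) : x.root = y.root := h.1

theorem Loc.le_child (x : Loc V ι) (d : Side) : x ≤ x.child d :=
  ⟨rfl, List.suffix_cons _ _⟩

theorem Loc.child_ne (x : Loc V ι) (d : Side) : x.child d ≠ x := by
  intro h
  have := congrArg (fun y => y.path.length) h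
  simp [Loc.child] at this

theorem Loc.child_inj {x y : Loc V ι} {d e : Side} (h : x.child d = y.child e) :
    x = y ∧ d = e := by
  obtain ⟨r, l⟩ := x
  obtain ⟨r', l'⟩ := y
  simp only [Loc.child, Loc.mk.injEq, List.cons.injEq] at h ⊢
  tauto

theorem Loc.le_child_iff {x y : Loc V ι} {d : Side} :
    x ≤ y.child d ↔ x = y.child d ∨ x ≤ y := by
  obtain ⟨r, l⟩ := x
  obtain ⟨r', l'⟩ := y
  simp only [Loc.le_def, Loc.child, List.suffix_cons_iff, Loc.mk.injEq]
  tauto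

/-- The ancestors of a vertex correspond to the suffixes of one path, hence form a chain. So in an
antichain at most one element lies above a given leaf. -/
theorem Loc.le_total_of_le {x y z : Loc V ι} (h : x ≤ z) (k : y ≤ z) : x ≤ y ∨ y ≤ x := by
  have e : x.root = y.root := h.1.trans k.1.symm
  rcases List.suffix_or_suffix_of_suffix h.2 k.2 with g | g
  · exact .inl ⟨e, g⟩
  · exact .inr ⟨e.symm, g⟩

theorem Loc.side_eq_of_child_le {x z : Loc V ι} {d e : Side} (h : x.child d ≤ z)
    (k : x.child e ≤ z) : d = e := by
  have : x.child d = x.child e := by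
    rcases Loc.le_total_of_le h k with g | g
    · refine Loc.mk.injEq .. ▸ ⟨rfl, g.2.eq_of_length_le (by simp [Loc.child])⟩
    · refine Loc.mk.injEq .. ▸ ⟨rfl, (g.2.eq_of_length_le (by simp [Loc.child])).symm⟩
  exact (Loc.child_inj this).2

theorem Root.mem_names {c : ℕ} {r : Root V ι} : c ∈ r.names ↔ ∃ A, r = .cut c A := by
  cases r <;> simp [Root.names, eq_comm]

@[simp] theorem Loc.ofCut_root (c : ℕ) (A : Formula V) :
    (Loc.ofCut c A : Loc V ι).root = .cut c A := rfl

@[simp] theorem Loc.child_root (d : Side) (a : Loc V ι) : (a.child d).root = a.root := rfl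

theorem Loc.ofCut_inj {c d : ℕ} {A B : Formula V}
    (h : (Loc.ofCut c A : Loc V ι) = Loc.ofCut d B) : c = d ∧ A = B := by
  simpa [Loc.ofCut] using h

theorem Loc.ofCut_le {c : ℕ} {A : Formula V} {x : Loc V ι} :
    Loc.ofCut c A ≤ x ↔ x.root = .cut c A := by
  simp [Loc.le_def, Loc.ofCut, eq_comm]

@[simp] theorem Formula.dual_dual (A : Formula V) : A.dual.dual = A := by
  induction A <;> simp_all [Formula.dual]

/-- Duality changes the main connective. This keeps the two arguments of a cut apart, as they share
the name and differ only in their formulas. -/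
theorem Formula.dual_ne (A : Formula V) : A.dual ≠ A := by
  cases A <;> simp [Formula.dual]

/-- The subformula at the end of a path. -/
def Formula.follow (F : Formula V) : List Side → Option (Formula V)
  | [] => some F
  | d :: l =>
    match F.follow l with
    | some (.tensor A B) => some (d.pick A B)
    | some (.par A B) => some (d.pick A B)
    | some (.wth A B) => some (d.pick A B)
    | some (.plus A B) => some (d.pick A B)
    | _ => none

/-- The formula at a root, for the conclusion `Γ`. -/
def Root.formula (Γ : ι → Formula V) : Root V ι → Formula V
  | concl i => Γ i
  | cut _ A => A

/-- The formula at a vertex of the parse forest, for the conclusion `Γ`. -/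
def Loc.formula (Γ : ι → Formula V) (a : Loc V ι) : Option (Formula V) :=
  (a.root.formula Γ).follow a.path

/-! ### Rules with one premise -/

/-- The rules with one premise. -/
inductive Un (V : Type u) (ι : Type v) : Type (max u v)
  | par (a : Loc V ι)
  | plus (d : Side) (a : Loc V ι)

/-- Application of a rule. -/
def Un.node : Un V ι → Tree V ι → Tree V ι
  | par a, p => .par a p
  | plus d a, p => .plus d a p

/-- The occurrences consumed by a rule. -/
def Un.act : Un V ι → Finset (Loc V ι)
  | par a => {a.child .left, a.child .right}
  | plus d a => {a.child d}

/-- The occurrence generated by a rule. -/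
def Un.out : Un V ι → Loc V ι
  | par a => a
  | plus _ a => a

/-- The main connective of the generated occurrence is the right one. -/
def Un.Typed (Γ : ι → Formula V) : Un V ι → Prop
  | par a => ∃ A B, a.formula Γ = some (.par A B)
  | plus _ a => ∃ A B, a.formula Γ = some (.plus A B)

/-- The rule applies to the sequent `S`. -/
def Un.Fits (Γ : ι → Formula V) (u : Un V ι) (S : Finset (Loc V ι)) : Prop :=
  u.Typed Γ ∧ u.act ⊆ S ∧ u.out ∉ S

/-- The sequent to which the rule leads. -/
def Un.result (u : Un V ι) (S : Finset (Loc V ι)) : Finset (Loc V ι) :=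
  insert u.out (S \ u.act)

/-! ### Rules that join two sequents -/

/-- The rules that join two sequents; in `tensor'` the premises are exchanged. -/
inductive Bi (V : Type u) (ι : Type v) : Type (max u v)
  | tensor (a : Loc V ι)
  | tensor' (a : Loc V ι)
  | mix
  | cut (c : ℕ) (A : Formula V)

/-- Application of a rule. -/
def Bi.node : Bi V ι → Tree V ι → Tree V ι → Tree V ι
  | tensor a, p, q => .tensor a p q
  | tensor' a, p, q => .tensor a q p
  | mix, p, q => .mix p q
  | cut c A, p, q => .cut c A p q

/-- The rule with exchanged premises. -/
def Bi.flip : Bi V ι → Bi V ι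
  | tensor a => tensor' a
  | tensor' a => tensor a
  | mix => mix
  | cut c A => cut c A.dual

/-- The occurrences in the first premise consumed by a rule. -/
def Bi.actL : Bi V ι → Finset (Loc V ι)
  | tensor a => {a.child .left}
  | tensor' a => {a.child .right}
  | mix => ∅
  | cut c A => {Loc.ofCut c A}

/-- The occurrences in the second premise consumed by a rule. -/
def Bi.actR : Bi V ι → Finset (Loc V ι)
  | tensor a => {a.child .right}
  | tensor' a => {a.child .left}
  | mix => ∅
  | cut c A => {Loc.ofCut c A.dual}

/-- The occurrences generated by a rule. -/
def Bi.out : Bi V ι → Finset (Loc V ι)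
  | tensor a => {a}
  | tensor' a => {a}
  | mix => ∅
  | cut _ _ => ∅

/-- The cuts generated by a rule. -/
def Bi.cuts : Bi V ι → Finset (Cut V)
  | tensor _ => ∅
  | tensor' _ => ∅
  | mix => ∅
  | cut c A => {(c, s(A, A.dual))}

/-- The rule is available and the generated occurrence has the right main connective. -/
def Bi.Typed (Γ : ι → Formula V) (m : Bool) : Bi V ι → Prop
  | tensor a => ∃ A B, a.formula Γ = some (.tensor A B)
  | tensor' a => ∃ A B, a.formula Γ = some (.tensor A B)
  | mix => m = true
  | cut _ _ => True

/-- The rule applies to the sequents `S` and `T`. -/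
structure Bi.Fits (Γ : ι → Formula V) (m : Bool) (β : Bi V ι) (S T : Finset (Loc V ι)) :
    Prop where
  typed : β.Typed Γ m
  actL : β.actL ⊆ S
  actR : β.actR ⊆ T
  disj : Disjoint (S \ β.actL) (T \ β.actR)
  outL : Disjoint β.out S
  outR : Disjoint β.out T
  fresh : ∀ k ∈ β.cuts, ∀ x ∈ S \ β.actL ∪ T \ β.actR, k.1 ∉ x.root.names

/-- The sequent to which the rule leads. -/
def Bi.result (β : Bi V ι) (S T : Finset (Loc V ι)) : Finset (Loc V ι) :=
  β.out ∪ (S \ β.actL ∪ T \ β.actR)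

/-! ### Invariants of trees -/

/-- The conclusion of a proof. -/
def Tree.concl : Tree V ι → Finset (Loc V ι)
  | ax a b => {a, b}
  | tensor a p q => (Bi.tensor a).result p.concl q.concl
  | par a p => (Un.par a).result p.concl
  -- The context is read off from the left premise; `Valid` demands that the right premise has the
  -- same one.
  | wth a p _ => insert a (p.concl \ {a.child .left})
  | plus d a p => (Un.plus d a).result p.concl
  | mix p q => Bi.mix.result p.concl q.concl
  | cut c A p q => (Bi.cut c A).result p.concl q.concl

/-- The cuts of a proof. -/
def Tree.cuts : Tree V ι → Finset (Cut V)
  | ax _ _ => ∅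
  | tensor _ p q => p.cuts ∪ q.cuts
  | par _ p => p.cuts
  | wth _ p q => p.cuts ∪ q.cuts
  | plus _ _ p => p.cuts
  | mix p q => p.cuts ∪ q.cuts
  | cut c A p q => {(c, s(A, A.dual))} ∪ (p.cuts ∪ q.cuts)

/-- A measure that is invariant under commutations. -/
def Tree.weight : Tree V ι → ℕ
  | ax _ _ => 1
  | tensor _ p q => p.weight + q.weight + 1
  | par _ p => p.weight + 1
  -- The maximum, because commuting a rule with `wth` copies a subproof into both branches; a sum
  -- would count it twice.
  | wth _ p q => max p.weight q.weight + 1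
  | plus _ _ p => p.weight + 1
  | mix p q => p.weight + q.weight + 1
  | cut _ _ p q => p.weight + q.weight + 1

/-- The tree is a proof, of the sequent `Tree.concl`. -/
def Tree.Valid (Γ : ι → Formula V) (m : Bool) : Tree V ι → Prop
  | ax a b => ∃ P, a.formula Γ = some (.pos P) ∧ b.formula Γ = some (.neg P)
  | tensor a p q => p.Valid Γ m ∧ q.Valid Γ m ∧ (Bi.tensor a).Fits Γ m p.concl q.concl
  | par a p => p.Valid Γ m ∧ (Un.par a).Fits Γ p.concl
  | wth a p q => p.Valid Γ m ∧ q.Valid Γ m ∧ (∃ A B, a.formula Γ = some (.wth A B)) ∧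
      a.child .left ∈ p.concl ∧ a.child .right ∈ q.concl ∧ a ∉ p.concl ∧ a ∉ q.concl ∧
      p.concl \ {a.child .left} = q.concl \ {a.child .right}
  | plus d a p => p.Valid Γ m ∧ (Un.plus d a).Fits Γ p.concl
  | mix p q => p.Valid Γ m ∧ q.Valid Γ m ∧ Bi.mix.Fits Γ m p.concl q.concl
  | cut c A p q => p.Valid Γ m ∧ q.Valid Γ m ∧ (Bi.cut c A).Fits Γ m p.concl q.concl

/-- The sets of cuts have no name in common. -/
def NamesDisjoint (C D : Finset (Cut V)) : Prop := ∀ k ∈ C, ∀ l ∈ D, k.1 ≠ l.1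

theorem NamesDisjoint.symm {C D : Finset (Cut V)} (h : NamesDisjoint C D) : NamesDisjoint D C :=
  fun k hk l hl e => h l hl k hk e.symm

theorem namesDisjoint_union_left {C D E : Finset (Cut V)} :
    NamesDisjoint (C ∪ D) E ↔ NamesDisjoint C E ∧ NamesDisjoint D E := by
  simp only [NamesDisjoint, Finset.mem_union]; grind

theorem namesDisjoint_union_right {C D E : Finset (Cut V)} :
    NamesDisjoint E (C ∪ D) ↔ NamesDisjoint E C ∧ NamesDisjoint E D := by
  simp only [NamesDisjoint, Finset.mem_union]; grind

@[simp] theorem namesDisjoint_empty_left {C : Finset (Cut V)} : NamesDisjoint ∅ C := by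
  simp [NamesDisjoint]

/-- No two premises of `tensor`, `mix` or `cut` share the name of a cut. -/
def Tree.Apart : Tree V ι → Prop
  | ax _ _ => True
  | tensor _ p q => p.Apart ∧ q.Apart ∧ NamesDisjoint p.cuts q.cuts
  | par _ p => p.Apart
  -- Nothing is demanded of the names here: a cut common to both premises is one that the rule
  -- superimposes.
  | wth _ p q => p.Apart ∧ q.Apart
  | plus _ _ p => p.Apart
  | mix p q => p.Apart ∧ q.Apart ∧ NamesDisjoint p.cuts q.cuts
  | cut c A p q => p.Apart ∧ q.Apart ∧ NamesDisjoint p.cuts q.cuts ∧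
      NamesDisjoint {(c, s(A, A.dual))} p.cuts ∧ NamesDisjoint {(c, s(A, A.dual))} q.cuts

/-- Distinct occurrences in `S` are incomparable. -/
def Anti (S : Finset (Loc V ι)) : Prop := ∀ x ∈ S, ∀ y ∈ S, x ≤ y → x = y

/-- No name of a cut of `C` is free in `S`. -/
def Sep (S : Finset (Loc V ι)) (C : Finset (Cut V)) : Prop :=
  ∀ x ∈ S, ∀ k ∈ C, k.1 ∉ x.root.names

/-- Distinct cuts in `C` have distinct names. -/
def Func (C : Finset (Cut V)) : Prop := ∀ k ∈ C, ∀ l ∈ C, k.1 = l.1 → k = l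

/-- The sequent with conclusions `S` and cuts `C` is well formed. -/
structure Good (S : Finset (Loc V ι)) (C : Finset (Cut V)) : Prop where
  anti : Anti S
  sep : Sep S C
  func : Func C

/-- The tree is a proof with retained cuts. -/
structure Tree.OK (Γ : ι → Formula V) (m : Bool) (t : Tree V ι) : Prop where
  valid : t.Valid Γ m
  apart : t.Apart
  good : Good t.concl t.cuts

theorem Anti.mono {S T : Finset (Loc V ι)} (h : Anti T) (hST : S ⊆ T) : Anti S :=
  fun x hx y hy => h x (hST hx) y (hST hy)

theorem Sep.mono {S T : Finset (Loc V ι)} {C D : Finset (Cut V)} (h : Sep T D) (hST : S ⊆ T)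
    (hCD : C ⊆ D) : Sep S C :=
  fun x hx k hk => h x (hST hx) k (hCD hk)

theorem Func.mono {C D : Finset (Cut V)} (h : Func D) (hCD : C ⊆ D) : Func C :=
  fun x hx y hy => h x (hCD hx) y (hCD hy)

/-! ### Trees built with abstract rules -/

@[simp] theorem Un.concl_node (u : Un V ι) (p : Tree V ι) :
    (u.node p).concl = u.result p.concl := by
  cases u <;> rfl

@[simp] theorem Un.cuts_node (u : Un V ι) (p : Tree V ι) : (u.node p).cuts = p.cuts := by
  cases u <;> rfl

@[simp] theorem Un.linkings_node (u : Un V ι) (p : Tree V ι) :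
    (u.node p).linkings = p.linkings := by
  cases u <;> rfl

@[simp] theorem Un.weight_node (u : Un V ι) (p : Tree V ι) :
    (u.node p).weight = p.weight + 1 := by
  cases u <;> rfl

theorem Un.valid_node {Γ : ι → Formula V} {m : Bool} {u : Un V ι} {p : Tree V ι} :
    (u.node p).Valid Γ m ↔ p.Valid Γ m ∧ u.Fits Γ p.concl := by
  cases u <;> rfl

theorem Un.apart_node {u : Un V ι} {p : Tree V ι} : (u.node p).Apart ↔ p.Apart := by
  cases u <;> rfl

@[simp] theorem Bi.flip_flip (β : Bi V ι) : β.flip.flip = β := by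
  cases β <;> simp [Bi.flip]

@[simp] theorem Bi.actL_flip (β : Bi V ι) : β.flip.actL = β.actR := by
  cases β <;> simp [Bi.flip, Bi.actL, Bi.actR]

@[simp] theorem Bi.actR_flip (β : Bi V ι) : β.flip.actR = β.actL := by
  cases β <;> simp [Bi.flip, Bi.actL, Bi.actR]

@[simp] theorem Bi.out_flip (β : Bi V ι) : β.flip.out = β.out := by
  cases β <;> simp [Bi.flip, Bi.out]

@[simp] theorem Bi.cuts_flip (β : Bi V ι) : β.flip.cuts = β.cuts := by
  cases β <;> simp [Bi.flip, Bi.cuts, Sym2.eq_swap]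

@[simp] theorem Bi.typed_flip {Γ : ι → Formula V} {m : Bool} (β : Bi V ι) :
    β.flip.Typed Γ m ↔ β.Typed Γ m := by
  cases β <;> simp [Bi.flip, Bi.Typed]

theorem Bi.result_flip (β : Bi V ι) (S T : Finset (Loc V ι)) :
    β.flip.result S T = β.result T S := by
  simp [Bi.result, Finset.union_comm]

/-- Since `tensor'` is the tensor with its premises read in the other order, every joining rule has
a flip that yields the same proof, and arguments about one premise transfer to the other. -/
theorem Bi.Fits.flip {Γ : ι → Formula V} {m : Bool} {β : Bi V ι} {S T : Finset (Loc V ι)}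
    (h : β.Fits Γ m S T) : β.flip.Fits Γ m T S where
  typed := by simpa using h.typed
  actL := by simpa using h.actR
  actR := by simpa using h.actL
  disj := by simpa using h.disj.symm
  outL := by simpa using h.outR
  outR := by simpa using h.outL
  fresh := by simpa [or_comm] using h.fresh

theorem Bi.fits_flip {Γ : ι → Formula V} {m : Bool} {β : Bi V ι} {S T : Finset (Loc V ι)} :
    β.flip.Fits Γ m S T ↔ β.Fits Γ m T S :=
  ⟨fun h => by simpa using h.flip, Bi.Fits.flip⟩

@[simp] theorem Bi.concl_node (β : Bi V ι) (p q : Tree V ι) :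
    (β.node p q).concl = β.result p.concl q.concl := by
  cases β with
  | tensor' a => exact (Bi.result_flip (.tensor' a) _ _)
  | _ => rfl

@[simp] theorem Bi.cuts_node (β : Bi V ι) (p q : Tree V ι) :
    (β.node p q).cuts = β.cuts ∪ (p.cuts ∪ q.cuts) := by
  cases β <;> simp [Bi.node, Tree.cuts, Bi.cuts, Finset.union_comm]

@[simp] theorem Bi.linkings_node (β : Bi V ι) (p q : Tree V ι) :
    (β.node p q).linkings = Set.image2 (· ∪ ·) p.linkings q.linkings := by
  cases β with
  | tensor' a => exact Set.image2_comm fun _ _ => Set.union_comm _ _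
  | _ => rfl

@[simp] theorem Bi.weight_node (β : Bi V ι) (p q : Tree V ι) :
    (β.node p q).weight = p.weight + q.weight + 1 := by
  cases β <;> simp [Bi.node, Tree.weight, add_comm]

theorem Bi.valid_node {Γ : ι → Formula V} {m : Bool} {β : Bi V ι} {p q : Tree V ι} :
    (β.node p q).Valid Γ m ↔ p.Valid Γ m ∧ q.Valid Γ m ∧ β.Fits Γ m p.concl q.concl := by
  cases β with
  | tensor' a =>
    have : (Bi.tensor' a).Fits Γ m p.concl q.concl ↔ (Bi.tensor a).Fits Γ m q.concl p.concl :=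
      Bi.fits_flip (β := .tensor a)
    rw [this, Bi.node, Tree.Valid]; tauto
  | _ => rfl

theorem Bi.apart_node {β : Bi V ι} {p q : Tree V ι} :
    (β.node p q).Apart ↔ p.Apart ∧ q.Apart ∧ NamesDisjoint p.cuts q.cuts ∧
      NamesDisjoint β.cuts p.cuts ∧ NamesDisjoint β.cuts q.cuts := by
  have : NamesDisjoint q.cuts p.cuts ↔ NamesDisjoint p.cuts q.cuts :=
    ⟨NamesDisjoint.symm, NamesDisjoint.symm⟩
  cases β <;> simp [Bi.node, Tree.Apart, Bi.cuts, this]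
  tauto

/-- Every proof tree is an axiom, or arises by a rule from one or two trees. -/
theorem Tree.rec_rules {motive : Tree V ι → Prop} (ax : ∀ a b, motive (.ax a b))
    (un : ∀ (u : Un V ι) p, motive p → motive (u.node p))
    (bi : ∀ (β : Bi V ι) p q, motive p → motive q → motive (β.node p q))
    (wth : ∀ a p q, motive p → motive q → motive (.wth a p q)) (t : Tree V ι) : motive t := by
  induction t with
  | ax a b => exact ax a b
  | tensor a p q hp hq => exact bi (.tensor a) p q hp hq
  | par a p hp => exact un (.par a) p hp
  | wth a p q hp hq => exact wth a p q hp hq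
  | plus d a p hp => exact un (.plus d a) p hp
  | mix p q hp hq => exact bi .mix p q hp hq
  | cut c A p q hp hq => exact bi (.cut c A) p q hp hq

variable {Γ : ι → Formula V} {m : Bool}

/-! ### Premises of well-formed proofs -/

/-- A vertex comparable with a child of `a` is comparable with `a` itself, and the two children are
incomparable with each other. -/
theorem Anti.children {T : Finset (Loc V ι)} (h : Anti T) {a : Loc V ι} (ha : a ∈ T) :
    Anti (T \ {a} ∪ {a.child .left, a.child .right}) := by
  have key : ∀ d, ∀ x ∈ T, x ≠ a → ¬ x ≤ a.child d ∧ ¬ a.child d ≤ x := by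
    intro d x hx hxa
    constructor
    · intro hle
      rcases Loc.le_child_iff.1 hle with rfl | hle
      · exact hxa (h a ha _ hx (a.le_child d)).symm
      · exact hxa (h x hx a ha hle)
    · intro hle
      exact hxa (h a ha x hx ((a.le_child d).trans hle)).symm
  have key2 : ∀ d e, a.child d ≤ a.child e → a.child d = a.child e := by
    intro d e hle
    rw [Loc.side_eq_of_child_le hle le_rfl]
  intro x hx y hy hle
  simp only [Finset.mem_union, Finset.mem_sdiff, Finset.mem_insert, Finset.mem_singleton] at hx hy
  rcases hx with ⟨hx, hxa⟩ | rfl | rfl <;> rcases hy with ⟨hy, hya⟩ | rfl | rfl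
  · exact h x hx y hy hle
  · exact absurd hle (key _ x hx hxa).1
  · exact absurd hle (key _ x hx hxa).1
  · exact absurd hle (key _ y hy hya).2
  · rfl
  · exact key2 _ _ hle
  · exact absurd hle (key _ y hy hya).2
  · exact key2 _ _ hle
  · rfl

theorem Anti.child_notMem {T : Finset (Loc V ι)} (h : Anti T) {a : Loc V ι} (ha : a ∈ T)
    (d : Side) : a.child d ∉ T :=
  fun hd => a.child_ne d (h a ha _ hd (a.le_child d)).symm

theorem Bi.act_fresh {β : Bi V ι} {T : Finset (Loc V ι)} (hT : Anti T) (ho : β.out ⊆ T)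
    (hs : Sep T β.cuts) : ∀ x ∈ T, x ∉ β.actL ∧ x ∉ β.actR := by
  intro x hx
  cases β with
  | tensor a =>
    have ha : a ∈ T := ho (by simp [Bi.out])
    have h1 := hT.child_notMem ha .left
    have h2 := hT.child_notMem ha .right
    simp only [Bi.actL, Bi.actR, Finset.mem_singleton]
    exact ⟨fun h => h1 (h ▸ hx), fun h => h2 (h ▸ hx)⟩
  | tensor' a =>
    have ha : a ∈ T := ho (by simp [Bi.out])
    have h1 := hT.child_notMem ha .left
    have h2 := hT.child_notMem ha .right
    simp only [Bi.actL, Bi.actR, Finset.mem_singleton]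
    exact ⟨fun h => h2 (h ▸ hx), fun h => h1 (h ▸ hx)⟩
  | mix => simp [Bi.actL, Bi.actR]
  | cut c A =>
    have := hs x hx (c, s(A, A.dual)) (by simp [Bi.cuts])
    simp only [Bi.actL, Bi.actR, Finset.mem_singleton]
    constructor <;> rintro rfl <;> exact this (by simp [Root.names])

/-- Read upwards, a tensor replaces a vertex by its children. A cut adds two new roots: their name
occurs nowhere in `T`, and they differ from each other because no formula is its own dual. -/
theorem Bi.anti_expand {β : Bi V ι} {T : Finset (Loc V ι)} (hT : Anti T) (ho : β.out ⊆ T)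
    (hs : Sep T β.cuts) : Anti (T \ β.out ∪ (β.actL ∪ β.actR)) := by
  cases β with
  | tensor a => exact hT.children (ho (by simp [Bi.out]))
  | tensor' a =>
    have : ((Bi.tensor' a).actL ∪ (Bi.tensor' a).actR : Finset (Loc V ι)) =
        {a.child .left, a.child .right} := by
      ext; simp [Bi.actL, Bi.actR, or_comm]
    rw [this]
    exact hT.children (ho (by simp [Bi.out]))
  | mix => simpa [Bi.out, Bi.actL, Bi.actR] using hT
  | cut c A =>
    have h1 : ∀ x ∈ T, ∀ B, x.root ≠ .cut c B := fun x hx B hB =>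
      hs x hx (c, s(A, A.dual)) (by simp [Bi.cuts]) (by simp [hB, Root.names])
    intro x hx y hy hle
    simp only [Bi.out, Bi.actL, Bi.actR, Finset.mem_union, Finset.mem_sdiff,
      Finset.mem_singleton, Finset.notMem_empty, not_false_eq_true, and_true] at hx hy
    have h2 := Loc.root_eq_of_le hle
    rcases hx with hx | rfl | rfl <;> rcases hy with hy | rfl | rfl
    · exact hT x hx y hy hle
    · exact absurd h2 (h1 x hx _)
    · exact absurd h2 (h1 x hx _)
    · exact absurd h2.symm (h1 y hy _)
    · rfl
    · simp at h2; exact absurd h2.symm A.dual_ne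
    · exact absurd h2.symm (h1 y hy _)
    · simp at h2; exact absurd h2 A.dual_ne
    · rfl

theorem Bi.act_disjoint (β : Bi V ι) : ∀ x ∈ β.actL, x ∉ β.actR := by
  cases β with
  | tensor a =>
    simp only [Bi.actL, Bi.actR, Finset.mem_singleton]
    rintro x rfl h
    cases (Loc.child_inj h).2
  | tensor' a =>
    simp only [Bi.actL, Bi.actR, Finset.mem_singleton]
    rintro x rfl h
    cases (Loc.child_inj h).2
  | mix => simp [Bi.actL]
  | cut c A =>
    simp only [Bi.actL, Bi.actR, Finset.mem_singleton]
    rintro x rfl h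
    exact A.dual_ne (Loc.ofCut_inj h).2.symm

theorem Bi.act_root {β : Bi V ι} {x : Loc V ι} (h : x ∈ β.actL ∨ x ∈ β.actR) :
    (∃ y ∈ β.out, x.root = y.root) ∨ ∃ k ∈ β.cuts, ∀ c ∈ x.root.names, c = k.1 := by
  cases β <;> simp [Bi.actL, Bi.actR, Bi.out, Bi.cuts] at h ⊢
  · rcases h with rfl | rfl <;> rfl
  · rcases h with rfl | rfl <;> rfl
  · rcases h with rfl | rfl <;> simp [Root.names]

/-- The relation between the two premises of a rule that joins two sequents. -/
structure Bi.Premises (β : Bi V ι) (p q : Tree V ι) : Prop where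
  anti : Anti (p.concl ∪ q.concl)
  disj : Disjoint p.concl q.concl
  sep : Sep (p.concl ∪ q.concl) (p.cuts ∪ q.cuts)
  func : Func (p.cuts ∪ q.cuts)
  names : NamesDisjoint p.cuts q.cuts

/-- Well-formedness is inherited upwards. An occurrence of a premise either survives in the
conclusion or is consumed, and then it lies under the generated occurrence or belongs to the
generated cut. -/
theorem Bi.premises {β : Bi V ι} {p q : Tree V ι} (h : (β.node p q).OK Γ m) :
    β.Premises p q := by
  obtain ⟨hv, ha, hg⟩ := h
  obtain ⟨-, -, hF⟩ := Bi.valid_node.1 hv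
  obtain ⟨-, -, hn, hnp, hnq⟩ := Bi.apart_node.1 ha
  rw [Bi.concl_node, Bi.cuts_node] at hg
  have ho : β.out ⊆ β.result p.concl q.concl := Finset.subset_union_left
  have hs : Sep (β.result p.concl q.concl) β.cuts :=
    hg.sep.mono subset_rfl Finset.subset_union_left
  have hanti := Bi.anti_expand hg.anti ho hs
  have hfr := Bi.act_fresh hg.anti ho hs
  have hd := β.act_disjoint
  have h3 := hF.disj
  have h4 := hF.outL
  have h5 := hF.outR
  rw [Finset.disjoint_left] at h3 h4 h5
  refine ⟨hanti.mono ?_, ?_, ?_, hg.func.mono Finset.subset_union_right, hn⟩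
  · intro x hx
    simp only [Bi.result]
    grind
  · rw [Finset.disjoint_left]
    intro x hx hy
    simp only [Bi.result, Finset.mem_union, Finset.mem_sdiff] at hfr h3
    have h6 := hd x
    have h7 := hfr x
    have h8 := h3 (a := x)
    tauto
  · intro x hx k hk hkx
    by_cases hxa : x ∈ β.actL ∨ x ∈ β.actR
    · rcases Bi.act_root hxa with ⟨y, hy, hxy⟩ | ⟨l, hl, hxl⟩
      · exact hg.sep y (ho hy) k (Finset.mem_union_right _ hk) (hxy ▸ hkx)
      · rcases Finset.mem_union.1 hk with hk | hk
        · exact hnp l hl k hk (hxl _ hkx).symm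
        · exact hnq l hl k hk (hxl _ hkx).symm
    · refine hg.sep x ?_ k (Finset.mem_union_right _ hk) hkx
      simp only [Bi.result]
      grind

theorem Bi.ok_left {β : Bi V ι} {p q : Tree V ι} (h : (β.node p q).OK Γ m) : p.OK Γ m :=
  have k := Bi.premises h
  ⟨(Bi.valid_node.1 h.valid).1, (Bi.apart_node.1 h.apart).1,
    k.anti.mono Finset.subset_union_left,
    k.sep.mono Finset.subset_union_left Finset.subset_union_left,
    k.func.mono Finset.subset_union_left⟩

theorem Bi.ok_right {β : Bi V ι} {p q : Tree V ι} (h : (β.node p q).OK Γ m) : q.OK Γ m :=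
  have k := Bi.premises h
  ⟨(Bi.valid_node.1 h.valid).2.1, (Bi.apart_node.1 h.apart).2.1,
    k.anti.mono Finset.subset_union_right,
    k.sep.mono Finset.subset_union_right Finset.subset_union_right,
    k.func.mono Finset.subset_union_right⟩

theorem Bi.ok_fits {β : Bi V ι} {p q : Tree V ι} (h : (β.node p q).OK Γ m) :
    β.Fits Γ m p.concl q.concl := (Bi.valid_node.1 h.valid).2.2

theorem Good.of_child {S T : Finset (Loc V ι)} {C D : Finset (Cut V)} {a : Loc V ι}
    (h : Good T D) (ha : a ∈ T) (hS : S ⊆ T \ {a} ∪ {a.child .left, a.child .right})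
    (hC : C ⊆ D) : Good S C := by
  refine ⟨(h.anti.children ha).mono hS, ?_, h.func.mono hC⟩
  intro x hx k hk
  have := hS hx
  simp only [Finset.mem_union, Finset.mem_sdiff, Finset.mem_insert, Finset.mem_singleton] at this
  rcases this with ⟨hx, -⟩ | rfl | rfl
  · exact h.sep x hx k (hC hk)
  · exact h.sep a ha k (hC hk)
  · exact h.sep a ha k (hC hk)

theorem Un.act_subset (u : Un V ι) : u.act ⊆ {u.out.child .left, u.out.child .right} := by
  cases u with
  | par a => rfl
  | plus d a => cases d <;> simp [Un.act, Un.out]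

theorem Un.child_of_mem_act {u : Un V ι} {x : Loc V ι} (h : x ∈ u.act) :
    ∃ d, x = u.out.child d := by
  have := u.act_subset h
  simp only [Finset.mem_insert, Finset.mem_singleton] at this
  tauto

theorem Un.act_nonempty (u : Un V ι) : u.act.Nonempty := by
  cases u <;> simp [Un.act]

theorem Un.act_fresh {u : Un V ι} {T : Finset (Loc V ι)} (hT : Anti T) (ho : u.out ∈ T) :
    ∀ x ∈ T, x ∉ u.act := by
  intro x hx h
  obtain ⟨d, rfl⟩ := Un.child_of_mem_act h
  exact hT.child_notMem ho d hx

theorem Un.ok_premise {u : Un V ι} {p : Tree V ι} (h : (u.node p).OK Γ m) : p.OK Γ m := by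
  obtain ⟨hv, ha, hg⟩ := h
  rw [Un.concl_node, Un.cuts_node] at hg
  have hF := (Un.valid_node.1 hv).2
  refine ⟨(Un.valid_node.1 hv).1, Un.apart_node.1 ha, hg.of_child (a := u.out) ?_ ?_ subset_rfl⟩
  · simp [Un.result]
  · have h1 := u.act_subset
    have h2 := hF.2.2
    simp only [Un.result]
    grind

theorem Un.ok_fits {u : Un V ι} {p : Tree V ι} (h : (u.node p).OK Γ m) :
    u.Fits Γ p.concl := (Un.valid_node.1 h.valid).2

/-- The conditions under which the `wth` rule that generates `a` applies. -/
structure WthFits (Γ : ι → Formula V) (a : Loc V ι) (S T : Finset (Loc V ι)) : Prop where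
  typed : ∃ A B, a.formula Γ = some (.wth A B)
  left : a.child .left ∈ S
  right : a.child .right ∈ T
  notMem_left : a ∉ S
  notMem_right : a ∉ T
  eq : S \ {a.child .left} = T \ {a.child .right}

theorem wth_valid {a : Loc V ι} {p q : Tree V ι} :
    (Tree.wth a p q).Valid Γ m ↔ p.Valid Γ m ∧ q.Valid Γ m ∧ WthFits Γ a p.concl q.concl :=
  ⟨fun ⟨h1, h2, h3, h4, h5, h6, h7, h8⟩ => ⟨h1, h2, h3, h4, h5, h6, h7, h8⟩,
    fun ⟨h1, h2, h3, h4, h5, h6, h7, h8⟩ => ⟨h1, h2, h3, h4, h5, h6, h7, h8⟩⟩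

theorem wth_fits {a : Loc V ι} {p q : Tree V ι} (h : (Tree.wth a p q).OK Γ m) :
    WthFits Γ a p.concl q.concl := (wth_valid.1 h.valid).2.2

theorem wth_ok_left {a : Loc V ι} {p q : Tree V ι} (h : (Tree.wth a p q).OK Γ m) :
    p.OK Γ m := by
  have k := wth_fits h
  refine ⟨h.valid.1, h.apart.1, h.good.of_child (a := a) ?_ ?_ Finset.subset_union_left⟩
  · simp [Tree.concl]
  · have h2 := k.notMem_left
    simp only [Tree.concl]
    grind

theorem wth_ok_right {a : Loc V ι} {p q : Tree V ι} (h : (Tree.wth a p q).OK Γ m) :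
    q.OK Γ m := by
  have k := wth_fits h
  refine ⟨h.valid.2.1, h.apart.2, h.good.of_child (a := a) ?_ ?_ Finset.subset_union_right⟩
  · simp [Tree.concl]
  · have h2 := k.notMem_right
    have h3 := k.eq
    simp only [Tree.concl]
    grind

/-! ### Conversions of proofs with retained cuts -/

variable (Γ m) in
/-- Convertibility by commutations between proofs with retained cuts, and exchange of the premises
of `mix` and `cut`. -/
inductive Conv : Tree V ι → Tree V ι → Prop
  | refl (p : Tree V ι) : Conv p p
  | symm {p q : Tree V ι} : Conv p q → Conv q p
  | trans {p q r : Tree V ι} : Conv p q → Conv q r → Conv p r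
  | comm {p q : Tree V ι} : Comm p q → p.OK Γ m → q.OK Γ m → p.concl = q.concl → Conv p q
  | mix_swap (p q : Tree V ι) : Conv (.mix p q) (.mix q p)
  | cut_swap (c : ℕ) (A : Formula V) (p q : Tree V ι) : Conv (.cut c A p q) (.cut c A.dual q p)
  | tensor {a : Loc V ι} {p p' q q' : Tree V ι} :
      Conv p p' → Conv q q' → Conv (.tensor a p q) (.tensor a p' q')
  | par {a : Loc V ι} {p p' : Tree V ι} : Conv p p' → Conv (.par a p) (.par a p')
  | wth {a : Loc V ι} {p p' q q' : Tree V ι} :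
      Conv p p' → Conv q q' → Conv (.wth a p q) (.wth a p' q')
  | plus {d : Side} {a : Loc V ι} {p p' : Tree V ι} :
      Conv p p' → Conv (.plus d a p) (.plus d a p')
  | mix {p p' q q' : Tree V ι} : Conv p p' → Conv q q' → Conv (.mix p q) (.mix p' q')
  | cut {c : ℕ} {A : Formula V} {p p' q q' : Tree V ι} :
      Conv p p' → Conv q q' → Conv (.cut c A p q) (.cut c A p' q')

/-! ### Invariants of conversions -/

theorem Comm.cuts_eq {p q : Tree V ι} (h : Comm p q) : p.cuts = q.cuts := by
  cases h <;> simp only [Tree.cuts] <;> grind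

theorem Comm.weight_eq {p q : Tree V ι} (h : Comm p q) : p.weight = q.weight := by
  cases h <;> simp only [Tree.weight] <;> omega

theorem image2_union_assoc {α : Type*} (A B C : Set (Set α)) :
    Set.image2 (· ∪ ·) A (Set.image2 (· ∪ ·) B C) =
      Set.image2 (· ∪ ·) (Set.image2 (· ∪ ·) A B) C :=
  (Set.image2_assoc fun a b c => Set.union_assoc a b c).symm

theorem image2_union_comm {α : Type*} (A B : Set (Set α)) :
    Set.image2 (· ∪ ·) A B = Set.image2 (· ∪ ·) B A :=
  Set.image2_comm fun _ _ => Set.union_comm _ _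

theorem image2_union_left_comm {α : Type*} (A B C : Set (Set α)) :
    Set.image2 (· ∪ ·) A (Set.image2 (· ∪ ·) B C) =
      Set.image2 (· ∪ ·) B (Set.image2 (· ∪ ·) A C) := by
  rw [image2_union_assoc, image2_union_assoc, image2_union_comm A B]

theorem image2_union_right_comm {α : Type*} (A B C : Set (Set α)) :
    Set.image2 (· ∪ ·) (Set.image2 (· ∪ ·) A B) C =
      Set.image2 (· ∪ ·) (Set.image2 (· ∪ ·) A C) B := by
  rw [← image2_union_assoc, ← image2_union_assoc, image2_union_comm B C]

/-- Joining rules form all pairwise unions of linkings and `wth` the union of the two sets. The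
commutations only need that pairwise union is associative and commutative and distributes over
unions of sets. -/
theorem Comm.linkings_eq {p q : Tree V ι} (h : Comm p q) : p.linkings = q.linkings := by
  cases h <;> simp only [Tree.linkings, Set.image2_union_left, Set.image2_union_right]
  all_goals first
    | exact image2_union_assoc _ _ _
    | exact image2_union_left_comm _ _ _
    | exact image2_union_right_comm _ _ _
    | exact Set.union_union_union_comm _ _ _ _

variable (Γ m) in
/-- The invariants of trees agree. -/
structure Agree (p q : Tree V ι) : Prop where
  concl : p.concl = q.concl
  cuts : p.cuts = q.cuts
  linkings : p.linkings = q.linkings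
  weight : p.weight = q.weight
  valid : p.Valid Γ m ↔ q.Valid Γ m
  apart : p.Apart ↔ q.Apart

theorem Agree.ok {p q : Tree V ι} (h : Agree Γ m p q) (k : p.OK Γ m) : q.OK Γ m :=
  ⟨h.valid.1 k.valid, h.apart.1 k.apart, h.concl ▸ h.cuts ▸ k.good⟩

theorem Agree.un {u : Un V ι} {p p' : Tree V ι} (h : Agree Γ m p p') :
    Agree Γ m (u.node p) (u.node p') where
  concl := by simp [h.concl]
  cuts := by simp [h.cuts]
  linkings := by simp [h.linkings]
  weight := by simp [h.weight]
  valid := by rw [Un.valid_node, Un.valid_node, h.concl, h.valid]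
  apart := by rw [Un.apart_node, Un.apart_node, h.apart]

theorem Agree.bi {β : Bi V ι} {p p' q q' : Tree V ι} (h : Agree Γ m p p')
    (k : Agree Γ m q q') : Agree Γ m (β.node p q) (β.node p' q') where
  concl := by simp [h.concl, k.concl]
  cuts := by simp [h.cuts, k.cuts]
  linkings := by simp [h.linkings, k.linkings]
  weight := by simp [h.weight, k.weight]
  valid := by rw [Bi.valid_node, Bi.valid_node, h.concl, h.valid, k.concl, k.valid]
  apart := by rw [Bi.apart_node, Bi.apart_node, h.cuts, h.apart, k.cuts, k.apart]

theorem Agree.wth {a : Loc V ι} {p p' q q' : Tree V ι} (h : Agree Γ m p p')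
    (k : Agree Γ m q q') : Agree Γ m (.wth a p q) (.wth a p' q') where
  concl := by simp [Tree.concl, h.concl]
  cuts := by simp [Tree.cuts, h.cuts, k.cuts]
  linkings := by simp [Tree.linkings, h.linkings, k.linkings]
  weight := by simp [Tree.weight, h.weight, k.weight]
  valid := by rw [wth_valid, wth_valid, h.concl, h.valid, k.concl, k.valid]
  apart := by rw [Tree.Apart, Tree.Apart, h.apart, k.apart]

theorem Agree.flip (β : Bi V ι) (p q : Tree V ι) :
    Agree Γ m (β.node p q) (β.flip.node q p) where
  concl := by simp [Bi.result_flip]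
  cuts := by simp [Finset.union_comm]
  linkings := by simp only [Bi.linkings_node]; exact image2_union_comm _ _
  weight := by simp [add_comm]
  valid := by rw [Bi.valid_node, Bi.valid_node, Bi.fits_flip]; tauto
  apart := by
    rw [Bi.apart_node, Bi.apart_node, Bi.cuts_flip]
    have : NamesDisjoint q.cuts p.cuts ↔ NamesDisjoint p.cuts q.cuts :=
      ⟨NamesDisjoint.symm, NamesDisjoint.symm⟩
    tauto

/-- Cuts, linkings and weight agree for any commutation of bare trees; well-formedness and equality
of the conclusions do not, which is why the constructor `comm` carries them. -/
theorem Conv.agree {p q : Tree V ι} (h : Conv Γ m p q) : Agree Γ m p q := by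
  induction h with
  | refl p => exact ⟨rfl, rfl, rfl, rfl, .rfl, .rfl⟩
  | symm _ h => exact ⟨h.1.symm, h.2.symm, h.3.symm, h.4.symm, h.5.symm, h.6.symm⟩
  | trans _ _ h k =>
    exact ⟨h.1.trans k.1, h.2.trans k.2, h.3.trans k.3, h.4.trans k.4, h.5.trans k.5,
      h.6.trans k.6⟩
  | comm h hp hq hc =>
    exact ⟨hc, h.cuts_eq, h.linkings_eq, h.weight_eq, iff_of_true hp.valid hq.valid,
      iff_of_true hp.apart hq.apart⟩
  | mix_swap p q => exact Agree.flip .mix p q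
  | cut_swap c A p q => exact Agree.flip (.cut c A) p q
  | tensor _ _ h k => exact Agree.bi (β := .tensor _) h k
  | par _ h => exact Agree.un (u := .par _) h
  | wth _ _ h k => exact Agree.wth h k
  | plus _ h => exact Agree.un (u := .plus _ _) h
  | mix _ _ h k => exact Agree.bi (β := .mix) h k
  | cut _ _ h k => exact Agree.bi (β := .cut _ _) h k

theorem Conv.ok {p q : Tree V ι} (h : Conv Γ m p q) (k : p.OK Γ m) : q.OK Γ m := h.agree.ok k

theorem Conv.un {u : Un V ι} {p p' : Tree V ι} (h : Conv Γ m p p') :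
    Conv Γ m (u.node p) (u.node p') := by
  cases u
  · exact .par h
  · exact .plus h

theorem Conv.bi {β : Bi V ι} {p p' q q' : Tree V ι} (h : Conv Γ m p p') (k : Conv Γ m q q') :
    Conv Γ m (β.node p q) (β.node p' q') := by
  cases β
  · exact .tensor h k
  · exact .tensor k h
  · exact .mix h k
  · exact .cut h k

theorem Conv.flip (β : Bi V ι) (p q : Tree V ι) :
    Conv Γ m (β.node p q) (β.flip.node q p) := by
  cases β
  · exact .refl _
  · exact .refl _
  · exact .mix_swap _ _
  · exact .cut_swap _ _ _ _

theorem Conv.flip' (β : Bi V ι) (p q : Tree V ι) :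
    Conv Γ m (β.flip.node p q) (β.node q p) := (Conv.flip β q p).symm

/-- The listed commutations fix the order of the premises of mix and cut; the other orders are
reached by swapping before and after. -/
theorem Conv.of_comm {p p' q' q : Tree V ι} (hc : Comm p' q') (hp : Conv Γ m p p')
    (hq : Conv Γ m q q') (okp : p.OK Γ m) (okq : q.OK Γ m) (h : p.concl = q.concl) :
    Conv Γ m p q :=
  hp.trans ((Conv.comm hc (hp.ok okp) (hq.ok okq)
    (hp.agree.concl.symm.trans (h.trans hq.agree.concl))).trans hq.symm)

/-! ### The commutations of abstract rules -/

/-- The only obstruction to exchanging two such rules is that the lower one consumes what the upper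
one generates. All other side conditions follow because the sequents involved are antichains. -/
theorem un_un {u w : Un V ι} {p : Tree V ι} (h : (u.node (w.node p)).OK Γ m)
    (hw : w.out ∉ u.act) :
    Conv Γ m (u.node (w.node p)) (w.node (u.node p)) := by
  have h1 := Un.ok_premise h
  have hu := Un.ok_fits h
  have hw' := Un.ok_fits h1
  have ho : w.out ∈ (u.node (w.node p)).concl := by
    simp only [Un.concl_node, Un.result]; grind
  have f1 := Un.act_fresh (u := w) h.good.anti ho
  have f2 := Un.act_fresh (u := u) h.good.anti (by simp [Un.result])
  have f3 := Un.act_fresh (u := w) h1.good.anti (by simp [Un.result])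
  obtain ⟨t1, a1, o1⟩ := hu
  obtain ⟨t2, a2, o2⟩ := hw'
  simp only [Un.concl_node, Un.result] at *
  -- What `u` consumes belongs to the sequent that contains `w.out`; in an antichain none of it can
  -- be a child of `w.out`.
  have hd : ∀ x ∈ u.act, x ∉ w.act := fun x hx => f3 x (a1 hx)
  have e : insert w.out (insert u.out (p.concl \ u.act) \ w.act) =
      insert u.out (insert w.out (p.concl \ w.act) \ u.act) := by
    have := f1 u.out (by simp)
    ext x; have := hd x; grind
  have hok : (w.node (u.node p)).OK Γ m := by
    refine ⟨?_, ?_, ?_⟩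
    · rw [Un.valid_node, Un.valid_node]
      refine ⟨⟨(Un.ok_premise h1).valid, t1, ?_, ?_⟩, t2, ?_, ?_⟩
      · intro x hx; have := a1 hx; grind
      · have := f1 u.out (by simp); grind
      · intro x hx; have := hd x; simp only [Un.concl_node, Un.result]; grind
      · simp only [Un.concl_node, Un.result]; grind
    · rw [Un.apart_node, Un.apart_node]; exact (Un.ok_premise h1).apart
    · have := h.good; simp only [Un.concl_node, Un.cuts_node, Un.result] at this ⊢
      rwa [e]
  have hc : (u.node (w.node p)).concl = (w.node (u.node p)).concl := by
    simp only [Un.concl_node, Un.result, e]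
  cases u <;> cases w
  · exact .comm (.par_par _ _ _) h hok hc
  · exact .comm (.plus_par _ _ _ _) h hok hc
  · exact (Conv.comm (.plus_par _ _ _ _) hok h hc.symm).symm
  · exact .comm (.plus_plus _ _ _ _ _) h hok hc

theorem un_bi {β : Bi V ι} {u : Un V ι} {p q : Tree V ι} (h : (β.node p (u.node q)).OK Γ m)
    (hu : u.out ∉ β.actR) :
    Conv Γ m (β.node p (u.node q)) (u.node (β.node p q)) := by
  have hp := Bi.ok_left h
  have huq := Bi.ok_right h
  have hq := Un.ok_premise huq
  have k := Bi.premises h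
  have hF := Bi.ok_fits h
  have hU := Un.ok_fits huq
  obtain ⟨t, a, o⟩ := hU
  obtain ⟨t', l, r, d, ol, or, fr⟩ := hF
  have f2 := Un.act_fresh (u := u) h.good.anti
    (by simp only [Bi.concl_node, Un.concl_node, Bi.result, Un.result]; grind)
  have f3 := Un.act_fresh (u := u) k.anti
    (by simp only [Un.concl_node, Un.result]; grind)
  have ha := Bi.apart_node.1 h.apart
  have hg := h.good
  have d2 := k.disj
  simp only [Bi.concl_node, Un.concl_node, Bi.result, Un.result, Finset.disjoint_left,
    Finset.mem_union, Finset.mem_sdiff, Finset.mem_insert, Un.cuts_node, Bi.cuts_node,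
    Finset.subset_iff, Un.apart_node] at *
  have e : β.out ∪ (p.concl \ β.actL ∪ insert u.out (q.concl \ u.act) \ β.actR) =
      insert u.out ((β.out ∪ (p.concl \ β.actL ∪ q.concl \ β.actR)) \ u.act) := by
    ext x; simp only [Finset.mem_union, Finset.mem_sdiff, Finset.mem_insert]
    have := f2 x; have := f3 x; have := @d x; grind
  have hok : (u.node (β.node p q)).OK Γ m := by
    refine ⟨?_, ?_, ?_⟩
    · rw [Un.valid_node, Bi.valid_node]
      refine ⟨⟨hp.valid, hq.valid, t', l, ?_, ?_, ?_, ?_, ?_⟩, t, ?_, ?_⟩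
      · intro x hx; have := @r x hx; grind
      · rw [Finset.disjoint_left]; intro x; have := @d2 x; have := f3 x; grind
      · rw [Finset.disjoint_left]; intro x; exact @ol x
      · rw [Finset.disjoint_left]; intro x; have := @or x; have := f2 x; grind
      · intro k' hk x hx
        by_cases hxa : x ∈ u.act
        · obtain ⟨s, rfl⟩ := Un.child_of_mem_act hxa
          exact hg.sep u.out (by grind) k' (by grind)
        · exact hg.sep x (by grind) k' (by grind)
      · intro x hx; have := @a x hx; have := @r x; simp only [Bi.concl_node, Bi.result]; grind
      · simp only [Bi.concl_node, Bi.result]; have := @d2 u.out; have := @or u.out; grind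
    · rw [Un.apart_node, Bi.apart_node]; exact ha
    · simp only [Bi.concl_node, Un.concl_node, Bi.result, Un.result, Un.cuts_node, Bi.cuts_node]
      rwa [← e]
  have hc : (β.node p (u.node q)).concl = (u.node (β.node p q)).concl := by
    simp only [Bi.concl_node, Un.concl_node, Bi.result, Un.result, e]
  cases u <;> cases β
  · exact .comm (.par_tensor _ _ _ _) h hok hc
  · exact .comm (.par_tensor' _ _ _ _) h hok hc
  · exact .comm (.par_mix _ _ _) h hok hc
  · exact .comm (.par_cut _ _ _ _ _) h hok hc
  · exact .comm (.plus_tensor _ _ _ _ _) h hok hc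
  · exact .comm (.plus_tensor' _ _ _ _ _) h hok hc
  · exact .comm (.plus_mix _ _ _ _) h hok hc
  · exact .comm (.plus_cut _ _ _ _ _ _) h hok hc

/-- The condition is genuine: a `par` may take its arguments from both premises of a joining rule
and then cannot be raised. When it holds, the raised proof is well formed and `un_bi` can be read
backwards. -/
theorem bi_un {β : Bi V ι} {u : Un V ι} {p q : Tree V ι} (h : (u.node (β.node p q)).OK Γ m)
    (hu : u.act ⊆ q.concl) :
    Conv Γ m (u.node (β.node p q)) (β.node p (u.node q)) := by
  have hpq := Un.ok_premise h
  have hp := Bi.ok_left hpq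
  have hq := Bi.ok_right hpq
  have k := Bi.premises hpq
  obtain ⟨t, a, o⟩ := Un.ok_fits h
  obtain ⟨t', l, r, d, ol, or, fr⟩ := Bi.ok_fits hpq
  have f2 := Un.act_fresh (u := u) h.good.anti (by simp [Un.result])
  have f3 := Bi.act_fresh (β := β) (hpq.good.anti) (by simp [Bi.result])
    (hpq.good.sep.mono subset_rfl (by simp))
  have hua : u.out ∉ β.actR ∧ u.out ∉ p.concl ∧ u.out ∉ q.concl := by
    -- A child of `u.out` is present in `q`, so by the antichain property `u.out` is absent from
    -- both premises.
    have key : ∀ x, x ∈ p.concl ∪ q.concl → x ≠ u.out := by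
      rintro x hx rfl
      obtain ⟨y, hy⟩ := u.act_nonempty
      obtain ⟨s, rfl⟩ := Un.child_of_mem_act hy
      exact k.anti.child_notMem hx s (Finset.mem_union_right _ (hu hy))
    refine ⟨fun h => key _ (Finset.mem_union_right _ (r h)) rfl,
      fun h => key _ (Finset.mem_union_left _ h) rfl,
      fun h => key _ (Finset.mem_union_right _ h) rfl⟩
  have ha := Bi.apart_node.1 hpq.apart
  have hg := h.good
  have d2 := k.disj
  simp only [Bi.concl_node, Un.concl_node, Bi.result, Un.result, Finset.disjoint_left,
    Finset.mem_union, Finset.mem_sdiff, Finset.mem_insert, Un.cuts_node, Bi.cuts_node,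
    Finset.subset_iff] at *
  have hRa : ∀ x ∈ β.actR, x ∉ u.act := fun x hx hxa => (f3 x (a hxa)).2 hx
  have e : β.out ∪ (p.concl \ β.actL ∪ insert u.out (q.concl \ u.act) \ β.actR) =
      insert u.out ((β.out ∪ (p.concl \ β.actL ∪ q.concl \ β.actR)) \ u.act) := by
    ext x; simp only [Finset.mem_union, Finset.mem_sdiff, Finset.mem_insert]
    have := f2 x; have := @d2 x; have := hRa x; have := @or x; have := @hu x
    grind
  have hok : (β.node p (u.node q)).OK Γ m := by
    refine ⟨?_, ?_, ?_⟩
    · rw [Bi.valid_node, Un.valid_node]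
      refine ⟨hp.valid, ⟨hq.valid, t, ?_, ?_⟩, t', l, ?_, ?_, ?_, ?_, ?_⟩
      · exact @hu
      · exact hua.2.2
      · intro x hx; have := @r x hx; have := hRa x hx
        simp only [Un.concl_node, Un.result]; grind
      · simp only [Un.concl_node, Un.result]
        rw [Finset.disjoint_left]; intro x; have := @d2 x; grind
      · rw [Finset.disjoint_left]; intro x; exact @ol x
      · simp only [Un.concl_node, Un.result]
        rw [Finset.disjoint_left]; intro x; have := @or x; grind
      · intro k' hk x hx
        refine hg.sep x ?_ k' (by grind)
        rw [← e]
        simp only [Un.concl_node, Un.result] at hx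
        exact Finset.mem_union_right _ hx
    · rw [Bi.apart_node, Un.apart_node, Un.cuts_node]; exact ha
    · simp only [Bi.concl_node, Un.concl_node, Bi.result, Un.result, Un.cuts_node, Bi.cuts_node]
      rwa [e]
  exact (un_bi hok hua.1).symm

theorem wth_un {a : Loc V ι} {u : Un V ι} {p q : Tree V ι}
    (h : (Tree.wth a (u.node p) (u.node q)).OK Γ m) (hl : u.out ≠ a.child .left)
    (hr : u.out ≠ a.child .right) :
    Conv Γ m (.wth a (u.node p) (u.node q)) (u.node (.wth a p q)) := by
  have hup := wth_ok_left h
  have huq := wth_ok_right h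
  have hp := Un.ok_premise hup
  have hq := Un.ok_premise huq
  have k := wth_fits h
  obtain ⟨t, l, o⟩ := Un.ok_fits hup
  obtain ⟨-, l', o'⟩ := Un.ok_fits huq
  obtain ⟨t', al, ar, nl, nr, e⟩ := k
  have f2 := Un.act_fresh (u := u) h.good.anti (by
    simp only [Tree.concl, Un.concl_node, Un.result]; grind)
  have f3 := Un.act_fresh (u := u) hup.good.anti (by simp [Un.result])
  have f4 := Un.act_fresh (u := u) huq.good.anti (by simp [Un.result])
  have hg := h.good
  have ha := h.apart
  simp only [Tree.concl, Un.concl_node, Un.result, Finset.mem_sdiff, Finset.mem_insert,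
    Finset.mem_singleton, Finset.subset_iff, Tree.cuts, Un.cuts_node, Tree.Apart,
    Un.apart_node] at *
  have e' : insert a (insert u.out (p.concl \ u.act) \ {a.child .left}) =
      insert u.out (insert a (p.concl \ {a.child .left}) \ u.act) := by
    ext x; simp only [Finset.mem_sdiff, Finset.mem_insert, Finset.mem_singleton]
    have := f2 x; have := f3 x; grind
  have hok : (u.node (.wth a p q)).OK Γ m := by
    refine ⟨?_, ?_, ?_⟩
    · rw [Un.valid_node, wth_valid]
      refine ⟨⟨hp.valid, hq.valid, t', ?_, ?_, ?_, ?_, ?_⟩, t, ?_, ?_⟩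
      · grind
      · grind
      · have := f2 a; grind
      · have := f2 a; grind
      · ext x
        have h1 := congrArg (x ∈ ·) e
        simp only [Finset.mem_sdiff, Finset.mem_insert, Finset.mem_singleton] at h1 ⊢
        have := @l x; have := @l' x
        by_cases hx : x ∈ u.act
        · have := f3 (a.child .left); have := f4 (a.child .right); grind
        · have : u.out ≠ x → ((x ∈ p.concl ∧ ¬ x = a.child .left) ↔
            (x ∈ q.concl ∧ ¬ x = a.child .right)) := by grind
          grind
      · intro x hx; have := @l x hx; have := f3 (a.child .left)
        simp only [Tree.concl]; grind
      · simp only [Tree.concl]; grind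
    · rw [Un.apart_node]; exact ha
    · simp only [Tree.concl, Un.concl_node, Un.result, Tree.cuts, Un.cuts_node]
      rwa [← e']
  have hc : (Tree.wth a (u.node p) (u.node q)).concl = (u.node (.wth a p q)).concl := by
    simp only [Tree.concl, Un.concl_node, Un.result, e']
  cases u
  · exact .comm (.par_wth _ _ _ _) h hok hc
  · exact .comm (.plus_wth _ _ _ _ _) h hok hc

theorem un_wth {a : Loc V ι} {u : Un V ι} {p q : Tree V ι}
    (h : (u.node (.wth a p q)).OK Γ m) (hu : a ∉ u.act) :
    Conv Γ m (u.node (.wth a p q)) (.wth a (u.node p) (u.node q)) := by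
  have hpq := Un.ok_premise h
  have hp := wth_ok_left hpq
  have hq := wth_ok_right hpq
  obtain ⟨t', al, ar, nl, nr, e⟩ := wth_fits hpq
  obtain ⟨t, l, o⟩ := Un.ok_fits h
  have f2 := Un.act_fresh (u := u) h.good.anti (by simp [Un.result])
  have ea := congrArg (u.out ∈ ·) e
  have h2 : a ∈ (u.node (.wth a p q)).concl := by
    simp only [Un.concl_node, Un.result, Tree.concl]; grind
  have fl := h.good.anti.child_notMem h2 .left
  have fr := h.good.anti.child_notMem h2 .right
  have gl := hpq.good.anti.child_notMem (a := a) (by simp [Tree.concl]) .left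
  have gr := hpq.good.anti.child_notMem (a := a) (by simp [Tree.concl]) .right
  have hg := h.good
  have ha := h.apart
  simp only [Tree.concl, Un.concl_node, Un.result, Finset.mem_sdiff, Finset.mem_insert,
    Finset.mem_singleton, Finset.subset_iff, Tree.cuts, Un.cuts_node, Tree.Apart,
    Un.apart_node] at *
  have e' : insert a (insert u.out (p.concl \ u.act) \ {a.child .left}) =
      insert u.out (insert a (p.concl \ {a.child .left}) \ u.act) := by
    ext x; simp only [Finset.mem_sdiff, Finset.mem_insert, Finset.mem_singleton]
    have := f2 x; have := @l x; grind
  have hok : (Tree.wth a (u.node p) (u.node q)).OK Γ m := by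
    refine ⟨?_, ?_, ?_⟩
    · rw [wth_valid, Un.valid_node, Un.valid_node]
      refine ⟨⟨hp.valid, t, ?_, ?_⟩, ⟨hq.valid, t, ?_, ?_⟩, t', ?_, ?_, ?_, ?_, ?_⟩
      · intro x hx; have := @l x hx; grind
      · grind
      · intro x hx; have := @l x hx
        have h1 := congrArg (x ∈ ·) e
        simp only [Finset.mem_sdiff, Finset.mem_singleton] at h1
        grind
      · grind
      · simp only [Un.concl_node, Un.result]; have := @l (a.child .left); grind
      · simp only [Un.concl_node, Un.result]; have := @l (a.child .right); grind
      · simp only [Un.concl_node, Un.result]; grind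
      · simp only [Un.concl_node, Un.result]; grind
      · ext x
        have h1 := congrArg (x ∈ ·) e
        simp only [Un.concl_node, Un.result, Finset.mem_sdiff, Finset.mem_insert,
          Finset.mem_singleton] at h1 ⊢
        grind
    · simp only [Tree.Apart, Un.apart_node]; exact ha
    · simp only [Tree.concl, Un.concl_node, Un.result, Tree.cuts, Un.cuts_node]
      rwa [e']
  exact (wth_un hok (by grind) (by grind)).symm

theorem union_dup {α : Type*} [DecidableEq α] (C P Q R : Finset α) :
    C ∪ (P ∪ Q) ∪ (C ∪ (P ∪ R)) = C ∪ (P ∪ (Q ∪ R)) := by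
  grind

theorem union_rotate {α : Type*} [DecidableEq α] (B C P Q R : Finset α) :
    B ∪ (P ∪ (C ∪ (Q ∪ R))) = C ∪ (B ∪ (P ∪ Q) ∪ R) := by
  grind

/-- The subproof `p` is copied into both branches together with the names of its cuts and with the
cut of `β`, if there is one. As the premises of `wth` may share names, the copies are superimposed
and the set of cuts stays the same. -/
theorem wth_bi {β : Bi V ι} {b : Loc V ι} {p q r : Tree V ι}
    (h : (β.node p (.wth b q r)).OK Γ m) (hb : b ∉ β.actR) :
    Conv Γ m (β.node p (.wth b q r)) (.wth b (β.node p q) (β.node p r)) := by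
  have hp := Bi.ok_left h
  have hqr := Bi.ok_right h
  have hq := wth_ok_left hqr
  have hr := wth_ok_right hqr
  have k := Bi.premises h
  obtain ⟨t, L, R, d, ol, or, fr⟩ := Bi.ok_fits h
  obtain ⟨t', al, ar, nl, nr, e⟩ := wth_fits hqr
  have hbT : b ∈ (β.node p (.wth b q r)).concl := by
    simp only [Bi.concl_node, Bi.result, Tree.concl]; grind
  have tl := h.good.anti.child_notMem hbT .left
  have tr := h.good.anti.child_notMem hbT .right
  have kl := k.anti.child_notMem (a := b) (by simp [Tree.concl]) .left
  have kr := k.anti.child_notMem (a := b) (by simp [Tree.concl]) .right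
  have ha := Bi.apart_node.1 h.apart
  have hg := h.good
  have d2 := k.disj
  simp only [Bi.concl_node, Tree.concl, Bi.result, Finset.disjoint_left, Finset.mem_union,
    Finset.mem_sdiff, Finset.mem_insert, Finset.mem_singleton, Tree.cuts, Bi.cuts_node,
    Finset.subset_iff, Tree.Apart, namesDisjoint_union_right] at *
  have e1 : ∀ x, (x ∈ q.concl ∧ x ≠ b.child .left) ↔ (x ∈ r.concl ∧ x ≠ b.child .right) := by
    intro x; have := congrArg (x ∈ ·) e; simpa using this
  have hRq : ∀ x ∈ β.actR, x ∈ q.concl ∧ x ≠ b.child .left := by grind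
  have hRr : ∀ x ∈ β.actR, x ∈ r.concl ∧ x ≠ b.child .right := by grind
  have hc : β.out ∪ (p.concl \ β.actL ∪ insert b (q.concl \ {b.child .left}) \ β.actR) =
      insert b ((β.out ∪ (p.concl \ β.actL ∪ q.concl \ β.actR)) \ {b.child .left}) := by
    ext x; simp only [Finset.mem_union, Finset.mem_sdiff, Finset.mem_insert,
      Finset.mem_singleton]
    grind
  have hok : (Tree.wth b (β.node p q) (β.node p r)).OK Γ m := by
    refine ⟨?_, ?_, ?_⟩
    · rw [wth_valid, Bi.valid_node, Bi.valid_node]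
      refine ⟨⟨hp.valid, hq.valid, t, L, fun x hx => (hRq x hx).1, ?_, ?_, ?_, ?_⟩,
        ⟨hp.valid, hr.valid, t, L, fun x hx => (hRr x hx).1, ?_, ?_, ?_, ?_⟩,
        t', ?_, ?_, ?_, ?_, ?_⟩
      · rw [Finset.disjoint_left]; intro x; have := @d2 x; grind
      · rw [Finset.disjoint_left]; intro x; exact @ol x
      · rw [Finset.disjoint_left]; intro x; have := @or x; grind
      · intro k' hk x hx
        by_cases hxa : x = b.child .left
        · rw [hxa, Loc.child_root]; exact hg.sep b (by grind) k' (by grind)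
        · exact hg.sep x (by grind) k' (by grind)
      · rw [Finset.disjoint_left]; intro x; have := @d2 x; have := e1 x; grind
      · rw [Finset.disjoint_left]; intro x; exact @ol x
      · rw [Finset.disjoint_left]; intro x; have := @or x; have := e1 x; grind
      · intro k' hk x hx
        by_cases hxa : x = b.child .right
        · rw [hxa, Loc.child_root]; exact hg.sep b (by grind) k' (by grind)
        · exact hg.sep x (by have := e1 x; grind) k' (by grind)
      · simp only [Bi.concl_node, Bi.result]; grind
      · simp only [Bi.concl_node, Bi.result]; grind
      · simp only [Bi.concl_node, Bi.result]; have := @d2 b; have := @or b; grind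
      · simp only [Bi.concl_node, Bi.result]; have := @d2 b; have := @or b; grind
      · ext x
        simp only [Bi.concl_node, Bi.result, Finset.mem_union, Finset.mem_sdiff,
          Finset.mem_singleton]
        have := e1 x; grind
    · simp only [Tree.Apart, Bi.apart_node]; tauto
    · simp only [Tree.concl, Bi.concl_node, Bi.result, Tree.cuts, Bi.cuts_node]
      rw [← hc]
      rwa [union_dup]
  have hc' : (β.node p (.wth b q r)).concl = (Tree.wth b (β.node p q) (β.node p r)).concl := by
    simp only [Tree.concl, Bi.concl_node, Bi.result, hc]
  cases β
  · exact .comm (.wth_tensor _ _ _ _ _) h hok hc'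
  · exact .comm (.wth_tensor' _ _ _ _ _) h hok hc'
  · exact .comm (.wth_mix _ _ _ _) h hok hc'
  · exact .comm (.wth_cut _ _ _ _ _ _) h hok hc'

/-- The two occurrences of `p` must be literally the same tree before it can be factored out.
Achieving this up to conversion is the task of `SplitAt.wth`. -/
theorem bi_wth {β : Bi V ι} {b : Loc V ι} {p q r : Tree V ι}
    (h : (Tree.wth b (β.node p q) (β.node p r)).OK Γ m) (hl : b.child .left ∈ q.concl)
    (hr : b.child .right ∈ r.concl) :
    Conv Γ m (.wth b (β.node p q) (β.node p r)) (β.node p (.wth b q r)) := by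
  have hpq := wth_ok_left h
  have hpr := wth_ok_right h
  have kq := Bi.premises hpq
  have kr := Bi.premises hpr
  obtain ⟨t, L, R, d, ol, or, fr⟩ := Bi.ok_fits hpq
  obtain ⟨-, -, R', d', -, or', fr'⟩ := Bi.ok_fits hpr
  obtain ⟨t', al, ar, nl, nr, e⟩ := wth_fits h
  have nb : ∀ x ∈ p.concl ∪ q.concl, x ≠ b := by
    rintro x hx rfl
    exact kq.anti.child_notMem hx .left (Finset.mem_union_right _ hl)
  have nb' : ∀ x ∈ p.concl ∪ r.concl, x ≠ b := by
    rintro x hx rfl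
    exact kr.anti.child_notMem hx .right (Finset.mem_union_right _ hr)
  have haq := Bi.apart_node.1 hpq.apart
  have har := Bi.apart_node.1 hpr.apart
  have hg := h.good
  have d2 := kq.disj
  have d3 := kr.disj
  have e1 : ∀ x, _ ↔ _ := fun x => iff_of_eq (congrArg (x ∈ ·) e)
  simp only [Bi.concl_node, Tree.concl, Bi.result, Finset.disjoint_left, Finset.mem_union,
    Finset.mem_sdiff, Finset.mem_singleton, Tree.cuts, Bi.cuts_node, Finset.subset_iff] at *
  have e2 : q.concl \ {b.child .left} = r.concl \ {b.child .right} := by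
    ext x
    have := e1 x; have := @d2 x; have := @d3 x; have := @or x; have := @or' x
    have := @R x; have := @R' x
    simp only [Finset.mem_sdiff, Finset.mem_singleton]
    grind
  have hc : β.out ∪ (p.concl \ β.actL ∪ insert b (q.concl \ {b.child .left}) \ β.actR) =
      insert b ((β.out ∪ (p.concl \ β.actL ∪ q.concl \ β.actR)) \ {b.child .left}) := by
    ext x; simp only [Finset.mem_union, Finset.mem_sdiff, Finset.mem_insert,
      Finset.mem_singleton]
    have := @d2 x; have := @or x; have := @R x; have := nb x
    grind
  have hok : (β.node p (.wth b q r)).OK Γ m := by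
    refine ⟨?_, ?_, ?_⟩
    · rw [Bi.valid_node, wth_valid]
      refine ⟨(Bi.ok_left hpq).valid, ⟨(Bi.ok_right hpq).valid, (Bi.ok_right hpr).valid,
        t', hl, hr, ?_, ?_, e2⟩, t, L, ?_, ?_, ?_, ?_, ?_⟩
      · grind
      · grind
      · intro x hx; have := @R x hx; have := @or x; have := @d2 x
        simp only [Tree.concl]; grind
      · rw [Finset.disjoint_left]; intro x; have := @d2 x; simp only [Tree.concl]; grind
      · rw [Finset.disjoint_left]; intro x; exact @ol x
      · rw [Finset.disjoint_left]; intro x; have := @or x; simp only [Tree.concl]; grind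
      · intro k' hk x hx
        refine hg.sep x ?_ k' (by simp [hk])
        rw [← hc]
        exact Finset.mem_union_right _ hx
    · simp only [Tree.Apart, Bi.apart_node, Tree.cuts, namesDisjoint_union_right]; tauto
    · simp only [Tree.concl, Bi.concl_node, Bi.result, Tree.cuts, Bi.cuts_node]
      rw [hc]
      rwa [← union_dup]
  refine (wth_bi hok ?_).symm
  intro hb
  exact nb b (Or.inr (@R b hb)) rfl

theorem wth_wth {a b : Loc V ι} {p q r s : Tree V ι}
    (h : (Tree.wth b (.wth a p q) (.wth a r s)).OK Γ m) (hl : a ≠ b.child .left)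
    (hr : a ≠ b.child .right) :
    Conv Γ m (.wth b (.wth a p q) (.wth a r s)) (.wth a (.wth b p r) (.wth b q s)) := by
  have hpq := wth_ok_left h
  have hrs := wth_ok_right h
  obtain ⟨t, al, ar, nl, nr, e⟩ := wth_fits h
  obtain ⟨t', al', ar', nl', nr', e'⟩ := wth_fits hpq
  obtain ⟨-, al'', ar'', nl'', nr'', e''⟩ := wth_fits hrs
  have haT : a ∈ (Tree.wth b (.wth a p q) (.wth a r s)).concl := by
    simp only [Tree.concl]; grind
  have hbT : b ∈ (Tree.wth b (.wth a p q) (.wth a r s)).concl := by simp [Tree.concl]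
  have f : ∀ d, b ≠ a.child d := fun d hd => h.good.anti.child_notMem haT d (hd ▸ hbT)
  have fl := f .left
  have fr := f .right
  have c : ∀ d, b.child d ≠ a.child d := fun d hd => by
    have := (Loc.child_inj hd).1; subst this; simp [Tree.concl] at nl
  have cl := c .left
  have cr := c .right
  have hab : a ≠ b := by rintro rfl; simp [Tree.concl] at nl
  have c1 : b.child .left ≠ a.child .right := fun hd => hab (Loc.child_inj hd).1.symm
  have c2 : b.child .right ≠ a.child .left := fun hd => hab (Loc.child_inj hd).1.symm
  have hg := h.good
  have e1 : ∀ x, _ ↔ _ := fun x => iff_of_eq (congrArg (x ∈ ·) e)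
  have e2 : ∀ x, _ ↔ _ := fun x => iff_of_eq (congrArg (x ∈ ·) e')
  have e3 : ∀ x, _ ↔ _ := fun x => iff_of_eq (congrArg (x ∈ ·) e'')
  have hap := h.apart
  simp only [Tree.concl, Finset.mem_sdiff, Finset.mem_insert, Finset.mem_singleton, Tree.cuts,
    Tree.Apart] at *
  have hc : insert b (insert a (p.concl \ {a.child .left}) \ {b.child .left}) =
      insert a (insert b (p.concl \ {b.child .left}) \ {a.child .left}) := by
    ext x; simp only [Finset.mem_sdiff, Finset.mem_insert, Finset.mem_singleton]; grind
  have hok : (Tree.wth a (.wth b p r) (.wth b q s)).OK Γ m := by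
    refine ⟨?_, ?_, ?_⟩
    · rw [wth_valid, wth_valid, wth_valid]
      refine ⟨⟨(wth_ok_left hpq).valid, (wth_ok_left hrs).valid, t, ?_, ?_, ?_, ?_, ?_⟩,
        ⟨(wth_ok_right hpq).valid, (wth_ok_right hrs).valid, t, ?_, ?_, ?_, ?_, ?_⟩,
        t', ?_, ?_, ?_, ?_, ?_⟩
      · grind
      · grind
      · grind
      · grind
      · ext x; have := e1 x; simp only [Finset.mem_sdiff, Finset.mem_singleton]; grind
      · have := e2 (b.child .left); grind
      · have := e3 (b.child .right); grind
      · have := e2 b; grind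
      · have := e3 b; grind
      · ext x; have := e1 x; have := e2 x; have := e3 x
        simp only [Finset.mem_sdiff, Finset.mem_singleton]; grind
      · simp only [Tree.concl]; grind
      · simp only [Tree.concl]; grind
      · simp only [Tree.concl]; grind
      · simp only [Tree.concl]; grind
      · ext x; have := e2 x
        simp only [Tree.concl, Finset.mem_sdiff, Finset.mem_insert, Finset.mem_singleton]; grind
    · simp only [Tree.Apart]; tauto
    · simp only [Tree.concl, Tree.cuts]
      rw [← hc]
      rwa [Finset.union_union_union_comm]
  exact .comm (.wth_wth _ _ _ _ _ _) h hok (by simp only [Tree.concl, hc])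

/-- `γ` can be moved below `β` as soon as `β` finds its second argument in `q`, for then `r` plays
no part in `β`. If `β` is a mix the condition is void. Other positions of the premises are obtained
by flipping. -/
theorem bi_bi {β γ : Bi V ι} {p q r : Tree V ι} (h : (β.node p (γ.node q r)).OK Γ m)
    (hR : β.actR ⊆ q.concl) :
    Conv Γ m (β.node p (γ.node q r)) (γ.node (β.node p q) r) := by
  have hp := Bi.ok_left h
  have hqr := Bi.ok_right h
  have k := Bi.premises h
  have k' := Bi.premises hqr
  obtain ⟨t, L, R, d, ol, or, fr⟩ := Bi.ok_fits h
  obtain ⟨t', L', R', d', ol', or', fr'⟩ := Bi.ok_fits hqr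
  have hsγ : Sep (β.node p (γ.node q r)).concl γ.cuts :=
    h.good.sep.mono subset_rfl (by simp only [Bi.cuts_node]; grind)
  have dd := k.disj
  have dd' := k'.disj
  have ha := Bi.apart_node.1 h.apart
  have ha' := Bi.apart_node.1 hqr.apart
  have hog : γ.out ⊆ (β.node p (γ.node q r)).concl := by
    intro x hx
    have h1 : x ∉ q.concl := Finset.disjoint_left.1 ol' hx
    have h2 : x ∉ β.actR := fun h => h1 (hR h)
    simp only [Bi.concl_node, Bi.result]; grind
  have f1 := Bi.act_fresh h.good.anti hog hsγ
  have f2 := Bi.act_fresh (β := γ) k.anti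
    (by intro x hx; simp only [Bi.concl_node, Bi.result]; grind)
    (k.sep.mono subset_rfl (by simp only [Bi.cuts_node]; grind))
  have hact := @Bi.act_root _ _ γ
  have hg := h.good
  simp only [Bi.concl_node, Bi.result, Finset.disjoint_left, Finset.mem_union,
    Finset.mem_sdiff, Bi.cuts_node, Finset.subset_iff, namesDisjoint_union_right] at *
  have hRL : ∀ x ∈ β.actR, x ∉ γ.actL := by
    intro x hx hx'
    have := @R x hx; have := @hR x hx; have := @ol' x; have := @dd' x; grind
  have hc : β.out ∪ (p.concl \ β.actL ∪
        (γ.out ∪ (q.concl \ γ.actL ∪ r.concl \ γ.actR)) \ β.actR) =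
      γ.out ∪ ((β.out ∪ (p.concl \ β.actL ∪ q.concl \ β.actR)) \ γ.actL ∪
        r.concl \ γ.actR) := by
    ext x; simp only [Finset.mem_union, Finset.mem_sdiff]
    have := @dd x; have := @dd' x; have := f1 x; have := f2 x; have := @hR x
    have := @or x; have := @or' x; have := @ol' x; have := hRL x
    grind
  have hok : (γ.node (β.node p q) r).OK Γ m := by
    refine ⟨?_, ?_, ?_⟩
    · rw [Bi.valid_node, Bi.valid_node]
      refine ⟨⟨hp.valid, (Bi.ok_left hqr).valid, t, L, @hR, ?_, ?_, ?_, ?_⟩,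
        (Bi.ok_right hqr).valid, t', ?_, R', ?_, ?_, ?_, ?_⟩
      · rw [Finset.disjoint_left]; intro x; have := @dd x; have := f2 x; grind
      · rw [Finset.disjoint_left]; intro x; exact @ol x
      · rw [Finset.disjoint_left]; intro x; have := @or x; have := f1 x; grind
      · intro l hl x hx
        by_cases hxa : x ∈ γ.actL
        · rcases hact (Or.inl hxa) with ⟨y, hy, hxy⟩ | ⟨n, hn, hxn⟩
          · rw [hxy]; exact hg.sep y (by have := @ol' y; have := @hR y; grind) l (by grind)
          · exact fun hlx => ha.2.2.2.2.1 l hl n hn (hxn _ hlx)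
        · exact hg.sep x (by have := @dd' x; have := @ol' x; grind) l (by grind)
      · intro x hx; have := @L' x hx; have := hRL x
        simp only [Bi.concl_node, Bi.result]; grind
      · simp only [Bi.concl_node, Bi.result]
        rw [Finset.disjoint_left]; intro x
        have := @dd x; have := @dd' x; have := @or x; grind
      · simp only [Bi.concl_node, Bi.result]
        rw [Finset.disjoint_left]; intro x
        have := @dd x; have := @or x; have := @ol' x; grind
      · rw [Finset.disjoint_left]; intro x; exact @or' x
      · intro l hl x hx
        refine hg.sep x ?_ l (by grind)
        rw [hc]
        simp only [Bi.concl_node, Bi.result] at hx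
        exact Finset.mem_union_right _ hx
    · simp only [Bi.apart_node, Bi.cuts_node, namesDisjoint_union_left,
        namesDisjoint_union_right]
      have s2 := ha.2.2.1.1.symm
      have s3 := ha.2.2.2.2.1.symm
      clear * - ha ha' s2 s3
      tauto
    · simp only [Bi.concl_node, Bi.result, Bi.cuts_node]
      rw [← hc]
      rwa [← union_rotate]
  have hc' : (β.node p (γ.node q r)).concl = (γ.node (β.node p q) r).concl := by
    simp only [Bi.concl_node, Bi.result, hc]
  clear * - h hok hc'
  cases β with
  | tensor a =>
    cases γ with
    | tensor b => exact .comm (.tensor_tensor _ _ _ _ _) h hok hc'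
    | tensor' b => exact .comm (.tensor_tensor_right _ _ _ _ _) h hok hc'
    | mix =>
      exact (Conv.of_comm (.tensor_mix' a r p q) (.mix_swap _ _) (.tensor (.refl _) (.mix_swap _ _))
        hok h hc'.symm).symm
    | cut c A =>
      exact (Conv.of_comm (.tensor_cut' c A.dual a r p q) (.cut_swap _ _ _ _)
        (.tensor (.refl _) (.cut_swap _ _ _ _)) hok h hc'.symm).symm
  | tensor' a =>
    cases γ with
    | tensor b => exact .comm (.tensor_tensor_left _ _ _ _ _) h hok hc'
    | tensor' b => exact (Conv.comm (.tensor_tensor _ _ _ _ _) hok h hc'.symm).symm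
    | mix =>
      exact (Conv.of_comm (.tensor_mix a r q p) (.mix_swap _ _) (.tensor (.mix_swap _ _) (.refl _))
        hok h hc'.symm).symm
    | cut c A =>
      exact (Conv.of_comm (.tensor_cut c A.dual a r q p) (.cut_swap _ _ _ _)
        (.tensor (.cut_swap _ _ _ _) (.refl _)) hok h hc'.symm).symm
  | mix =>
    cases γ with
    | tensor b => exact .comm (.tensor_mix _ _ _ _) h hok hc'
    | tensor' b => exact .comm (.tensor_mix' _ _ _ _) h hok hc'
    | mix => exact .comm (.mix_mix _ _ _) h hok hc'
    | cut c A => exact .comm (.cut_mix _ _ _ _ _) h hok hc'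
  | cut c A =>
    cases γ with
    | tensor b => exact .comm (.tensor_cut _ _ _ _ _ _) h hok hc'
    | tensor' b => exact .comm (.tensor_cut' _ _ _ _ _ _) h hok hc'
    | mix =>
      -- The listed commutation of mix and cut serves for this arrangement too, after the premises
      -- of the cut are swapped, which exchanges `A` and its dual.
      exact (Conv.of_comm (.cut_mix c A.dual r q p)
        (.trans (.mix_swap _ _) (.mix (.refl _) (.cut_swap _ _ _ _)))
        (.trans (.cut_swap _ _ _ _) (.cut (.mix_swap _ _) (.refl _))) hok h hc'.symm).symm
    | cut d B => exact .comm (.cut_cut _ _ _ _ _ _ _) h hok hc'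

/-! ### Leaves of linkings -/

/-- Some link of `lk` has a leaf below the vertex `x`. -/
def Touches (lk : Linking V ι) (x : Loc V ι) : Prop := ∃ e ∈ lk, ∃ l ∈ e, x ≤ l

theorem Touches.mono {lk lk' : Linking V ι} {x : Loc V ι} (h : Touches lk x) (hs : lk ⊆ lk') :
    Touches lk' x := by
  obtain ⟨e, he, l, hl, hx⟩ := h
  exact ⟨e, hs he, l, hl, hx⟩

theorem Touches.of_le {lk : Linking V ι} {x y : Loc V ι} (h : Touches lk y) (hxy : x ≤ y) :
    Touches lk x := by
  obtain ⟨e, he, l, hl, hx⟩ := h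
  exact ⟨e, he, l, hl, hxy.trans hx⟩

/-- The vertex `l` belongs to the cut `k`. -/
def Loc.OnCut (l : Loc V ι) (k : Cut V) : Prop :=
  ∃ A, l.root = .cut k.1 A ∧ k.2 = s(A, A.dual)

/-- The vertices that belong to a conclusion or to a cut of the tree. -/
def Tree.supp (t : Tree V ι) : Set (Loc V ι) :=
  {l | (∃ x ∈ t.concl, x ≤ l) ∨ ∃ k ∈ t.cuts, l.OnCut k}

theorem sym2_nonempty {α : Type*} (e : Sym2 α) : ∃ l, l ∈ e := ⟨_, e.out_fst_mem⟩

theorem Bi.exists_actL {β : Bi V ι} {x : Loc V ι} (h : x ∈ β.out) :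
    (∃ d, x.child d ∈ β.actL) ∧ ∃ d, x.child d ∈ β.actR := by
  cases β <;> simp [Bi.out, Bi.actL, Bi.actR] at h ⊢
  all_goals subst h; exact ⟨⟨_, rfl⟩, ⟨_, rfl⟩⟩

theorem Bi.act_cases {β : Bi V ι} {x : Loc V ι} (h : x ∈ β.actL ∨ x ∈ β.actR) :
    (∃ y ∈ β.out, ∃ d, x = y.child d) ∨
      ∃ c A, x = .ofCut c A ∧ (c, s(A, A.dual)) ∈ β.cuts := by
  cases β <;> simp [Bi.actL, Bi.actR, Bi.out, Bi.cuts] at h ⊢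
  · rcases h with rfl | rfl <;> exact ⟨_, rfl⟩
  · rcases h with rfl | rfl <;> exact ⟨_, rfl⟩
  · rcases h with rfl | rfl
    · exact ⟨_, rfl, .inl ⟨rfl, rfl⟩⟩
    · exact ⟨_, rfl, by simp⟩

theorem Tree.linkings_nonempty (t : Tree V ι) : t.linkings.Nonempty := by
  induction t using Tree.rec_rules with
  | ax a b => exact ⟨_, rfl⟩
  | un u p h => simpa using h
  | bi β p q h k => rw [Bi.linkings_node]; exact Set.Nonempty.image2 h k
  | wth a p q h k => exact h.mono Set.subset_union_left

theorem Tree.linking_nonempty {t : Tree V ι} {lk : Linking V ι} (h : lk ∈ t.linkings) :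
    lk.Nonempty := by
  induction t using Tree.rec_rules generalizing lk with
  | ax a b => cases h; exact ⟨_, rfl⟩
  | un u p ih => exact ih (by simpa using h)
  | bi β p q ih _ =>
    rw [Bi.linkings_node] at h
    obtain ⟨x, hx, y, hy, rfl⟩ := h
    exact (ih hx).mono Set.subset_union_left
  | wth a p q ih ih' => exact h.elim ih ih'

/-- Every linking reaches every formula of the conclusion. -/
theorem touches_concl {t : Tree V ι} (ht : t.Valid Γ m) {lk : Linking V ι}
    (h : lk ∈ t.linkings) {x : Loc V ι} (hx : x ∈ t.concl) : Touches lk x := by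
  induction t using Tree.rec_rules generalizing lk x with
  | ax a b =>
    cases h
    simp only [Tree.concl, Finset.mem_insert, Finset.mem_singleton] at hx
    exact ⟨_, rfl, x, by simpa using hx, le_rfl⟩
  | un u p ih =>
    obtain ⟨hp, hF⟩ := Un.valid_node.1 ht
    rw [Un.linkings_node] at h
    rw [Un.concl_node, Un.result, Finset.mem_insert, Finset.mem_sdiff] at hx
    rcases hx with rfl | hx
    · obtain ⟨y, hy⟩ := u.act_nonempty
      obtain ⟨d, rfl⟩ := Un.child_of_mem_act hy
      exact (ih hp h (hF.2.1 hy)).of_le (Loc.le_child _ d)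
    · exact ih hp h hx.1
  | bi β p q ih ih' =>
    obtain ⟨hp, hq, hF⟩ := Bi.valid_node.1 ht
    rw [Bi.linkings_node] at h
    obtain ⟨l1, h1, l2, h2, rfl⟩ := h
    rw [Bi.concl_node, Bi.result, Finset.mem_union, Finset.mem_union, Finset.mem_sdiff,
      Finset.mem_sdiff] at hx
    rcases hx with hx | hx | hx
    · obtain ⟨d, hd⟩ := (Bi.exists_actL hx).1
      exact ((ih hp h1 (hF.actL hd)).of_le (Loc.le_child _ d)).mono Set.subset_union_left
    · exact (ih hp h1 hx.1).mono Set.subset_union_left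
    · exact (ih' hq h2 hx.1).mono Set.subset_union_right
  | wth a p q ih ih' =>
    obtain ⟨hp, hq, hF⟩ := wth_valid.1 ht
    rw [Tree.concl, Finset.mem_insert] at hx
    rcases h with h | h <;> rcases hx with rfl | hx
    · exact (ih hp h hF.left).of_le (Loc.le_child _ _)
    · exact ih hp h (Finset.mem_sdiff.1 hx).1
    · exact (ih' hq h hF.right).of_le (Loc.le_child _ _)
    · rw [hF.eq] at hx
      exact ih' hq h (Finset.mem_sdiff.1 hx).1

theorem Bi.mem_cuts {β : Bi V ι} {k : Cut V} (h : k ∈ β.cuts) :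
    ∃ A, β = .cut k.1 A ∧ k.2 = s(A, A.dual) := by
  cases β <;> simp [Bi.cuts] at h ⊢
  subst h; exact ⟨rfl, rfl⟩

theorem Tree.mem_cuts {t : Tree V ι} {k : Cut V} (h : k ∈ t.cuts) :
    ∃ A, k.2 = s(A, A.dual) := by
  induction t using Tree.rec_rules with
  | ax a b => simp [Tree.cuts] at h
  | un u p ih => exact ih (by simpa using h)
  | bi β p q ih ih' =>
    rw [Bi.cuts_node, Finset.mem_union, Finset.mem_union] at h
    rcases h with h | h | h
    · obtain ⟨A, -, h⟩ := Bi.mem_cuts h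
      exact ⟨A, h⟩
    · exact ih h
    · exact ih' h
  | wth a p q ih ih' =>
    rw [Tree.cuts, Finset.mem_union] at h
    exact h.elim ih ih'

theorem dual_pair {A B : Formula V} (h : s(A, A.dual) = s(B, B.dual)) : A = B ∨ A = B.dual := by
  simp only [Sym2.eq_iff] at h
  tauto

/-- Every cut is reached by some linking. -/
theorem touches_cut {t : Tree V ι} (ht : t.Valid Γ m) {c : ℕ} {A : Formula V}
    (h : (c, s(A, A.dual)) ∈ t.cuts) : ∃ lk ∈ t.linkings, Touches lk (.ofCut c A) := by
  induction t using Tree.rec_rules with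
  | ax a b => simp [Tree.cuts] at h
  | un u p ih => simpa using ih (Un.valid_node.1 ht).1 (by simpa using h)
  | bi β p q ih ih' =>
    obtain ⟨hp, hq, hF⟩ := Bi.valid_node.1 ht
    rw [Bi.cuts_node, Finset.mem_union, Finset.mem_union] at h
    obtain ⟨l1, h1⟩ := p.linkings_nonempty
    obtain ⟨l2, h2⟩ := q.linkings_nonempty
    rw [Bi.linkings_node]
    rcases h with h | h | h
    · obtain ⟨B, rfl, hB⟩ := Bi.mem_cuts h
      refine ⟨_, ⟨l1, h1, l2, h2, rfl⟩, ?_⟩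
      rcases dual_pair hB with rfl | rfl
      · exact (touches_concl hp h1 (hF.actL (by simp [Bi.actL]))).mono Set.subset_union_left
      · exact (touches_concl hq h2 (hF.actR (by simp [Bi.actR]))).mono Set.subset_union_right
    · obtain ⟨l, hl, hx⟩ := ih hp h
      exact ⟨_, ⟨l, hl, l2, h2, rfl⟩, hx.mono Set.subset_union_left⟩
    · obtain ⟨l, hl, hx⟩ := ih' hq h
      exact ⟨_, ⟨l1, h1, l, hl, rfl⟩, hx.mono Set.subset_union_right⟩
  | wth a p q ih ih' =>
    obtain ⟨hp, hq, hF⟩ := wth_valid.1 ht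
    rw [Tree.cuts, Finset.mem_union] at h
    rcases h with h | h
    · obtain ⟨l, hl, hx⟩ := ih hp h
      exact ⟨l, Or.inl hl, hx⟩
    · obtain ⟨l, hl, hx⟩ := ih' hq h
      exact ⟨l, Or.inr hl, hx⟩

/-- A consumed occurrence leaves its leaves in the support, either under the generated occurrence or
on the generated cut. -/
theorem Bi.supp_left {β : Bi V ι} {p q : Tree V ι} : p.supp ⊆ (β.node p q).supp := by
  rintro l (⟨x, hx, hxl⟩ | ⟨k, hk, hl⟩)
  · by_cases hxa : x ∈ β.actL
    · rcases Bi.act_cases (Or.inl hxa) with ⟨y, hy, d, rfl⟩ | ⟨c, A, rfl, hk⟩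
      · exact .inl ⟨y, by simp [Bi.result, hy], (Loc.le_child y d).trans hxl⟩
      · exact .inr ⟨(c, s(A, A.dual)), by simp [hk], A, Loc.ofCut_le.1 hxl, rfl⟩
    · exact .inl ⟨x, by simp [Bi.result, hx, hxa], hxl⟩
  · exact .inr ⟨k, by simp [hk], hl⟩

theorem Bi.supp_right {β : Bi V ι} {p q : Tree V ι} : q.supp ⊆ (β.node p q).supp := by
  rintro l (⟨x, hx, hxl⟩ | ⟨k, hk, hl⟩)
  · by_cases hxa : x ∈ β.actR
    · rcases Bi.act_cases (Or.inr hxa) with ⟨y, hy, d, rfl⟩ | ⟨c, A, rfl, hk⟩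
      · exact .inl ⟨y, by simp [Bi.result, hy], (Loc.le_child y d).trans hxl⟩
      · exact .inr ⟨(c, s(A, A.dual)), by simp [hk], A, Loc.ofCut_le.1 hxl, rfl⟩
    · exact .inl ⟨x, by simp [Bi.result, hx, hxa], hxl⟩
  · exact .inr ⟨k, by simp [hk], hl⟩

/-- All leaves of links lie under a conclusion or a cut. -/
theorem mem_supp {t : Tree V ι} (ht : t.Valid Γ m) {lk : Linking V ι}
    (h : lk ∈ t.linkings) {e : Sym2 (Loc V ι)} (he : e ∈ lk) {l : Loc V ι} (hl : l ∈ e) :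
    l ∈ t.supp := by
  induction t using Tree.rec_rules generalizing lk with
  | ax a b =>
    cases h; cases he
    exact .inl ⟨l, by simpa [Tree.concl] using hl, le_rfl⟩
  | un u p ih =>
    obtain ⟨hp, hF⟩ := Un.valid_node.1 ht
    rw [Un.linkings_node] at h
    rcases ih hp h he with ⟨x, hx, hxl⟩ | ⟨k, hk, hl⟩
    · by_cases hxa : x ∈ u.act
      · obtain ⟨d, rfl⟩ := Un.child_of_mem_act hxa
        exact .inl ⟨u.out, by simp [Un.result], (Loc.le_child _ d).trans hxl⟩
      · exact .inl ⟨x, by simp [Un.result, hx, hxa], hxl⟩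
    · exact .inr ⟨k, by simpa using hk, hl⟩
  | bi β p q ih ih' =>
    obtain ⟨hp, hq, hF⟩ := Bi.valid_node.1 ht
    rw [Bi.linkings_node] at h
    obtain ⟨l1, h1, l2, h2, rfl⟩ := h
    rcases he with he | he
    · exact Bi.supp_left (ih hp h1 he)
    · exact Bi.supp_right (ih' hq h2 he)
  | wth a p q ih ih' =>
    obtain ⟨hp, hq, hF⟩ := wth_valid.1 ht
    rcases h with h | h
    · rcases ih hp h he with ⟨x, hx, hxl⟩ | ⟨k, hk, hl⟩
      · by_cases hxa : x = a.child .left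
        · subst hxa
          exact .inl ⟨a, by simp [Tree.concl], (Loc.le_child _ _).trans hxl⟩
        · exact .inl ⟨x, by simp [Tree.concl, hx, hxa], hxl⟩
      · exact .inr ⟨k, by simp [Tree.cuts, hk], hl⟩
    · rcases ih' hq h he with ⟨x, hx, hxl⟩ | ⟨k, hk, hl⟩
      · by_cases hxa : x = a.child .right
        · subst hxa
          exact .inl ⟨a, by simp [Tree.concl], (Loc.le_child _ _).trans hxl⟩
        · refine .inl ⟨x, ?_, hxl⟩
          rw [Tree.concl, hF.eq]
          simp [hx, hxa]
      · exact .inr ⟨k, by simp [Tree.cuts, hk], hl⟩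

theorem Loc.OnCut.name_mem {l : Loc V ι} {k : Cut V} (h : l.OnCut k) : k.1 ∈ l.root.names := by
  obtain ⟨A, h, -⟩ := h
  exact Root.mem_names.2 ⟨A, h⟩

/-- The root of a vertex already records both the name and the formula of its cut. -/
theorem Loc.OnCut.name_eq {l : Loc V ι} {k k' : Cut V} (h : l.OnCut k) (h' : l.OnCut k') :
    k = k' := by
  obtain ⟨A, h, e⟩ := h
  obtain ⟨B, h', e'⟩ := h'
  rw [h] at h'
  injection h' with h1 h2
  subst h2
  exact Prod.ext h1 (e.trans e'.symm)

/-- A common leaf below conclusions of both premises would make these comparable, hence equal; one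
below a conclusion and on a cut would make the name of the cut free; one on two cuts would force
these to share a name. -/
theorem Bi.Premises.supp_disjoint {β : Bi V ι} {p q : Tree V ι} (k : β.Premises p q)
    {l : Loc V ι} (hp : l ∈ p.supp) (hq : l ∈ q.supp) : False := by
  rcases hp with ⟨x, hx, hxl⟩ | ⟨c, hc, hcl⟩ <;> rcases hq with ⟨y, hy, hyl⟩ | ⟨d, hd, hdl⟩
  · have hx' := Finset.mem_union_left q.concl hx
    have hy' := Finset.mem_union_right p.concl hy
    have : x = y := by
      rcases Loc.le_total_of_le hxl hyl with h | h
      · exact k.anti x hx' y hy' h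
      · exact (k.anti y hy' x hx' h).symm
    exact Finset.disjoint_left.1 k.disj hx (this ▸ hy)
  · refine k.sep x (Finset.mem_union_left _ hx) d (Finset.mem_union_right _ hd) ?_
    rw [Loc.root_eq_of_le hxl]; exact hdl.name_mem
  · refine k.sep y (Finset.mem_union_right _ hy) c (Finset.mem_union_left _ hc) ?_
    rw [Loc.root_eq_of_le hyl]; exact hcl.name_mem
  · exact k.names c hc d hd (by rw [hcl.name_eq hdl])

/-- The cuts of a proof are determined by its conclusion and its linkings. -/
theorem cuts_subset {s t : Tree V ι} (hs : s.OK Γ m) (ht : t.Valid Γ m)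
    (hc : s.concl = t.concl) (hl : s.linkings = t.linkings) : s.cuts ⊆ t.cuts := by
  rintro ⟨c, e⟩ hk
  obtain ⟨A, rfl⟩ := Tree.mem_cuts hk
  -- Some link has a leaf under this cut. The same link occurs in `t`, where the leaf cannot lie
  -- under a conclusion, since the name of the cut is not free, and so lies on a cut of `t`.
  obtain ⟨lk, hlk, e, he, l, hle, hx⟩ := touches_cut hs.valid hk
  rcases mem_supp ht (hl ▸ hlk) he hle with ⟨x, hx', hxl⟩ | ⟨k, hk', hkl⟩
  · refine absurd ?_ (hs.good.sep x (hc ▸ hx') _ hk)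
    rw [Loc.root_eq_of_le hxl, ← Loc.root_eq_of_le hx]
    simp [Root.names]
  · have : l.OnCut (c, s(A, A.dual)) := ⟨A, Loc.ofCut_le.1 hx, rfl⟩
    rwa [this.name_eq hkl]

theorem cuts_eq {s t : Tree V ι} (hs : s.OK Γ m) (ht : t.OK Γ m)
    (hc : s.concl = t.concl) (hl : s.linkings = t.linkings) : s.cuts = t.cuts :=
  (cuts_subset hs ht.valid hc hl).antisymm (cuts_subset ht hs.valid hc.symm hl.symm)

/-- Which of the linkings of a proof that ends with `wth` belong to which premise. -/
theorem wth_not_touches_left {a : Loc V ι} {p q : Tree V ι} (h : (Tree.wth a p q).OK Γ m)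
    {lk : Linking V ι} (hlk : lk ∈ q.linkings) : ¬ Touches lk (a.child .left) := by
  rintro ⟨e, he, l, hl, hal⟩
  have hF := wth_fits h
  have hp := wth_ok_left h
  rcases mem_supp (wth_ok_right h).valid hlk he hl with ⟨x, hx, hxl⟩ | ⟨k, hk, hkl⟩
  · by_cases hxa : x = a.child .right
    · subst hxa
      cases Loc.side_eq_of_child_le hxl hal
    · have hx' : x ∈ p.concl \ {a.child .left} := by rw [hF.eq]; simp [hx, hxa]
      simp only [Finset.mem_sdiff, Finset.mem_singleton] at hx'
      rcases Loc.le_total_of_le hxl hal with g | g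
      · exact hx'.2 (hp.good.anti _ hx'.1 _ hF.left g)
      · exact hx'.2 (hp.good.anti _ hF.left _ hx'.1 g).symm
  · refine h.good.sep a (by simp [Tree.concl]) k (by simp [Tree.cuts, hk]) ?_
    have := Loc.root_eq_of_le hal
    rw [Loc.child_root] at this
    rw [this]; exact hkl.name_mem

theorem wth_not_touches_right {a : Loc V ι} {p q : Tree V ι} (h : (Tree.wth a p q).OK Γ m)
    {lk : Linking V ι} (hlk : lk ∈ p.linkings) : ¬ Touches lk (a.child .right) := by
  rintro ⟨e, he, l, hl, hal⟩
  have hF := wth_fits h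
  have hq := wth_ok_right h
  rcases mem_supp (wth_ok_left h).valid hlk he hl with ⟨x, hx, hxl⟩ | ⟨k, hk, hkl⟩
  · by_cases hxa : x = a.child .left
    · subst hxa
      cases Loc.side_eq_of_child_le hxl hal
    · have hx' : x ∈ q.concl \ {a.child .right} := by rw [← hF.eq]; simp [hx, hxa]
      simp only [Finset.mem_sdiff, Finset.mem_singleton] at hx'
      rcases Loc.le_total_of_le hxl hal with g | g
      · exact hx'.2 (hq.good.anti _ hx'.1 _ hF.right g)
      · exact hx'.2 (hq.good.anti _ hF.right _ hx'.1 g).symm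
  · refine h.good.sep a (by simp [Tree.concl]) k (by simp [Tree.cuts, hk]) ?_
    have := Loc.root_eq_of_le hal
    rw [Loc.child_root] at this
    rw [this]; exact hkl.name_mem

/-- Every linking of the whole proof reaches exactly one of the two arguments of `a`, so that the
linkings of a premise can be recovered from those of the conclusion. -/
theorem wth_linkings_left {a : Loc V ι} {p q : Tree V ι} (h : (Tree.wth a p q).OK Γ m) :
    p.linkings = {lk ∈ (Tree.wth a p q).linkings | Touches lk (a.child .left)} := by
  ext lk
  constructor
  · exact fun hl => ⟨Or.inl hl, touches_concl (wth_ok_left h).valid hl (wth_fits h).left⟩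
  · rintro ⟨hl | hl, ht⟩
    · exact hl
    · exact absurd ht (wth_not_touches_left h hl)

theorem wth_linkings_right {a : Loc V ι} {p q : Tree V ι} (h : (Tree.wth a p q).OK Γ m) :
    q.linkings = {lk ∈ (Tree.wth a p q).linkings | Touches lk (a.child .right)} := by
  ext lk
  constructor
  · exact fun hl => ⟨Or.inr hl, touches_concl (wth_ok_right h).valid hl (wth_fits h).right⟩
  · rintro ⟨hl | hl, ht⟩
    · exact absurd ht (wth_not_touches_right h hl)
    · exact hl

/-! ### Colourings of the leaves -/

/-- All leaves of the linkings of `t` lie in `χ`. -/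
def AllIn (χ : Set (Loc V ι)) (t : Tree V ι) : Prop :=
  ∀ lk ∈ t.linkings, ∀ e ∈ lk, ∀ l ∈ e, l ∈ χ

/-- The links in `lk` all of whose leaves lie in `χ`. -/
def res (χ : Set (Loc V ι)) (lk : Linking V ι) : Linking V ι := {e ∈ lk | ∀ l ∈ e, l ∈ χ}

/-- The links do not cross between `χ` and its complement, and the linkings are all combinations
of their restrictions to the two sets. -/
structure Splits (χ : Set (Loc V ι)) (θ : Set (Linking V ι)) : Prop where
  mono : ∀ lk ∈ θ, ∀ e ∈ lk, (∀ l ∈ e, l ∈ χ) ∨ ∀ l ∈ e, l ∈ χᶜ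
  closed : ∀ lk ∈ θ, ∀ lk' ∈ θ, res χ lk ∪ res χᶜ lk' ∈ θ

theorem Splits.compl {χ : Set (Loc V ι)} {θ : Set (Linking V ι)} (h : Splits χ θ) :
    Splits χᶜ θ where
  mono lk hlk e he := by rw [compl_compl]; exact (h.mono lk hlk e he).symm
  closed lk hlk lk' hlk' := by
    rw [compl_compl, Set.union_comm]; exact h.closed lk' hlk' lk hlk

theorem res_subset {χ : Set (Loc V ι)} {lk : Linking V ι} : res χ lk ⊆ lk := fun _ h => h.1

theorem res_union {χ : Set (Loc V ι)} {lk lk' : Linking V ι} :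
    res χ (lk ∪ lk') = res χ lk ∪ res χ lk' := by
  ext e; simp only [res, Set.mem_union, Set.mem_ofPred_eq]; tauto

theorem res_eq_self {χ : Set (Loc V ι)} {lk : Linking V ι}
    (h : ∀ e ∈ lk, ∀ l ∈ e, l ∈ χ) : res χ lk = lk := by
  ext e; exact ⟨fun h => h.1, fun he => ⟨he, h e he⟩⟩

theorem res_eq_empty {χ : Set (Loc V ι)} {lk : Linking V ι}
    (h : ∀ e ∈ lk, ∀ l ∈ e, l ∈ χᶜ) : res χ lk = ∅ := by
  ext e
  simp only [Set.mem_empty_iff_false, iff_false]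
  rintro ⟨he, hl⟩
  obtain ⟨l, hle⟩ := sym2_nonempty e
  exact h e he l hle (hl l hle)

/-- Restriction to `χ` keeps the links of `p` and erases those of `q`. No linking of `p` is lost,
because `q` has at least one linking with which to combine it. -/
theorem linkings_eq_res_left {χ : Set (Loc V ι)} {β : Bi V ι} {p q : Tree V ι}
    (hp : AllIn χ p) (hq : AllIn χᶜ q) : p.linkings = res χ '' (β.node p q).linkings := by
  rw [Bi.linkings_node]
  obtain ⟨k, hk⟩ := q.linkings_nonempty
  have key : ∀ lk ∈ p.linkings, ∀ lk' ∈ q.linkings, res χ (lk ∪ lk') = lk := by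
    intro lk h lk' h'
    rw [res_union, res_eq_self (hp lk h), res_eq_empty (hq lk' h'), Set.union_empty]
  ext lk
  constructor
  · exact fun h => ⟨_, ⟨lk, h, k, hk, rfl⟩, key lk h k hk⟩
  · rintro ⟨_, ⟨l1, h1, l2, h2, rfl⟩, rfl⟩
    simp only [key l1 h1 l2 h2, h1]

theorem Bi.linkings_flip (β : Bi V ι) (p q : Tree V ι) :
    (β.flip.node q p).linkings = (β.node p q).linkings := by
  rw [Bi.linkings_node, Bi.linkings_node]; exact image2_union_comm _ _

theorem linkings_eq_res_right {χ : Set (Loc V ι)} {β : Bi V ι} {p q : Tree V ι}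
    (hp : AllIn χ p) (hq : AllIn χᶜ q) : q.linkings = res χᶜ '' (β.node p q).linkings := by
  rw [linkings_eq_res_left (β := β.flip) hq ((compl_compl χ).symm ▸ hp),
    Bi.linkings_flip]

/-- The subtree with root `x` lies in `χ`. -/
def Under (χ : Set (Loc V ι)) (x : Loc V ι) : Prop := ∀ l, x ≤ l → l ∈ χ

theorem Under.mono {χ : Set (Loc V ι)} {x y : Loc V ι} (h : Under χ x) (hxy : x ≤ y) :
    Under χ y := fun l hl => h l (hxy.trans hl)

/-- The occurrences consumed by the rule lie in `χ`. -/
def Bi.In (χ : Set (Loc V ι)) (γ : Bi V ι) : Prop :=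
  ∀ x, x ∈ γ.actL ∨ x ∈ γ.actR → Under χ x

theorem Bi.In.flip {χ : Set (Loc V ι)} {γ : Bi V ι} (h : γ.In χ) : γ.flip.In χ := by
  intro x hx
  rw [Bi.actL_flip, Bi.actR_flip] at hx
  exact h x hx.symm

theorem Bi.In.mix (χ : Set (Loc V ι)) : (Bi.mix : Bi V ι).In χ := by
  intro x hx; simp [Bi.actL, Bi.actR] at hx

/-- The colouring `χ` assigns one colour to each conclusion and each cut of `t`, except for those
generated by `β`; the arguments of `β` have different colours. -/
structure Col (β : Bi V ι) (χ : Set (Loc V ι)) (t : Tree V ι) : Prop where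
  concl : ∀ x ∈ t.concl, x ∉ β.out → Under χ x ∨ Under χᶜ x
  cuts : ∀ k ∈ t.cuts, k ∉ β.cuts →
    (∀ l : Loc V ι, l.OnCut k → l ∈ χ) ∨ ∀ l : Loc V ι, l.OnCut k → l ∈ χᶜ
  left : ∀ x ∈ β.actL, Under χ x
  right : ∀ x ∈ β.actR, Under χᶜ x

theorem Col.flip {β : Bi V ι} {χ : Set (Loc V ι)} {t : Tree V ι} (h : Col β χ t) :
    Col β.flip χᶜ t where
  concl x hx hb := by
    rw [compl_compl]; exact (h.concl x hx (by simpa using hb)).symm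
  cuts k hk hb := by
    rw [compl_compl]; exact (h.cuts k hk (by simpa using hb)).symm
  left x hx := h.right x (by simpa using hx)
  right x hx := by rw [compl_compl]; exact h.left x (by simpa using hx)

theorem AllIn.compl {χ : Set (Loc V ι)} {t : Tree V ι} (h : AllIn χ t) : AllIn χᶜᶜ t := by
  rwa [compl_compl]

theorem AllIn.bi {χ : Set (Loc V ι)} {β : Bi V ι} {p q : Tree V ι} (hp : AllIn χ p)
    (hq : AllIn χ q) : AllIn χ (β.node p q) := by
  intro lk hlk
  rw [Bi.linkings_node] at hlk
  obtain ⟨l1, h1, l2, h2, rfl⟩ := hlk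
  rintro e (he | he)
  · exact hp l1 h1 e he
  · exact hq l2 h2 e he

theorem AllIn.un {χ : Set (Loc V ι)} {u : Un V ι} {p : Tree V ι} (hp : AllIn χ p) :
    AllIn χ (u.node p) := by
  rw [AllIn, Un.linkings_node]; exact hp

theorem AllIn.wth {χ : Set (Loc V ι)} {a : Loc V ι} {p q : Tree V ι} (hp : AllIn χ p)
    (hq : AllIn χ q) : AllIn χ (.wth a p q) := by
  rintro lk (h | h)
  · exact hp lk h
  · exact hq lk h

/-- Every linking has a leaf below `x`, and this leaf lies outside `χ`. -/
theorem not_under_of_allIn {χ : Set (Loc V ι)} {t : Tree V ι} (ht : t.Valid Γ m)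
    (h : AllIn χᶜ t) {x y : Loc V ι} (hx : x ∈ t.concl) (hyx : y ≤ x) : ¬ Under χ y := by
  intro hu
  obtain ⟨lk, hlk⟩ := t.linkings_nonempty
  obtain ⟨e, he, l, hl, hxl⟩ := touches_concl ht hlk hx
  exact h lk hlk e he l hl (hu l (hyx.trans hxl))

/-- An occurrence generated by `β` has a child in `q`, hence leaves outside `χ`, and so has every
context formula of `q`. Only the context of `p` remains. -/
theorem mem_left_of_under {χ : Set (Loc V ι)} {β : Bi V ι} {p q : Tree V ι}
    (hok : (β.node p q).OK Γ m) (hq : AllIn χᶜ q) {x : Loc V ι}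
    (hx : x ∈ (β.node p q).concl) (hu : Under χ x) : x ∈ p.concl := by
  have hv := (Bi.ok_right hok).valid
  simp only [Bi.concl_node, Bi.result, Finset.mem_union, Finset.mem_sdiff] at hx
  rcases hx with hx | hx | hx
  · obtain ⟨d, hd⟩ := (Bi.exists_actL hx).2
    exact absurd hu (not_under_of_allIn hv hq ((Bi.ok_fits hok).actR hd) (x.le_child d))
  · exact hx.1
  · exact absurd hu (not_under_of_allIn hv hq hx.1 le_rfl)

theorem mem_right_of_under {χ : Set (Loc V ι)} {β : Bi V ι} {p q : Tree V ι}
    (hok : (β.node p q).OK Γ m) (hp : AllIn χ p) {x : Loc V ι}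
    (hx : x ∈ (β.node p q).concl) (hu : Under χᶜ x) : x ∈ q.concl := by
  have hf := Conv.flip (Γ := Γ) (m := m) β p q
  refine mem_left_of_under (hf.ok hok) hp.compl ?_ hu
  rwa [← hf.agree.concl]

/-! ### Splitting by mix along a colouring -/

variable (Γ m) in
/-- Up to commutations, the tree is the `mix` of one with leaves in `χ` and possibly one with
leaves in the complement. -/
def LSplit (χ : Set (Loc V ι)) (t : Tree V ι) : Prop :=
  AllIn χ t ∨ ∃ p q, Conv Γ m t (.mix p q) ∧ AllIn χ p ∧ AllIn χᶜ q

theorem LSplit.cases {χ : Set (Loc V ι)} {t : Tree V ι} (h : LSplit Γ m χ t) :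
    AllIn χ t ∨ LSplit Γ m χᶜ t := by
  rcases h with h | ⟨p, q, h, hp, hq⟩
  · exact .inl h
  · exact .inr (.inr ⟨q, p, h.trans (.mix_swap _ _), hq, hp.compl⟩)

theorem mix_assoc {p q r : Tree V ι} (h : (Tree.mix p (.mix q r)).OK Γ m) :
    Conv Γ m (.mix p (.mix q r)) (.mix (.mix p q) r) :=
  bi_bi (β := .mix) (γ := .mix) h (by simp [Bi.actR])

theorem mix_assoc' {p q r : Tree V ι} (h : (Tree.mix (.mix p q) r).OK Γ m) :
    Conv Γ m (.mix (.mix p q) r) (.mix p (.mix q r)) := by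
  have h1 : Conv Γ m (.mix (.mix p q) r) (.mix r (.mix q p)) :=
    (Conv.mix_swap _ _).trans (.mix (.refl _) (.mix_swap _ _))
  exact h1.trans ((mix_assoc (h1.ok h)).trans
    ((Conv.mix_swap _ _).trans (.mix (.refl _) (.mix_swap _ _))))

/-- The second argument of `γ` lies in `χ`, hence in the part `q1` of `q`. The other part is not
involved in `γ` and can be split off below it. -/
theorem LSplit.bi_right {χ : Set (Loc V ι)} {γ : Bi V ι} {p q : Tree V ι}
    (h : (γ.node p q).OK Γ m) (hγ : γ.In χ) (hp : AllIn χ p) (hq : LSplit Γ m χ q) :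
    LSplit Γ m χ (γ.node p q) := by
  rcases hq with hq | ⟨q1, q2, hc, h1, h2⟩
  · exact .inl (hp.bi hq)
  · have c1 : Conv Γ m (γ.node p q) (γ.node p (Bi.mix.node q1 q2)) := .bi (.refl _) hc
    have ok1 := c1.ok h
    refine .inr ⟨γ.node p q1, q2, c1.trans (bi_bi ok1 ?_), hp.bi h1, h2⟩
    exact fun x hx => mem_left_of_under (Bi.ok_right ok1) h2 ((Bi.ok_fits ok1).actR hx)
      (hγ x (.inr hx))

/-- A rule whose arguments lie in `χ` preserves splittings by `χ`. -/
theorem LSplit.bi {χ : Set (Loc V ι)} {γ : Bi V ι} {p q : Tree V ι}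
    (h : (γ.node p q).OK Γ m) (hγ : γ.In χ) (hp : LSplit Γ m χ p) (hq : LSplit Γ m χ q) :
    LSplit Γ m χ (γ.node p q) := by
  rcases hp with hp | ⟨p1, p2, hc, h1, h2⟩
  · exact .bi_right h hγ hp hq
  · have c1 : Conv Γ m (γ.node p q) (γ.flip.node q (Bi.mix.node p1 p2)) :=
      (Conv.flip _ _ _).trans (.bi (.refl _) hc)
    have ok1 := c1.ok h
    have c2 : Conv Γ m (γ.node p q) (.mix (γ.node p1 q) p2) := by
      refine c1.trans ((bi_bi ok1 ?_).trans (.mix (.flip' _ _ _) (.refl _)))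
      exact fun x hx => mem_left_of_under (Bi.ok_right ok1) h2 ((Bi.ok_fits ok1).actR hx)
        (hγ.flip x (.inr hx))
    have ok2 := c2.ok h
    rcases LSplit.bi_right (Bi.ok_left (β := .mix) ok2) hγ h1 hq with h3 | ⟨r1, r2, hc, h3, h4⟩
    · exact .inr ⟨_, _, c2, h3, h2⟩
    · have c3 := c2.trans (.mix hc (.refl _))
      exact .inr ⟨_, _, c3.trans (mix_assoc' (c3.ok h)), h3, AllIn.bi (β := .mix) h4 h2⟩

theorem LSplit.un {χ : Set (Loc V ι)} {u : Un V ι} {p : Tree V ι}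
    (h : (u.node p).OK Γ m) (hu : Under χ u.out) (hp : LSplit Γ m χ p) :
    LSplit Γ m χ (u.node p) := by
  rcases hp with hp | ⟨p1, p2, hc, h1, h2⟩
  · exact .inl hp.un
  · have c1 : Conv Γ m (u.node p) (u.node (Bi.mix.node p2 p1)) :=
      .un (hc.trans (.mix_swap _ _))
    have ok1 := c1.ok h
    refine .inr ⟨u.node p1, p2, c1.trans ((bi_un ok1 ?_).trans (.mix_swap _ _)), h1.un, h2⟩
    intro x hx
    obtain ⟨d, rfl⟩ := Un.child_of_mem_act hx
    exact mem_right_of_under (χ := χᶜ) (Un.ok_premise ok1) h2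
      ((Un.ok_fits ok1).2.1 hx) (by rw [compl_compl]; exact hu.mono (Loc.le_child _ _))

/-! ### Splitting at a prescribed last rule -/

variable (Γ m) in
/-- Up to commutations, the last rule is `β`, with leaves in `χ` and its complement. -/
def SplitAt (β : Bi V ι) (χ : Set (Loc V ι)) (t : Tree V ι) : Prop :=
  ∃ p q, Conv Γ m t (β.node p q) ∧ AllIn χ p ∧ AllIn χᶜ q

theorem SplitAt.flip {β : Bi V ι} {χ : Set (Loc V ι)} {t : Tree V ι}
    (h : SplitAt Γ m β χ t) : SplitAt Γ m β.flip χᶜ t := by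
  obtain ⟨p, q, h, hp, hq⟩ := h
  exact ⟨q, p, h.trans (.flip _ _ _), hq, hp.compl⟩

theorem SplitAt.of_flip {β : Bi V ι} {χ : Set (Loc V ι)} {t : Tree V ι}
    (h : SplitAt Γ m β.flip χᶜ t) : SplitAt Γ m β χ t := by
  simpa using h.flip

theorem SplitAt.un_left {β : Bi V ι} {χ : Set (Loc V ι)} {u : Un V ι} {p : Tree V ι}
    (h : (u.node p).OK Γ m) (hu : Under χ u.out) (hp : SplitAt Γ m β χ p) :
    SplitAt Γ m β χ (u.node p) := by
  obtain ⟨p1, p2, hc, h1, h2⟩ := hp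
  have c1 : Conv Γ m (u.node p) (u.node (β.flip.node p2 p1)) :=
    .un (hc.trans (.flip _ _ _))
  have ok1 := c1.ok h
  refine ⟨u.node p1, p2, c1.trans ((bi_un ok1 ?_).trans (.flip' _ _ _)), h1.un, h2⟩
  intro x hx
  obtain ⟨d, rfl⟩ := Un.child_of_mem_act hx
  exact mem_right_of_under (χ := χᶜ) (Un.ok_premise ok1) h2
    ((Un.ok_fits ok1).2.1 hx) (by rw [compl_compl]; exact hu.mono (Loc.le_child _ _))

theorem SplitAt.un {β : Bi V ι} {χ : Set (Loc V ι)} {u : Un V ι} {p : Tree V ι}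
    (h : (u.node p).OK Γ m) (hu : Under χ u.out ∨ Under χᶜ u.out) (hp : SplitAt Γ m β χ p) :
    SplitAt Γ m β χ (u.node p) := by
  rcases hu with hu | hu
  · exact .un_left h hu hp
  · exact (SplitAt.un_left h hu hp.flip).of_flip

theorem SplitAt.bi_allIn {β γ : Bi V ι} {χ : Set (Loc V ι)} {p q : Tree V ι}
    (h : (γ.node p q).OK Γ m) (hγ : γ.In χ) (hp : SplitAt Γ m β χ p) (hq : AllIn χ q) :
    SplitAt Γ m β χ (γ.node p q) := by
  obtain ⟨p1, p2, hc, h1, h2⟩ := hp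
  have c1 : Conv Γ m (γ.node p q) (γ.flip.node q (β.node p1 p2)) :=
    (Conv.flip _ _ _).trans (.bi (.refl _) hc)
  have ok1 := c1.ok h
  refine ⟨γ.node p1 q, p2, c1.trans ((bi_bi ok1 ?_).trans (.bi (.flip' _ _ _) (.refl _))),
    h1.bi hq, h2⟩
  exact fun x hx => mem_left_of_under (Bi.ok_right ok1) h2 ((Bi.ok_fits ok1).actR hx)
    (hγ.flip x (.inr hx))

/-- The part of `q` outside `χ` is first split off by a mix below `γ`. The rest of `q` joins the
first premise of `β`, and the part split off is then mixed into the second. -/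
theorem SplitAt.bi_left {β γ : Bi V ι} {χ : Set (Loc V ι)} {p q : Tree V ι}
    (h : (γ.node p q).OK Γ m) (hγ : γ.In χ) (hp : SplitAt Γ m β χ p) (hq : LSplit Γ m χ q) :
    SplitAt Γ m β χ (γ.node p q) := by
  rcases hq with hq | ⟨q1, q2, hc, h1, h2⟩
  · exact .bi_allIn h hγ hp hq
  · have c1 : Conv Γ m (γ.node p q) (γ.node p (Bi.mix.node q1 q2)) := .bi (.refl _) hc
    have ok1 := c1.ok h
    have c2 : Conv Γ m (γ.node p q) (.mix (γ.node p q1) q2) := by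
      refine c1.trans (bi_bi ok1 ?_)
      exact fun x hx => mem_left_of_under (Bi.ok_right ok1) h2 ((Bi.ok_fits ok1).actR hx)
        (hγ x (.inr hx))
    have ok2 := c2.ok h
    obtain ⟨r1, r2, hc', h3, h4⟩ := SplitAt.bi_allIn (Bi.ok_left (β := .mix) ok2) hγ hp h1
    have c3 : Conv Γ m (γ.node p q) (Bi.mix.node q2 (β.flip.node r2 r1)) :=
      c2.trans ((Conv.mix (hc'.trans (.flip _ _ _)) (.refl _)).trans (.mix_swap _ _))
    have c4 := c3.trans (bi_bi (c3.ok h) (by simp [Bi.actR]))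
    exact ⟨r1, _, c4.trans (.flip' _ _ _), h3, AllIn.bi (β := .mix) h2 h4⟩

/-- Moving a part of the first premise of a rule to the second one. -/
theorem bi_mix_shift {β : Bi V ι} {p1 p2 q : Tree V ι}
    (h : (β.node (.mix p1 p2) q).OK Γ m) (hL : β.actL ⊆ p1.concl) :
    Conv Γ m (β.node (.mix p1 p2) q) (β.node p1 (.mix p2 q)) := by
  have c1 : Conv Γ m (β.node (.mix p1 p2) q) (β.flip.node q (Bi.mix.node p1 p2)) := .flip _ _ _
  have c2 := c1.trans (bi_bi (c1.ok h) (by simpa using hL))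
  have c3 : Conv Γ m (β.node (.mix p1 p2) q) (Bi.mix.node p2 (β.flip.node q p1)) :=
    c2.trans (.mix_swap _ _)
  exact c3.trans ((bi_bi (c3.ok h) (by simp [Bi.actR])).trans (.flip' _ _ _))

theorem SplitAt.base_allIn {β : Bi V ι} {χ : Set (Loc V ι)} {p q : Tree V ι}
    (h : (β.node p q).OK Γ m) (hL : ∀ x ∈ β.actL, Under χ x) (hp : LSplit Γ m χ p)
    (hq : AllIn χᶜ q) : SplitAt Γ m β χ (β.node p q) := by
  rcases hp with hp | ⟨p1, p2, hc, h1, h2⟩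
  · exact ⟨p, q, .refl _, hp, hq⟩
  · have c1 : Conv Γ m (β.node p q) (β.node (.mix p1 p2) q) := .bi hc (.refl _)
    have ok1 := c1.ok h
    refine ⟨p1, _, c1.trans (bi_mix_shift ok1 ?_), h1, AllIn.bi (β := .mix) h2 hq⟩
    exact fun x hx => mem_left_of_under (β := .mix) (Bi.ok_left ok1) h2
      ((Bi.ok_fits ok1).actL hx) (hL x hx)

/-- Whatever has the wrong colour in one premise is handed over to the other by a mix: first the
second premise is cleaned, then the first, which by then includes what the second gave up. -/
theorem SplitAt.base {β : Bi V ι} {χ : Set (Loc V ι)} {p q : Tree V ι}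
    (h : (β.node p q).OK Γ m) (hL : ∀ x ∈ β.actL, Under χ x) (hR : ∀ x ∈ β.actR, Under χᶜ x)
    (hp : LSplit Γ m χ p) (hq : LSplit Γ m χᶜ q) : SplitAt Γ m β χ (β.node p q) := by
  rcases hq with hq | ⟨q1, q2, hc, h1, h2⟩
  · exact .base_allIn h hL hp hq
  · have c1 : Conv Γ m (β.node p q) (β.flip.node (.mix q1 q2) p) :=
      (Conv.bi (.refl _) hc).trans (.flip _ _ _)
    have ok1 := c1.ok h
    have c2 : Conv Γ m (β.node p q) (β.node (.mix q2 p) q1) := by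
      refine c1.trans ((bi_mix_shift ok1 ?_).trans (.flip' _ _ _))
      exact fun x hx => mem_left_of_under (β := .mix) (Bi.ok_left ok1) h2
        ((Bi.ok_fits ok1).actL hx) (hR x (by simpa using hx))
    have ok2 := c2.ok h
    rw [compl_compl] at h2
    obtain ⟨r, s, hc, k⟩ := SplitAt.base_allIn ok2 hL
      (LSplit.bi (γ := .mix) (Bi.ok_left ok2) (.mix χ) (.inl h2) hp) h1
    exact ⟨r, s, c2.trans hc, k⟩

/-! ### Colourings of premises -/

theorem Touches.res {χ : Set (Loc V ι)} {lk : Linking V ι} {x : Loc V ι} (h : Touches lk x)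
    (hu : Under χ x) (hm : ∀ e ∈ lk, (∀ l ∈ e, l ∈ χ) ∨ ∀ l ∈ e, l ∈ χᶜ) :
    Touches (res χ lk) x := by
  obtain ⟨e, he, l, hl, hx⟩ := h
  rcases hm e he with k | k
  · exact ⟨e, ⟨he, k⟩, l, hl, hx⟩
  · exact absurd (hu l hx) (k l hl)

theorem bi_links_disjoint {β : Bi V ι} {p q : Tree V ι} (h : (β.node p q).OK Γ m)
    {lk lk' : Linking V ι} (hp : lk ∈ p.linkings) (hq : lk' ∈ q.linkings)
    {e : Sym2 (Loc V ι)} (he : e ∈ lk) : e ∉ lk' := by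
  intro he'
  obtain ⟨l, hl⟩ := sym2_nonempty e
  exact (Bi.premises h).supp_disjoint (mem_supp (Bi.ok_left h).valid hp he hl)
    (mem_supp (Bi.ok_right h).valid hq he' hl)

/-- Linkings of `p` are completed by one fixed linking of `q` and recombined there. The share of `p`
in the result can be read off because `p` and `q` have no link in common. -/
theorem Splits.bi_left {χ : Set (Loc V ι)} {β : Bi V ι} {p q : Tree V ι}
    (h : (β.node p q).OK Γ m) (hs : Splits χ (β.node p q).linkings) : Splits χ p.linkings := by
  obtain ⟨k, hk⟩ := q.linkings_nonempty
  rw [Bi.linkings_node] at hs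
  constructor
  · exact fun lk hlk e he => hs.mono _ ⟨lk, hlk, k, hk, rfl⟩ e (Or.inl he)
  · intro lk hlk lk' hlk'
    obtain ⟨l1, h1, l2, h2, he⟩ := hs.closed _ ⟨lk, hlk, k, hk, rfl⟩ _ ⟨lk', hlk', k, hk, rfl⟩
    have : res χ lk ∪ res χᶜ lk' = l1 := by
      ext e
      have hm := iff_of_eq (congrArg (e ∈ ·) he)
      simp only [res_union, Set.mem_union] at hm ⊢
      constructor
      · intro hx
        rcases hm.2 (by tauto) with h3 | h3
        · exact h3
        · rcases hx with hx | hx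
          · exact absurd h3 (bi_links_disjoint h hlk h2 hx.1)
          · exact absurd h3 (bi_links_disjoint h hlk' h2 hx.1)
      · intro hx
        rcases hm.1 (Or.inl hx) with (h3 | h3) | h3 | h3
        · exact .inl h3
        · exact absurd h3.1 (bi_links_disjoint h h1 hk hx)
        · exact .inr h3
        · exact absurd h3.1 (bi_links_disjoint h h1 hk hx)
    rwa [this]

theorem Splits.bi_right {χ : Set (Loc V ι)} {β : Bi V ι} {p q : Tree V ι}
    (h : (β.node p q).OK Γ m) (hs : Splits χ (β.node p q).linkings) : Splits χ q.linkings := by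
  have hf := Conv.flip (Γ := Γ) (m := m) β p q
  exact Splits.bi_left (hf.ok h) (hf.agree.linkings ▸ hs)

/-- A link below `b` has the colour `χ` of `b`, so the recombined linking still reaches the argument
of `b` that `lk` reaches: the choice made at `b` is governed by the `χ`-part alone. -/
theorem Splits.wth_closed {χ : Set (Loc V ι)} {b : Loc V ι} {p q : Tree V ι}
    (hb : Under χ b) (hs : Splits χ (Tree.wth b p q).linkings) {lk lk' : Linking V ι} {d : Side}
    (hlk : lk ∈ (Tree.wth b p q).linkings) (hlk' : lk' ∈ (Tree.wth b p q).linkings)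
    (ht : Touches lk (b.child d)) :
    res χ lk ∪ res χᶜ lk' ∈ {lk ∈ (Tree.wth b p q).linkings | Touches lk (b.child d)} :=
  ⟨hs.closed _ hlk _ hlk', (ht.res (hb.mono (b.le_child d)) (hs.mono lk hlk)).mono
    Set.subset_union_left⟩

theorem Splits.wth_left {χ : Set (Loc V ι)} {b : Loc V ι} {p q : Tree V ι}
    (h : (Tree.wth b p q).OK Γ m) (hb : Under χ b ∨ Under χᶜ b)
    (hs : Splits χ (Tree.wth b p q).linkings) : Splits χ p.linkings := by
  wlog hb' : Under χ b generalizing χ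
  · have := this (χ := χᶜ) (by rw [compl_compl]; exact hb.symm) hs.compl (by tauto)
    simpa using this.compl
  refine ⟨fun lk hlk => hs.mono lk (Or.inl hlk), fun lk hlk lk' hlk' => ?_⟩
  rw [wth_linkings_left h]
  exact hs.wth_closed hb' (Or.inl hlk) (Or.inl hlk')
    (touches_concl (wth_ok_left h).valid hlk (wth_fits h).left)

theorem Splits.wth_right {χ : Set (Loc V ι)} {b : Loc V ι} {p q : Tree V ι}
    (h : (Tree.wth b p q).OK Γ m) (hb : Under χ b ∨ Under χᶜ b)
    (hs : Splits χ (Tree.wth b p q).linkings) : Splits χ q.linkings := by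
  wlog hb' : Under χ b generalizing χ
  · have := this (χ := χᶜ) (by rw [compl_compl]; exact hb.symm) hs.compl (by tauto)
    simpa using this.compl
  refine ⟨fun lk hlk => hs.mono lk (Or.inr hlk), fun lk hlk lk' hlk' => ?_⟩
  rw [wth_linkings_right h]
  exact hs.wth_closed hb' (Or.inr hlk) (Or.inr hlk')
    (touches_concl (wth_ok_right h).valid hlk (wth_fits h).right)

theorem res_compl_union {χ : Set (Loc V ι)} {lk lk' : Linking V ι} :
    res χᶜ (res χ lk ∪ res χᶜ lk') = res χᶜ lk' := by
  rw [res_union, res_eq_empty (lk := res χ lk) (fun e he l hl => by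
    rw [compl_compl]; exact he.2 l hl), Set.empty_union, res_eq_self fun e he => he.2]

/-- Outside of the colour of `b`, the premises of `wth` have the same linkings. -/
theorem wth_res_eq {χ : Set (Loc V ι)} {b : Loc V ι} {p q : Tree V ι}
    (h : (Tree.wth b p q).OK Γ m) (hb : Under χ b) (hs : Splits χ (Tree.wth b p q).linkings) :
    res χᶜ '' p.linkings = res χᶜ '' q.linkings := by
  obtain ⟨k, hk⟩ := p.linkings_nonempty
  obtain ⟨k', hk'⟩ := q.linkings_nonempty
  ext x
  constructor
  · rintro ⟨lk, hlk, rfl⟩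
    -- The `χ`-part of `k'` makes the combination reach the right argument of `b`, which places it
    -- among the linkings of `q`, while its other part is that of `lk`.
    refine ⟨res χ k' ∪ res χᶜ lk, ?_, res_compl_union⟩
    rw [wth_linkings_right h]
    exact hs.wth_closed hb (Or.inr hk') (Or.inl hlk)
      (touches_concl (wth_ok_right h).valid hk' (wth_fits h).right)
  · rintro ⟨lk, hlk, rfl⟩
    refine ⟨res χ k ∪ res χᶜ lk, ?_, res_compl_union⟩
    rw [wth_linkings_left h]
    exact hs.wth_closed hb (Or.inl hk) (Or.inr hlk)
      (touches_concl (wth_ok_left h).valid hk (wth_fits h).left)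

theorem Col.un {β : Bi V ι} {χ : Set (Loc V ι)} {u : Un V ι} {p : Tree V ι}
    (h : Col β χ (u.node p)) (hu : u.out ∉ β.out) : Col β χ p where
  concl x hx hb := by
    by_cases hxa : x ∈ u.act
    · obtain ⟨d, rfl⟩ := Un.child_of_mem_act hxa
      exact (h.concl u.out (by simp [Un.result]) hu).imp
        (fun k => k.mono (Loc.le_child _ _)) fun k => k.mono (Loc.le_child _ _)
    · exact h.concl x (by simp [Un.result, hx, hxa]) hb
  cuts k hk := h.cuts k (by simpa using hk)
  left := h.left
  right := h.right

/-- The arguments of a tensor inherit the colour of the formula it generates, those of a cut the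
colour of the cut; a mix has no arguments. -/
theorem Col.in_or {β γ : Bi V ι} {χ : Set (Loc V ι)} {p q : Tree V ι}
    (h : Col β χ (γ.node p q)) (ho : ∀ x ∈ γ.out, x ∉ β.out) (hc : ∀ k ∈ γ.cuts, k ∉ β.cuts) :
    γ.In χ ∨ γ.In χᶜ := by
  have key : ∀ a ∈ γ.out, Under χ a ∨ Under χᶜ a := fun a ha =>
    h.concl a (by simp [Bi.result, ha]) (ho a ha)
  have key' : ∀ k ∈ γ.cuts, (∀ l : Loc V ι, l.OnCut k → l ∈ χ) ∨
      ∀ l : Loc V ι, l.OnCut k → l ∈ χᶜ := fun k hk => h.cuts k (by simp [hk]) (hc k hk)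
  have fin : ∀ χ' : Set (Loc V ι), (∀ a ∈ γ.out, Under χ' a) →
      (∀ k ∈ γ.cuts, ∀ l : Loc V ι, l.OnCut k → l ∈ χ') → γ.In χ' := by
    intro χ' h1 h2 x hx
    rcases Bi.act_cases hx with ⟨y, hy, d, rfl⟩ | ⟨c, A, rfl, hk⟩
    · exact (h1 y hy).mono (Loc.le_child _ _)
    · exact fun l hl => h2 _ hk l ⟨A, Loc.ofCut_le.1 hl, rfl⟩
  cases γ with
  | tensor a => exact (key a (by simp [Bi.out])).imp (fun k => fin _ (by simpa [Bi.out] using k)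
      (by simp [Bi.cuts])) fun k => fin _ (by simpa [Bi.out] using k) (by simp [Bi.cuts])
  | tensor' a => exact (key a (by simp [Bi.out])).imp (fun k => fin _ (by simpa [Bi.out] using k)
      (by simp [Bi.cuts])) fun k => fin _ (by simpa [Bi.out] using k) (by simp [Bi.cuts])
  | mix => exact .inl (.mix χ)
  | cut c A =>
    exact (key' (c, s(A, A.dual)) (by simp [Bi.cuts])).imp
      (fun k => fin _ (by simp [Bi.out]) (by simpa [Bi.cuts] using k))
      fun k => fin _ (by simp [Bi.out]) (by simpa [Bi.cuts] using k)

theorem Bi.In.or_under {γ : Bi V ι} {χ : Set (Loc V ι)} (h : γ.In χ ∨ γ.In χᶜ) {x : Loc V ι}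
    (hx : x ∈ γ.actL ∨ x ∈ γ.actR) : Under χ x ∨ Under χᶜ x :=
  h.imp (fun k => k x hx) fun k => k x hx

theorem Col.bi_left {β γ : Bi V ι} {χ : Set (Loc V ι)} {p q : Tree V ι}
    (h : Col β χ (γ.node p q)) (hγ : γ.In χ ∨ γ.In χᶜ) : Col β χ p where
  concl x hx hb := by
    by_cases hxa : x ∈ γ.actL
    · exact Bi.In.or_under hγ (.inl hxa)
    · exact h.concl x (by simp [Bi.result, hx, hxa]) hb
  cuts k hk := h.cuts k (by simp [hk])
  left := h.left
  right := h.right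

theorem Col.bi_right {β γ : Bi V ι} {χ : Set (Loc V ι)} {p q : Tree V ι}
    (h : Col β χ (γ.node p q)) (hγ : γ.In χ ∨ γ.In χᶜ) : Col β χ q where
  concl x hx hb := by
    by_cases hxa : x ∈ γ.actR
    · exact Bi.In.or_under hγ (.inr hxa)
    · exact h.concl x (by simp [Bi.result, hx, hxa]) hb
  cuts k hk := h.cuts k (by simp [hk])
  left := h.left
  right := h.right

theorem Col.wth_left {β : Bi V ι} {χ : Set (Loc V ι)} {b : Loc V ι} {p q : Tree V ι}
    (h : Col β χ (.wth b p q)) (hb : b ∉ β.out) : Col β χ p where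
  concl x hx hxb := by
    by_cases hxa : x = b.child .left
    · subst hxa
      exact (h.concl b (by simp [Tree.concl]) hb).imp
        (fun k => k.mono (Loc.le_child _ _)) fun k => k.mono (Loc.le_child _ _)
    · exact h.concl x (by simp [Tree.concl, hx, hxa]) hxb
  cuts k hk := h.cuts k (by simp [Tree.cuts, hk])
  left := h.left
  right := h.right

theorem Col.wth_right {β : Bi V ι} {χ : Set (Loc V ι)} {b : Loc V ι} {p q : Tree V ι}
    (hF : WthFits Γ b p.concl q.concl) (h : Col β χ (.wth b p q)) (hb : b ∉ β.out) :
    Col β χ q where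
  concl x hx hxb := by
    by_cases hxa : x = b.child .right
    · subst hxa
      exact (h.concl b (by simp [Tree.concl]) hb).imp
        (fun k => k.mono (Loc.le_child _ _)) fun k => k.mono (Loc.le_child _ _)
    · exact h.concl x (by rw [Tree.concl, hF.eq]; simp [hx, hxa]) hxb
  cuts k hk := h.cuts k (by simp [Tree.cuts, hk])
  left := h.left
  right := h.right

/-- The occurrence or the cut generated by `β` is present. -/
def Bi.Present (β : Bi V ι) (t : Tree V ι) : Prop := β.out ⊆ t.concl ∧ β.cuts ⊆ t.cuts

/-- As a mix generates nothing, `Col .mix` says that every conclusion and every cut is coloured,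
without exceptions. This is the situation in the subproofs from which the output of `β` is absent.
-/
theorem Col.to_mix {β : Bi V ι} {χ : Set (Loc V ι)} {t : Tree V ι} (h : Col β χ t)
    (ho : ∀ x ∈ t.concl, x ∉ β.out) (hc : ∀ k ∈ t.cuts, k ∉ β.cuts) : Col .mix χ t where
  concl x hx _ := h.concl x hx (ho x hx)
  cuts k hk _ := h.cuts k hk (hc k hk)
  left := by simp [Bi.actL]
  right := by simp [Bi.actR]

/-- The premises of `γ` share neither occurrences nor names of cuts, so what `β` generates is absent
from `q` if it is present in `p`. -/
theorem Col.mix_of_present {β γ : Bi V ι} {χ : Set (Loc V ι)} {p q : Tree V ι}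
    (hok : (γ.node p q).OK Γ m) (h : Col β χ (γ.node p q)) (hγ : γ.In χ ∨ γ.In χᶜ)
    (hp : β.Present p) : Col .mix χ q := by
  refine (h.bi_right hγ).to_mix (fun x hx hb => ?_) fun k hk hb => ?_
  · exact Finset.disjoint_left.1 (Bi.premises hok).disj (hp.1 hb) hx
  · exact (Bi.premises hok).names k (hp.2 hb) k hk rfl

/-- Above `β` the exceptional occurrence or cut is gone, and in its place stands an argument of one
colour. -/
theorem Col.base_left {β : Bi V ι} {χ : Set (Loc V ι)} {p q : Tree V ι}
    (hok : (β.node p q).OK Γ m) (h : Col β χ (β.node p q)) : Col .mix χ p where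
  concl x hx _ := by
    by_cases hxa : x ∈ β.actL
    · exact .inl (h.left x hxa)
    · refine h.concl x (by simp [Bi.result, hx, hxa]) fun hb => ?_
      exact Finset.disjoint_left.1 (Bi.ok_fits hok).outL hb hx
  cuts k hk _ := h.cuts k (by simp [hk]) fun hb =>
    (Bi.apart_node.1 hok.apart).2.2.2.1 k hb k hk rfl
  left := by simp [Bi.actL]
  right := by simp [Bi.actR]

theorem Col.congr {β : Bi V ι} {χ : Set (Loc V ι)} {s t : Tree V ι} (h : Col β χ s)
    (hc : s.concl = t.concl) (hk : s.cuts = t.cuts) : Col β χ t :=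
  ⟨hc ▸ h.concl, hk ▸ h.cuts, h.left, h.right⟩

/-! ### Splitting a proof along a colouring -/

/-- A context formula of `p₂` has a leaf outside `χ`; having one colour, it lies entirely outside
and must belong to the second premise of the other proof as well. -/
theorem right_subset {β : Bi V ι} {χ : Set (Loc V ι)} {p₁ p₂ q₁ q₂ : Tree V ι}
    (hp : (β.node p₁ p₂).OK Γ m) (hq : (β.node q₁ q₂).OK Γ m) (h2 : AllIn χᶜ p₂)
    (h1 : AllIn χ q₁) (h : ∀ x ∈ p₂.concl, x ∉ β.actR →
      x ∈ (β.node q₁ q₂).concl ∧ (Under χ x ∨ Under χᶜ x)) : p₂.concl ⊆ q₂.concl := by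
  intro x hx
  by_cases hxa : x ∈ β.actR
  · exact (Bi.ok_fits hq).actR hxa
  · obtain ⟨hx', hu | hu⟩ := h x hx hxa
    · exact absurd hu (not_under_of_allIn (Bi.ok_right hp).valid h2 hx le_rfl)
    · exact mem_right_of_under hq h1 hx' hu

variable (Γ m) in
/-- Proofs of weight less than `n` are determined by their linkings, up to commutations. -/
def Determined (n : ℕ) : Prop :=
  ∀ s t : Tree V ι, s.weight < n → s.OK Γ m → t.OK Γ m → s.concl = t.concl →
    s.linkings = t.linkings → Conv Γ m s t

/-- The choice at `b` does not influence the colour opposite to `b`, so the components `p2` and `q2`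
of that colour have the same conclusions and linkings. Their weight is smaller than that of the
whole, hence they are convertible by `Determined`, and the common component can be moved below the
`wth`. -/
theorem SplitAt.wth {β : Bi V ι} {χ : Set (Loc V ι)} {b : Loc V ι} {p q : Tree V ι}
    (h : (Tree.wth b p q).OK Γ m) (hb : Under χ b) (hs : Splits χ (Tree.wth b p q).linkings)
    (hc : ∀ x ∈ (Tree.wth b p q).concl, x ∉ β.out → Under χ x ∨ Under χᶜ x)
    (hd : Determined Γ m (Tree.wth b p q).weight) (hp : SplitAt Γ m β χ p)
    (hq : SplitAt Γ m β χ q) : SplitAt Γ m β χ (.wth b p q) := by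
  obtain ⟨p1, p2, cp, hp1, hp2⟩ := hp
  obtain ⟨q1, q2, cq, hq1, hq2⟩ := hq
  have hF := wth_fits h
  have okp := cp.ok (wth_ok_left h)
  have okq := cq.ok (wth_ok_right h)
  have ec : p2.concl = q2.concl := by
    apply Finset.Subset.antisymm
    · refine right_subset okp okq hp2 hq1 fun x hx hxa => ?_
      have hxb : x ≠ b.child .left := by
        rintro rfl
        exact not_under_of_allIn (Bi.ok_right okp).valid hp2 hx (b.le_child _) hb
      have hxp : x ∈ p.concl := by
        rw [cp.agree.concl]; simp [Bi.result, hx, hxa]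
      refine ⟨?_, hc x (by simp [Tree.concl, hxp, hxb])
        fun ho => Finset.disjoint_left.1 (Bi.ok_fits okp).outR ho hx⟩
      have : x ∈ p.concl \ {b.child .left} := by simp [hxp, hxb]
      rw [hF.eq] at this
      rw [← cq.agree.concl]
      exact (Finset.mem_sdiff.1 this).1
    · refine right_subset okq okp hq2 hp1 fun x hx hxa => ?_
      have hxb : x ≠ b.child .right := by
        rintro rfl
        exact not_under_of_allIn (Bi.ok_right okq).valid hq2 hx (b.le_child _) hb
      have hxq : x ∈ q.concl := by
        rw [cq.agree.concl]; simp [Bi.result, hx, hxa]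
      refine ⟨?_, hc x (by rw [Tree.concl, hF.eq]; simp [hxq, hxb])
        fun ho => Finset.disjoint_left.1 (Bi.ok_fits okq).outR ho hx⟩
      have : x ∈ q.concl \ {b.child .right} := by simp [hxq, hxb]
      rw [← hF.eq] at this
      rw [← cp.agree.concl]
      exact (Finset.mem_sdiff.1 this).1
  have el : p2.linkings = q2.linkings := by
    rw [linkings_eq_res_right (β := β) hp1 hp2, linkings_eq_res_right (β := β) hq1 hq2,
      ← cp.agree.linkings, ← cq.agree.linkings, wth_res_eq h hb hs]
  have c2 : Conv Γ m p2 q2 := by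
    refine hd p2 q2 ?_ (Bi.ok_right okp) (Bi.ok_right okq) ec el
    have := cp.agree.weight
    rw [Bi.weight_node] at this
    rw [Tree.weight]
    omega
  -- Now `q2` is replaced by `p2`, and `β` is flipped so that the shared component comes first, as
  -- `bi_wth` requires.
  have c3 : Conv Γ m (.wth b p q) (.wth b (β.flip.node p2 p1) (β.flip.node p2 q1)) :=
    .wth (cp.trans (.flip _ _ _)) (cq.trans ((Conv.flip _ _ _).trans (.bi c2.symm (.refl _))))
  have hl : b.child .left ∈ p1.concl := mem_left_of_under okp hp2
    (cp.agree.concl ▸ hF.left) (hb.mono (b.le_child _))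
  have hr : b.child .right ∈ q1.concl := mem_left_of_under okq hq2
    (cq.agree.concl ▸ hF.right) (hb.mono (b.le_child _))
  exact ⟨_, _, c3.trans ((bi_wth (c3.ok h) hl hr).trans (.flip' _ _ _)), hp1.wth hq1, hp2⟩

/-! ### Proofs in which every conclusion and every cut is coloured -/

variable (Γ m) in
/-- Up to commutations, the tree is split by `mix` along `χ`, or its leaves have one colour. -/
def SplitR (χ : Set (Loc V ι)) (t : Tree V ι) : Prop := LSplit Γ m χ t ∨ LSplit Γ m χᶜ t

theorem SplitR.of_compl {χ : Set (Loc V ι)} {t : Tree V ι} (h : SplitR Γ m χᶜ t) :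
    SplitR Γ m χ t := by
  rw [SplitR, compl_compl] at h; exact h.symm

theorem SplitR.compl {χ : Set (Loc V ι)} {t : Tree V ι} (h : SplitR Γ m χ t) :
    SplitR Γ m χᶜ t := by
  rw [SplitR, compl_compl]; exact h.symm

/-- A conclusion of colour `χ` excludes that all leaves lie outside `χ`, the only alternative that
is not already a splitting along `χ`. -/
theorem SplitR.left {χ : Set (Loc V ι)} {t : Tree V ι} (h : SplitR Γ m χ t) (ht : t.OK Γ m)
    {x : Loc V ι} (hx : x ∈ t.concl) (hu : Under χ x) : LSplit Γ m χ t := by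
  rcases h with h | h
  · exact h
  · rcases h.cases with h | h
    · exact absurd hu (not_under_of_allIn ht.valid h hx le_rfl)
    · rwa [compl_compl] at h

theorem SplitR.un {χ : Set (Loc V ι)} {u : Un V ι} {p : Tree V ι} (h : (u.node p).OK Γ m)
    (hu : Under χ u.out ∨ Under χᶜ u.out) (hp : SplitR Γ m χ p) : SplitR Γ m χ (u.node p) := by
  wlog hu' : Under χ u.out generalizing χ
  · exact (this (χ := χᶜ) (by rw [compl_compl]; exact hu.symm) hp.compl (by tauto)).of_compl
  rcases hp with hp | hp
  · exact .inl (hp.un h hu')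
  · rcases hp.cases with hp | hp
    · exact .inr (.inl hp.un)
    · rw [compl_compl] at hp
      exact .inl (hp.un h hu')

theorem Bi.nonempty_or (γ : Bi V ι) : γ = .mix ∨ γ.actL.Nonempty ∧ γ.actR.Nonempty := by
  cases γ <;> simp [Bi.actL, Bi.actR]

/-- The arguments of a tensor or cut impose their colour on both premises. A mix imposes nothing; a
mix of one-coloured premises of opposite colours is itself the required splitting. -/
theorem SplitR.bi {χ : Set (Loc V ι)} {γ : Bi V ι} {p q : Tree V ι} (h : (γ.node p q).OK Γ m)
    (hγ : γ.In χ ∨ γ.In χᶜ) (hp : SplitR Γ m χ p) (hq : SplitR Γ m χ q) :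
    SplitR Γ m χ (γ.node p q) := by
  rcases γ.nonempty_or with rfl | ⟨⟨x, hx⟩, ⟨y, hy⟩⟩
  · rcases hp with hp | hp <;> rcases hq with hq | hq
    · exact .inl (.bi h (.mix _) hp hq)
    · rcases hp.cases with hp | hp
      · rcases hq.cases with hq | hq
        · exact .inl (.inr ⟨p, q, .refl _, hp, hq⟩)
        · rw [compl_compl] at hq
          exact .inl (.bi h (.mix _) (.inl hp) hq)
      · exact .inr (.bi h (.mix _) hp hq)
    · rcases hq.cases with hq | hq
      · rcases hp.cases with hp | hp
        · exact .inl (.inr ⟨q, p, .mix_swap _ _, hq, hp⟩)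
        · rw [compl_compl] at hp
          exact .inl (.bi h (.mix _) hp (.inl hq))
      · exact .inr (.bi h (.mix _) hp hq)
    · exact .inr (.bi h (.mix _) hp hq)
  · wlog hγ' : γ.In χ generalizing χ
    · exact (this (χ := χᶜ) (by rw [compl_compl]; exact hγ.symm) hp.compl hq.compl
        (hγ.resolve_left hγ')).of_compl
    exact .inl (.bi h hγ'
      (hp.left (Bi.ok_left h) ((Bi.ok_fits h).actL hx) (hγ' x (.inl hx)))
      (hq.left (Bi.ok_right h) ((Bi.ok_fits h).actR hy) (hγ' y (.inr hy))))

/-- Outside `χ` the linkings of `p` restrict to the empty set, whereas those of `q` restrict to the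
linkings of `q₂`, which are nonempty. So one premise of a `wth` cannot be of one colour while the
other is a genuine mix. -/
theorem allIn_of_res_eq {χ : Set (Loc V ι)} {p q q₁ q₂ : Tree V ι} (hp : AllIn χ p)
    (h : res χᶜ '' p.linkings = res χᶜ '' q.linkings) (hc : Conv Γ m q (.mix q₁ q₂))
    (h1 : AllIn χ q₁) (h2 : AllIn χᶜ q₂) : False := by
  have e := linkings_eq_res_right (β := .mix) h1 h2
  rw [Bi.node, ← hc.agree.linkings, ← h] at e
  obtain ⟨lk, hlk⟩ := p.linkings_nonempty
  have he : (∅ : Linking V ι) ∈ q₂.linkings := by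
    rw [e]
    exact ⟨lk, hlk, res_eq_empty fun e he l hl => by rw [compl_compl]; exact hp lk hlk e he l hl⟩
  exact Set.not_nonempty_empty (Tree.linking_nonempty he)

/-- Both premises contain an argument of `b`, hence leaves of its colour. They are either both of
one colour or both proper mixes, and the latter case is `SplitAt.wth` for `β = mix`. -/
theorem SplitR.wth {χ : Set (Loc V ι)} {b : Loc V ι} {p q : Tree V ι}
    (h : (Tree.wth b p q).OK Γ m) (hs : Splits χ (Tree.wth b p q).linkings)
    (hc : ∀ x ∈ (Tree.wth b p q).concl, Under χ x ∨ Under χᶜ x)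
    (hd : Determined Γ m (Tree.wth b p q).weight) (hp : SplitR Γ m χ p)
    (hq : SplitR Γ m χ q) : SplitR Γ m χ (.wth b p q) := by
  have hb := hc b (by simp [Tree.concl])
  wlog hb' : Under χ b generalizing χ
  · exact (this (χ := χᶜ) hs.compl (fun x hx => by rw [compl_compl]; exact (hc x hx).symm)
      hp.compl hq.compl (by rw [compl_compl]; exact hb.symm) (by tauto)).of_compl
  have hp' := hp.left (wth_ok_left h) (wth_fits h).left (hb'.mono (b.le_child _))
  have hq' := hq.left (wth_ok_right h) (wth_fits h).right (hb'.mono (b.le_child _))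
  have hr := wth_res_eq h hb' hs
  rcases hp' with hp' | ⟨p1, p2, cp, hp1, hp2⟩ <;> rcases hq' with hq' | ⟨q1, q2, cq, hq1, hq2⟩
  · exact .inl (.inl (hp'.wth hq'))
  · exact (allIn_of_res_eq hp' hr cq hq1 hq2).elim
  · exact (allIn_of_res_eq hq' hr.symm cp hp1 hp2).elim
  · exact .inl (.inr (SplitAt.wth (β := .mix) h hb' hs (fun x hx _ => hc x hx) hd
      ⟨p1, p2, cp, hp1, hp2⟩ ⟨q1, q2, cq, hq1, hq2⟩))

theorem Determined.mono {n k : ℕ} (h : Determined (V := V) Γ m n) (hk : k ≤ n) :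
    Determined Γ m k := fun s t hs => h s t (hs.trans_le hk)

/-- A proof whose conclusions and cuts are coloured can be split by `mix` along the colouring. -/
theorem splitR {n : ℕ} (hd : Determined Γ m n) {χ : Set (Loc V ι)} {t : Tree V ι}
    (hn : t.weight ≤ n) (ht : t.OK Γ m) (hc : Col .mix χ t) (hs : Splits χ t.linkings) :
    SplitR Γ m χ t := by
  induction t using Tree.rec_rules with
  | ax a b =>
    rcases hs.mono _ rfl _ rfl with h | h
    · left; left; rintro _ rfl _ rfl; exact h
    · right; left; rintro _ rfl _ rfl; exact h
  | un u p ih =>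
    rw [Un.weight_node] at hn
    refine SplitR.un ht (hc.concl u.out (by simp [Un.result]) (by simp [Bi.out])) ?_
    exact ih (by omega) (Un.ok_premise ht) (hc.un (by simp [Bi.out])) (by simpa using hs)
  | bi γ p q ihp ihq =>
    rw [Bi.weight_node] at hn
    have hγ := hc.in_or (by simp [Bi.out]) (by simp [Bi.cuts])
    exact SplitR.bi ht hγ (ihp (by omega) (Bi.ok_left ht) (hc.bi_left hγ) (hs.bi_left ht))
      (ihq (by omega) (Bi.ok_right ht) (hc.bi_right hγ) (hs.bi_right ht))
  | wth b p q ihp ihq =>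
    have hb := hc.concl b (by simp [Tree.concl]) (by simp [Bi.out])
    have hn' := hn
    rw [Tree.weight] at hn'
    exact SplitR.wth ht hs (fun x hx => hc.concl x hx (by simp [Bi.out])) (hd.mono hn)
      (ihp (by omega) (wth_ok_left ht) (hc.wth_left (by simp [Bi.out])) (hs.wth_left ht hb))
      (ihq (by omega) (wth_ok_right ht) (hc.wth_right (wth_fits ht) (by simp [Bi.out]))
        (hs.wth_right ht hb))

/-! ### Bringing a tensor or a cut to the bottom -/

theorem Bi.typed_out {β : Bi V ι} (h : β.Typed Γ m) {x : Loc V ι} (hx : x ∈ β.out) :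
    ∃ A B, x.formula Γ = some (.tensor A B) := by
  cases β <;> simp [Bi.out] at hx
  all_goals subst hx; exact h

theorem Un.out_notMem {β : Bi V ι} (h : β.Typed Γ m) {u : Un V ι} (hu : u.Typed Γ) :
    u.out ∉ β.out := by
  intro hx
  obtain ⟨A, B, e⟩ := Bi.typed_out h hx
  cases u <;> obtain ⟨C, D, e'⟩ := hu <;> simp [Un.out] at e <;> simp [e] at e'

theorem wth_notMem_out {β : Bi V ι} (h : β.Typed Γ m) {a : Loc V ι}
    (ha : ∃ A B, a.formula Γ = some (.wth A B)) : a ∉ β.out := by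
  intro hx
  obtain ⟨A, B, e⟩ := Bi.typed_out h hx
  obtain ⟨C, D, e'⟩ := ha
  simp [e] at e'

theorem SplitAt.conv {β : Bi V ι} {χ : Set (Loc V ι)} {s t : Tree V ι}
    (h : SplitAt Γ m β χ t) (k : Conv Γ m s t) : SplitAt Γ m β χ s := by
  obtain ⟨p, q, h, h'⟩ := h
  exact ⟨p, q, k.trans h, h'⟩

/-- A tensor is identified by the vertex that it generates and a cut by its name and unordered
formula, each up to the order of the premises. -/
theorem Bi.eq_or_eq_flip {β γ : Bi V ι}
    (h : (∃ x ∈ γ.out, x ∈ β.out) ∨ ∃ k ∈ γ.cuts, k ∈ β.cuts) : γ = β ∨ γ = β.flip := by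
  rcases h with ⟨x, hx, hx'⟩ | ⟨k, hk, hk'⟩
  · cases β <;> cases γ <;> simp [Bi.out] at hx hx' <;> subst hx <;> subst hx' <;> simp [Bi.flip]
  · obtain ⟨A, rfl, hA⟩ := Bi.mem_cuts hk
    obtain ⟨B, rfl, hB⟩ := Bi.mem_cuts hk'
    rcases dual_pair (hA.symm.trans hB) with rfl | rfl <;> simp [Bi.flip]

/-- The proof can be split at `β` if `β` is its last rule. -/
theorem splitAt_base {n : ℕ} (hd : Determined Γ m n) {β : Bi V ι} {χ : Set (Loc V ι)}
    {p q : Tree V ι} (hn : (β.node p q).weight ≤ n) (ht : (β.node p q).OK Γ m)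
    (hβ : β ≠ .mix) (hc : Col β χ (β.node p q)) (hs : Splits χ (β.node p q).linkings) :
    SplitAt Γ m β χ (β.node p q) := by
  obtain ⟨⟨x, hx⟩, ⟨y, hy⟩⟩ := β.nonempty_or.resolve_left hβ
  rw [Bi.weight_node] at hn
  have hf := Conv.flip (Γ := Γ) (m := m) β p q
  have hc' := (hc.congr hf.agree.concl hf.agree.cuts).flip
  have h1 := (splitR hd (t := p) (by omega) (Bi.ok_left ht) (hc.base_left ht)
    (hs.bi_left ht)).left (Bi.ok_left ht) ((Bi.ok_fits ht).actL hx) (hc.left x hx)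
  have h2 := (splitR hd (t := q) (by omega) (Bi.ok_right ht) (hc'.base_left (hf.ok ht))
    (hs.compl.bi_right ht)).left (Bi.ok_right ht) ((Bi.ok_fits ht).actR hy) (hc.right y hy)
  exact .base ht hc.left hc.right h1 h2

/-- If `γ` has arguments, their colour decides how `q` is to be split; if it is a mix, either way of
splitting `q` will do. -/
theorem SplitAt.bi {β γ : Bi V ι} {χ : Set (Loc V ι)} {p q : Tree V ι}
    (h : (γ.node p q).OK Γ m) (hγ : γ.In χ ∨ γ.In χᶜ) (hp : SplitAt Γ m β χ p)
    (hq : SplitR Γ m χ q) : SplitAt Γ m β χ (γ.node p q) := by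
  have key : γ.In χ ∧ LSplit Γ m χ q ∨ γ.In χᶜ ∧ LSplit Γ m χᶜ q := by
    rcases γ.nonempty_or with rfl | ⟨-, ⟨y, hy⟩⟩
    · exact hq.imp (fun k => ⟨.mix _, k⟩) fun k => ⟨.mix _, k⟩
    · exact hγ.imp
        (fun k => ⟨k, hq.left (Bi.ok_right h) ((Bi.ok_fits h).actR hy) (k y (.inr hy))⟩)
        fun k => ⟨k, hq.compl.left (Bi.ok_right h) ((Bi.ok_fits h).actR hy) (k y (.inr hy))⟩
  rcases key with ⟨k, hq⟩ | ⟨k, hq⟩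
  · exact .bi_left h k hp hq
  · exact (SplitAt.bi_left h k hp.flip hq).of_flip

/-- A rule generates at most one occurrence or cut, which is therefore found in a single premise. -/
theorem Bi.present_or {β γ : Bi V ι} {p q : Tree V ι} (h : β.Present (γ.node p q))
    (ho : ∀ x ∈ γ.out, x ∉ β.out) (hc : ∀ k ∈ γ.cuts, k ∉ β.cuts) :
    β.Present p ∨ β.Present q := by
  obtain ⟨h1, h2⟩ := h
  have k1 : ∀ x ∈ β.out, x ∈ p.concl ∨ x ∈ q.concl := by
    intro x hx
    have := h1 hx
    have := ho x
    simp only [Bi.concl_node, Bi.result, Finset.mem_union, Finset.mem_sdiff] at *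
    tauto
  have k2 : ∀ k ∈ β.cuts, k ∈ p.cuts ∨ k ∈ q.cuts := by
    intro x hx
    have := h2 hx
    have := hc x
    simp only [Bi.cuts_node, Finset.mem_union] at *
    tauto
  cases β <;> simp [Bi.Present, Bi.out, Bi.cuts] at k1 k2 ⊢ <;> assumption

/-- A cut with arguments of both colours occurs in both premises of `wth`, or in neither. -/
theorem mem_cuts_of_res_subset {χ : Set (Loc V ι)} {p q : Tree V ι} {c : ℕ}
    {A : Formula V} (hp : p.Valid Γ m) (hq : q.Valid Γ m)
    (hsep : ∀ x ∈ q.concl, c ∉ x.root.names) (hm : Splits χ p.linkings)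
    (hu : Under χ (.ofCut c A)) (h : res χ '' p.linkings ⊆ res χ '' q.linkings)
    (hk : (c, s(A, A.dual)) ∈ p.cuts) : (c, s(A, A.dual)) ∈ q.cuts := by
  obtain ⟨lk, hlk, ht⟩ := touches_cut hp hk
  obtain ⟨lk', hlk', e'⟩ := h ⟨lk, hlk, rfl⟩
  obtain ⟨e, he, l, hl, hx⟩ := (e' ▸ ht.res hu (hm.mono lk hlk)).mono res_subset
  rcases mem_supp hq hlk' he hl with ⟨x, hx', hxl⟩ | ⟨k, hk', hkl⟩
  · refine absurd ?_ (hsep x hx')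
    rw [Loc.root_eq_of_le hxl, ← Loc.root_eq_of_le hx]
    simp [Root.names]
  · have : l.OnCut (c, s(A, A.dual)) := ⟨A, Loc.ofCut_le.1 hx, rfl⟩
    rwa [this.name_eq hkl]

theorem wth_sep {b : Loc V ι} {p q : Tree V ι} (h : (Tree.wth b p q).OK Γ m) {k : Cut V}
    (hk : k ∈ (Tree.wth b p q).cuts) :
    (∀ x ∈ p.concl, k.1 ∉ x.root.names) ∧ ∀ x ∈ q.concl, k.1 ∉ x.root.names := by
  have hF := wth_fits h
  constructor
  · intro x hx
    by_cases hxa : x = b.child .left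
    · subst hxa; exact h.good.sep b (by simp [Tree.concl]) k hk
    · exact h.good.sep x (by simp [Tree.concl, hx, hxa]) k hk
  · intro x hx
    by_cases hxa : x = b.child .right
    · subst hxa; exact h.good.sep b (by simp [Tree.concl]) k hk
    · exact h.good.sep x (by rw [Tree.concl, hF.eq]; simp [hx, hxa]) k hk

/-- A tensor formula lies in the common context. A cut could a priori occur in one branch only, as
the rule keeps `Ω₁` and `Ω₂` apart; but its argument of the colour opposite to `b` is reached by
some linking, and the restrictions to that colour are the same in both branches. -/
theorem Bi.present_wth {β : Bi V ι} {χ : Set (Loc V ι)} {b : Loc V ι} {p q : Tree V ι}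
    (h : (Tree.wth b p q).OK Γ m) (hP : β.Present (.wth b p q)) (hc : Col β χ (.wth b p q))
    (hb : b ∉ β.out) (hs : Splits χ (Tree.wth b p q).linkings) :
    β.Present p ∧ β.Present q := by
  have hF := wth_fits h
  have hb' := hc.concl b (by simp [Tree.concl]) hb
  have k1 : ∀ x ∈ β.out, x ∈ p.concl ∧ x ∈ q.concl := by
    intro x hx
    have h1 := hP.1 hx
    rw [Tree.concl, Finset.mem_insert] at h1
    rcases h1 with rfl | h1
    · exact absurd hx hb
    · have h2 := h1
      rw [hF.eq] at h2
      exact ⟨(Finset.mem_sdiff.1 h1).1, (Finset.mem_sdiff.1 h2).1⟩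
  have k2 : ∀ k ∈ β.cuts, k ∈ p.cuts ∧ k ∈ q.cuts := by
    intro k hk
    have hk' := hP.2 hk
    obtain ⟨A, rfl, hA⟩ := Bi.mem_cuts hk
    obtain ⟨c, e⟩ := k
    dsimp only at hA; subst hA
    have hL := hc.left (.ofCut c A) (by simp [Bi.actL])
    have hR := hc.right (.ofCut c A.dual) (by simp [Bi.actR])
    have hsep := wth_sep h hk'
    have hsp := hs.wth_left h hb'
    have hsq := hs.wth_right h hb'
    have e : (c, s(A, A.dual)) = (c, s(A.dual, A.dual.dual)) := by simp [Sym2.eq_swap]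
    rw [Tree.cuts, Finset.mem_union] at hk'
    have both : (c, s(A, A.dual)) ∈ p.cuts ↔ (c, s(A, A.dual)) ∈ q.cuts := by
      rcases hb' with hb' | hb'
      · have hr := wth_res_eq h hb' hs
        -- The cut is presented through its other argument, the one coloured `χᶜ`, opposite to `b`.
        rw [e]
        exact ⟨mem_cuts_of_res_subset (wth_ok_left h).valid (wth_ok_right h).valid
          hsep.2 hsp.compl hR hr.subset,
          mem_cuts_of_res_subset (wth_ok_right h).valid (wth_ok_left h).valid
          hsep.1 hsq.compl hR hr.superset⟩
      · have hr := wth_res_eq h hb' hs.compl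
        rw [compl_compl] at hr
        exact ⟨mem_cuts_of_res_subset (wth_ok_left h).valid (wth_ok_right h).valid
          hsep.2 hsp hL hr.subset,
          mem_cuts_of_res_subset (wth_ok_right h).valid (wth_ok_left h).valid
          hsep.1 hsq hL hr.superset⟩
    tauto
  exact ⟨⟨fun x hx => (k1 x hx).1, fun k hk => (k2 k hk).1⟩,
    ⟨fun x hx => (k1 x hx).2, fun k hk => (k2 k hk).2⟩⟩

/-- A proof with a `tensor` or a cut whose arguments can be separated by a colouring can be
transformed into one with this `tensor` or cut as last rule. -/
theorem splitAt {n : ℕ} (hd : Determined Γ m n) {β : Bi V ι} (hβ : β ≠ .mix)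
    (hT : β.Typed Γ m) {χ : Set (Loc V ι)} {t : Tree V ι}
    (hn : t.weight ≤ n) (ht : t.OK Γ m) (hP : β.Present t) (hc : Col β χ t)
    (hs : Splits χ t.linkings) : SplitAt Γ m β χ t := by
  induction t using Tree.rec_rules with
  | ax a b =>
    exfalso
    obtain ⟨P, ha, hb⟩ := ht.valid
    have hk := hP.2
    have ho := hP.1
    have key : ∀ x ∈ β.out, False := by
      intro x hx
      obtain ⟨A, B, e⟩ := Bi.typed_out hT hx
      have := ho hx
      simp only [Tree.concl, Finset.mem_insert, Finset.mem_singleton] at this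
      rcases this with rfl | rfl
      · simp [e] at ha
      · simp [e] at hb
    cases β with
    | tensor a => exact key a (by simp [Bi.out])
    | tensor' a => exact key a (by simp [Bi.out])
    | mix => exact hβ rfl
    | cut c A => simp [Bi.cuts, Tree.cuts] at hk
  | un u p ih =>
    rw [Un.weight_node] at hn
    have hu := Un.out_notMem hT (Un.ok_fits ht).1
    refine SplitAt.un ht (hc.concl u.out (by simp [Un.result]) hu)
      (ih (by omega) (Un.ok_premise ht) ⟨fun x hx => ?_, by simpa using hP.2⟩ (hc.un hu)
        (by simpa using hs))
    have h1 := hP.1 hx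
    rw [Un.concl_node, Un.result, Finset.mem_insert, Finset.mem_sdiff] at h1
    rcases h1 with rfl | h1
    · exact absurd hx hu
    · exact h1.1
  | bi γ p q ihp ihq =>
    have hf := Conv.flip (Γ := Γ) (m := m) γ p q
    -- Either this instance generates the output of `β`, and then it is `β` up to the order of
    -- premises, or its arguments have a single colour and it can stay above `β`.
    by_cases hm : (∃ x ∈ γ.out, x ∈ β.out) ∨ ∃ k ∈ γ.cuts, k ∈ β.cuts
    · rcases Bi.eq_or_eq_flip hm with rfl | rfl
      · exact splitAt_base hd hn ht hβ hc hs
      · rw [Bi.flip_flip] at hf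
        exact (splitAt_base hd (by rwa [← hf.agree.weight]) (hf.ok ht) hβ
          (hc.congr hf.agree.concl hf.agree.cuts) (hf.agree.linkings ▸ hs)).conv hf
    · push Not at hm
      have hγ := hc.in_or hm.1 hm.2
      rw [Bi.weight_node] at hn
      rcases Bi.present_or hP hm.1 hm.2 with hp | hq
      · exact SplitAt.bi ht hγ
          (ihp (by omega) (Bi.ok_left ht) hp (hc.bi_left hγ) (hs.bi_left ht))
          (splitR hd (by omega) (Bi.ok_right ht) (hc.mix_of_present ht hγ hp) (hs.bi_right ht))
      · have hγ' : γ.flip.In χ ∨ γ.flip.In χᶜ := hγ.imp Bi.In.flip Bi.In.flip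
        have hc' := hc.congr hf.agree.concl hf.agree.cuts
        exact (SplitAt.bi (hf.ok ht) hγ'
          (ihq (by omega) (Bi.ok_right ht) hq (hc.bi_right hγ) (hs.bi_right ht))
          (splitR hd (by omega) (Bi.ok_left ht) (hc'.mix_of_present (hf.ok ht) hγ' hq)
            (hs.bi_left ht))).conv hf
  | wth b p q ihp ihq =>
    have hbo := wth_notMem_out hT (wth_fits ht).typed
    have hb := hc.concl b (by simp [Tree.concl]) hbo
    have hn' := hn
    rw [Tree.weight] at hn'
    obtain ⟨hPp, hPq⟩ := Bi.present_wth ht hP hc hbo hs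
    have h1 := ihp (by omega) (wth_ok_left ht) hPp (hc.wth_left hbo) (hs.wth_left ht hb)
    have h2 := ihq (by omega) (wth_ok_right ht) hPq (hc.wth_right (wth_fits ht) hbo)
      (hs.wth_right ht hb)
    rcases hb with hb | hb
    · exact .wth ht hb hs hc.concl (hd.mono hn) h1 h2
    · refine (SplitAt.wth ht hb hs.compl (fun x hx hxo => ?_) (hd.mono hn) h1.flip
        h2.flip).of_flip
      rw [compl_compl]
      exact (hc.concl x hx (by simpa using hxo)).symm

/-! ### Invertible rules -/

/-- The formula at the generated vertex determines the connective, so only the side chosen by a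
`plus` is left open. -/
theorem Un.eq_of_out {u w : Un V ι} (hu : u.Typed Γ) (hw : w.Typed Γ) (h : u.out = w.out) :
    u = w ∨ ∃ d e, u = .plus d u.out ∧ w = .plus e u.out := by
  cases u <;> cases w <;> simp only [Un.out] at h <;> subst h
  · exact .inl rfl
  · obtain ⟨A, B, e⟩ := hu; obtain ⟨C, D, e'⟩ := hw; simp [e] at e'
  · obtain ⟨A, B, e⟩ := hu; obtain ⟨C, D, e'⟩ := hw; simp [e] at e'
  · exact .inr ⟨_, _, rfl, rfl⟩

/-- A rule with one premise can be made the last rule if the linkings admit it. -/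
theorem un_invert {u : Un V ι} (hu : u.Typed Γ) {t : Tree V ι} (ht : t.OK Γ m)
    (ho : u.out ∈ t.concl)
    (hl : ∀ lk ∈ t.linkings, ∀ d, Touches lk (u.out.child d) → u.out.child d ∈ u.act) :
    ∃ p, Conv Γ m t (u.node p) := by
  induction t using Tree.rec_rules with
  | ax a b =>
    exfalso
    obtain ⟨P, ha, hb⟩ := ht.valid
    simp only [Tree.concl, Finset.mem_insert, Finset.mem_singleton] at ho
    rcases ho with rfl | rfl <;> cases u <;> obtain ⟨A, B, e⟩ := hu <;>
      simp_all [Un.out]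
  | un w p ih =>
    have hF := Un.ok_fits ht
    by_cases h : u.out = w.out
    · rcases Un.eq_of_out hu hF.1 h with rfl | ⟨d, e, h1, h2⟩
      · exact ⟨p, .refl _⟩
      · rw [h1] at hl ⊢
        rw [h2] at hl hF ht ⊢
        -- Every linking reaches the argument that this `plus` selects, so the hypothesis on the
        -- linkings forces the two sides to agree.
        obtain ⟨lk, hlk⟩ := p.linkings_nonempty
        have hm := hl lk hlk e (touches_concl (Un.ok_premise ht).valid hlk
          (hF.2.1 (by simp [Un.act, Un.out])))
        simp only [Un.act, Un.out, Finset.mem_singleton] at hm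
        have : e = d := (Loc.child_inj hm).2
        subst this
        exact ⟨p, .refl _⟩
    · rw [Un.concl_node, Un.result, Finset.mem_insert, Finset.mem_sdiff] at ho
      have ho' := ho.resolve_left h
      obtain ⟨p', hp⟩ := ih (Un.ok_premise ht) ho'.1 (by simpa using hl)
      have c1 : Conv Γ m (w.node p) (w.node (u.node p')) := .un hp
      exact ⟨_, c1.trans (un_un (c1.ok ht) ho'.2)⟩
  | bi γ p q ihp ihq =>
    have hF := Bi.ok_fits ht
    obtain ⟨k, hk⟩ := p.linkings_nonempty
    obtain ⟨k', hk'⟩ := q.linkings_nonempty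
    have ho' := ho
    rw [Bi.concl_node, Bi.result, Finset.mem_union, Finset.mem_union, Finset.mem_sdiff,
      Finset.mem_sdiff] at ho'
    rw [Bi.linkings_node] at hl
    rcases ho'.resolve_left (Un.out_notMem hF.typed hu) with h | h
    · obtain ⟨p', hp⟩ := ihp (Bi.ok_left ht) h.1
        fun lk hlk d hd => hl _ ⟨lk, hlk, k', hk', rfl⟩ d (hd.mono Set.subset_union_left)
      have c1 : Conv Γ m (γ.node p q) (γ.flip.node q (u.node p')) :=
        (Conv.flip _ _ _).trans (.bi (.refl _) hp)
      exact ⟨_, c1.trans (un_bi (c1.ok ht) (by simpa using h.2))⟩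
    · obtain ⟨q', hq⟩ := ihq (Bi.ok_right ht) h.1
        fun lk hlk d hd => hl _ ⟨k, hk, lk, hlk, rfl⟩ d (hd.mono Set.subset_union_right)
      have c1 : Conv Γ m (γ.node p q) (γ.node p (u.node q')) := .bi (.refl _) hq
      exact ⟨_, c1.trans (un_bi (c1.ok ht) h.2)⟩
  | wth b p q ihp ihq =>
    have hF := wth_fits ht
    have hub : u.out ≠ b := by
      intro h
      obtain ⟨A, B, e⟩ := hF.typed
      cases u <;> obtain ⟨C, D, e'⟩ := hu <;> simp only [Un.out] at h <;> subst h <;>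
        simp [e] at e'
    rw [Tree.concl, Finset.mem_insert] at ho
    have h1 := ho.resolve_left hub
    have h2 := h1
    rw [hF.eq] at h2
    rw [Finset.mem_sdiff, Finset.mem_singleton] at h1 h2
    obtain ⟨p', hp⟩ := ihp (wth_ok_left ht) h1.1 fun lk hlk => hl lk (Or.inl hlk)
    obtain ⟨q', hq⟩ := ihq (wth_ok_right ht) h2.1 fun lk hlk => hl lk (Or.inr hlk)
    have c1 : Conv Γ m (.wth b p q) (.wth b (u.node p') (u.node q')) := .wth hp hq
    exact ⟨_, c1.trans (wth_un (c1.ok ht) h1.2 h2.2)⟩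

/-- The rule for `wth` can be made the last rule. -/
theorem wth_invert {a : Loc V ι} (ha : ∃ A B, a.formula Γ = some (.wth A B)) {t : Tree V ι}
    (ht : t.OK Γ m) (ho : a ∈ t.concl) : ∃ p q, Conv Γ m t (.wth a p q) := by
  induction t using Tree.rec_rules with
  | ax b c =>
    exfalso
    obtain ⟨P, hb, hc⟩ := ht.valid
    obtain ⟨A, B, e⟩ := ha
    simp only [Tree.concl, Finset.mem_insert, Finset.mem_singleton] at ho
    rcases ho with rfl | rfl <;> simp_all
  | un w p ih =>
    have hF := Un.ok_fits ht
    have hwa : a ≠ w.out := by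
      intro h
      obtain ⟨A, B, e⟩ := ha
      cases w <;> obtain ⟨C, D, e'⟩ := hF.1 <;> simp only [Un.out] at h <;> subst h <;>
        simp [e] at e'
    rw [Un.concl_node, Un.result, Finset.mem_insert, Finset.mem_sdiff] at ho
    have ho' := ho.resolve_left hwa
    obtain ⟨p', q', hp⟩ := ih (Un.ok_premise ht) ho'.1
    have c1 : Conv Γ m (w.node p) (w.node (.wth a p' q')) := .un hp
    exact ⟨_, _, c1.trans (un_wth (c1.ok ht) ho'.2)⟩
  | bi γ p q ihp ihq =>
    have hF := Bi.ok_fits ht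
    rw [Bi.concl_node, Bi.result, Finset.mem_union, Finset.mem_union, Finset.mem_sdiff,
      Finset.mem_sdiff] at ho
    rcases ho.resolve_left (wth_notMem_out hF.typed ha) with h | h
    · obtain ⟨p', q', hp⟩ := ihp (Bi.ok_left ht) h.1
      have c1 : Conv Γ m (γ.node p q) (γ.flip.node q (.wth a p' q')) :=
        (Conv.flip _ _ _).trans (.bi (.refl _) hp)
      exact ⟨_, _, c1.trans (wth_bi (c1.ok ht) (by simpa using h.2))⟩
    · obtain ⟨p', q', hq⟩ := ihq (Bi.ok_right ht) h.1
      have c1 : Conv Γ m (γ.node p q) (γ.node p (.wth a p' q')) := .bi (.refl _) hq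
      exact ⟨_, _, c1.trans (wth_bi (c1.ok ht) h.2)⟩
  | wth b p q ihp ihq =>
    have hF := wth_fits ht
    by_cases hab : a = b
    · subst hab; exact ⟨p, q, .refl _⟩
    · rw [Tree.concl, Finset.mem_insert] at ho
      have h1 := ho.resolve_left hab
      have h2 := h1
      rw [hF.eq] at h2
      rw [Finset.mem_sdiff, Finset.mem_singleton] at h1 h2
      obtain ⟨p1, p2, hp⟩ := ihp (wth_ok_left ht) h1.1
      obtain ⟨q1, q2, hq⟩ := ihq (wth_ok_right ht) h2.1
      have c1 : Conv Γ m (.wth b p q) (.wth b (.wth a p1 p2) (.wth a q1 q2)) := .wth hp hq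
      exact ⟨_, _, c1.trans (wth_wth (c1.ok ht) h1.2 h2.2)⟩

/-! ### Proofs with the same linkings -/

/-- A leaf below an argument that was not consumed would have to lie under another conclusion or on
a cut; the antichain condition forbids the first and the separation of names the second. This
supplies the hypothesis on linkings in `un_invert`. -/
theorem un_touches {u : Un V ι} {p : Tree V ι} (h : (u.node p).OK Γ m) {lk : Linking V ι}
    (hlk : lk ∈ p.linkings) {d : Side} (ht : Touches lk (u.out.child d)) :
    u.out.child d ∈ u.act := by
  obtain ⟨e, he, l, hl, hx⟩ := ht
  have hF := Un.ok_fits h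
  rcases mem_supp (Un.ok_premise h).valid hlk he hl with ⟨x, hx', hxl⟩ | ⟨k, hk, hkl⟩
  · by_cases hxa : x ∈ u.act
    · obtain ⟨s, rfl⟩ := Un.child_of_mem_act hxa
      rwa [← Loc.side_eq_of_child_le hxl hx]
    · have h1 : x ∈ (u.node p).concl := by simp [Un.result, hx', hxa]
      have h2 : u.out ∈ (u.node p).concl := by simp [Un.result]
      have : x = u.out := by
        rcases Loc.le_total_of_le hxl ((u.out.le_child d).trans hx) with g | g
        · exact h.good.anti _ h1 _ h2 g
        · exact (h.good.anti _ h2 _ h1 g).symm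
      exact absurd (this ▸ hx') hF.2.2
  · refine absurd ?_ (h.good.sep u.out (by simp [Un.result]) k (by simpa using hk))
    rw [Loc.root_eq_of_le ((u.out.le_child d).trans hx)]
    exact hkl.name_mem

theorem Un.concl_eq {u : Un V ι} {p q : Tree V ι} (hp : (u.node p).OK Γ m)
    (hq : (u.node q).OK Γ m) (h : (u.node p).concl = (u.node q).concl) : p.concl = q.concl := by
  obtain ⟨-, a, o⟩ := Un.ok_fits hp
  obtain ⟨-, a', o'⟩ := Un.ok_fits hq
  rw [Un.concl_node, Un.concl_node] at h
  ext x
  have hx := iff_of_eq (congrArg (x ∈ ·) h)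
  simp only [Un.result, Finset.mem_insert, Finset.mem_sdiff] at hx
  have := @a x; have := @a' x
  by_cases hxo : x = u.out
  · subst hxo; tauto
  · tauto

theorem wth_concl_eq {a : Loc V ι} {p q p' q' : Tree V ι}
    (h : WthFits Γ a p.concl q.concl) (h' : WthFits Γ a p'.concl q'.concl)
    (e : (Tree.wth a p q).concl = (Tree.wth a p' q').concl) :
    p.concl = p'.concl ∧ q.concl = q'.concl := by
  have key : p.concl \ {a.child .left} = p'.concl \ {a.child .left} := by
    have h1 := h.notMem_left
    have h2 := h'.notMem_left
    ext x
    have hx := iff_of_eq (congrArg (x ∈ ·) e)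
    simp only [Tree.concl, Finset.mem_insert, Finset.mem_sdiff, Finset.mem_singleton] at hx ⊢
    by_cases hxa : x = a
    · subst hxa; tauto
    · tauto
  have fin : ∀ (S T : Finset (Loc V ι)) (x : Loc V ι), x ∈ S → x ∈ T → S \ {x} = T \ {x} →
      S = T := by
    intro S T x hS hT hST
    ext y
    have hy := iff_of_eq (congrArg (y ∈ ·) hST)
    simp only [Finset.mem_sdiff, Finset.mem_singleton] at hy
    by_cases hyx : y = x
    · subst hyx; tauto
    · tauto
  refine ⟨fin _ _ _ h.left h'.left key, fin _ _ _ h.right h'.right ?_⟩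
  rw [← h.eq, ← h'.eq, key]

/-- The colour is the support of the first premise. The linkings of a joining rule are all unions of
linkings of the premises, so any two of them can be recombined along the colours. -/
theorem supp_splits {β : Bi V ι} {p q : Tree V ι} (h : (β.node p q).OK Γ m) :
    AllIn p.supp p ∧ AllIn p.suppᶜ q ∧ Col β p.supp (β.node p q) ∧
      Splits p.supp (β.node p q).linkings := by
  have k := Bi.premises h
  have hF := Bi.ok_fits h
  have hp : AllIn p.supp p := fun lk hlk e he l hl => mem_supp (Bi.ok_left h).valid hlk he hl
  have hq : AllIn p.suppᶜ q := fun lk hlk e he l hl hl' =>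
    k.supp_disjoint hl' (mem_supp (Bi.ok_right h).valid hlk he hl)
  have up : ∀ x ∈ p.concl, Under p.supp x := fun x hx l hl => .inl ⟨x, hx, hl⟩
  have uq : ∀ x ∈ q.concl, Under p.suppᶜ x := fun x hx l hl hl' =>
    k.supp_disjoint hl' (.inl ⟨x, hx, hl⟩)
  refine ⟨hp, hq, ⟨?_, ?_, fun x hx => up x (hF.actL hx), fun x hx => uq x (hF.actR hx)⟩, ?_, ?_⟩
  · intro x hx hxo
    rw [Bi.concl_node, Bi.result, Finset.mem_union, Finset.mem_union, Finset.mem_sdiff,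
      Finset.mem_sdiff] at hx
    rcases hx.resolve_left hxo with hx | hx
    · exact .inl (up x hx.1)
    · exact .inr (uq x hx.1)
  · intro c hc hcb
    rw [Bi.cuts_node, Finset.mem_union, Finset.mem_union] at hc
    rcases hc.resolve_left hcb with hc | hc
    · exact .inl fun l hl => .inr ⟨c, hc, hl⟩
    · exact .inr fun l hl hl' => k.supp_disjoint hl' (.inr ⟨c, hc, hl⟩)
  · rw [Bi.linkings_node]
    rintro _ ⟨l1, h1, l2, h2, rfl⟩ e (he | he)
    · exact .inl (hp l1 h1 e he)
    · exact .inr (hq l2 h2 e he)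
  · rw [Bi.linkings_node]
    rintro _ ⟨l1, h1, l2, h2, rfl⟩ _ ⟨l3, h3, l4, h4, rfl⟩
    refine ⟨l1, h1, l4, h4, ?_⟩
    simp only [res_union]
    rw [res_eq_self (hp l1 h1), res_eq_empty (hq l2 h2), res_eq_self (hq l4 h4),
      res_eq_empty (χ := p.suppᶜ) (hp.compl l3 h3), Set.union_empty, Set.empty_union]

/-- A mix leaves no trace in the sequent, so it is treated apart: `splitR` provides a mix, since
both premises of the given one have links and a proof of a single colour is thereby excluded. -/
theorem splitAt_bi {n : ℕ} (hd : Determined Γ m n) {β : Bi V ι} {t p q : Tree V ι}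
    (hn : t.weight ≤ n) (ht : t.OK Γ m) (hpq : (β.node p q).OK Γ m)
    (hc : t.concl = (β.node p q).concl) (hl : t.linkings = (β.node p q).linkings) :
    SplitAt Γ m β p.supp t := by
  obtain ⟨hp, hq, hcol, hs⟩ := supp_splits hpq
  have hk := cuts_eq ht hpq hc hl
  have hcol' := hcol.congr hc.symm hk.symm
  rw [← hl] at hs
  by_cases hβ : β = .mix
  · subst hβ
    obtain ⟨l1, h1⟩ := p.linkings_nonempty
    obtain ⟨l2, h2⟩ := q.linkings_nonempty
    have hmem : l1 ∪ l2 ∈ t.linkings := by rw [hl]; exact ⟨l1, h1, l2, h2, rfl⟩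
    have n1 : ¬ AllIn p.supp t := by
      intro h
      obtain ⟨e, he⟩ := Tree.linking_nonempty h2
      obtain ⟨l, hle⟩ := sym2_nonempty e
      exact hq l2 h2 e he l hle (h _ hmem e (Or.inr he) l hle)
    have n2 : ¬ AllIn p.suppᶜ t := by
      intro h
      obtain ⟨e, he⟩ := Tree.linking_nonempty h1
      obtain ⟨l, hle⟩ := sym2_nonempty e
      exact h _ hmem e (Or.inl he) l hle (hp l1 h1 e he l hle)
    rcases splitR hd hn ht hcol' hs with h | h
    · exact h.resolve_left n1
    · exact SplitAt.of_flip (β := .mix) (h.resolve_left n2)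
  · exact splitAt hd hβ (Bi.ok_fits hpq).typed hn ht
      ⟨by rw [hc, Bi.concl_node]; exact Finset.subset_union_left,
        by rw [hk, Bi.cuts_node]; exact Finset.subset_union_left⟩ hcol' hs

/-- Literals as only conclusions rule out `par`, `plus` and `wth` as last rules. A joining rule
would need two disjoint nonempty sets of links, but there is a single link. -/
theorem eq_ax {t : Tree V ι} {a b : Loc V ι} (ht : t.OK Γ m) (ha : (Tree.ax a b).OK Γ m)
    (hc : t.concl = (Tree.ax a b).concl) (hl : t.linkings = (Tree.ax a b).linkings) :
    t = .ax a b := by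
  obtain ⟨P, h1, h2⟩ := ha.valid
  have hlit : ∀ x ∈ t.concl, x.formula Γ = some (.pos P) ∨ x.formula Γ = some (.neg P) := by
    intro x hx
    rw [hc] at hx
    simp only [Tree.concl, Finset.mem_insert, Finset.mem_singleton] at hx
    rcases hx with rfl | rfl
    · exact .inl h1
    · exact .inr h2
  cases t using Tree.rec_rules with
  | ax a' b' =>
    obtain ⟨Q, h3, h4⟩ := ht.valid
    have : s(a', b') = s(a, b) := by simpa [Tree.linkings] using hl
    rcases Sym2.eq_iff.1 this with ⟨rfl, rfl⟩ | ⟨rfl, rfl⟩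
    · rfl
    · simp [h2] at h3
  | un u p =>
    have := hlit u.out (by simp [Un.result])
    have ht := (Un.ok_fits ht).1
    cases u <;> obtain ⟨A, B, e⟩ := ht <;> simp only [Un.out] at this <;> simp [e] at this
  | bi γ p q =>
    exfalso
    rw [Bi.linkings_node] at hl
    obtain ⟨l1, m1⟩ := p.linkings_nonempty
    obtain ⟨l2, m2⟩ := q.linkings_nonempty
    have hu : l1 ∪ l2 = {s(a, b)} := by
      have : l1 ∪ l2 ∈ (Tree.ax a b).linkings := hl ▸ ⟨l1, m1, l2, m2, rfl⟩
      exact this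
    obtain ⟨e1, g1⟩ := Tree.linking_nonempty m1
    obtain ⟨e2, g2⟩ := Tree.linking_nonempty m2
    have k1 : e1 = s(a, b) := by have : e1 ∈ l1 ∪ l2 := Or.inl g1; rwa [hu] at this
    have k2 : e2 = s(a, b) := by have : e2 ∈ l1 ∪ l2 := Or.inr g2; rwa [hu] at this
    exact bi_links_disjoint ht m1 m2 g1 (k1.trans k2.symm ▸ g2)
  | wth c p q =>
    have := hlit c (by simp [Tree.concl])
    obtain ⟨A, B, e⟩ := (wth_fits ht).typed
    simp [e] at this

/-- Proofs with retained cuts that have the same linkings are convertible into each other. -/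
theorem determined (n : ℕ) : Determined (V := V) Γ m n := by
  induction n with
  | zero => exact fun s t hs => absurd hs (Nat.not_lt_zero _)
  | succ n ih =>
    intro s t hn hs ht hc hl
    -- The last rule of `t` decides which rule is brought to the bottom of `s`.
    cases t using Tree.rec_rules with
    | ax a b => rw [eq_ax hs ht hc hl]; exact .refl _
    | un u p =>
      rw [Un.linkings_node] at hl
      obtain ⟨s', hs'⟩ := un_invert (Un.ok_fits ht).1 hs (by rw [hc]; simp [Un.result])
        fun lk hlk d hd => un_touches ht (hl ▸ hlk) hd
      have ok := hs'.ok hs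
      have hw := hs'.agree.weight
      rw [Un.weight_node] at hw
      refine hs'.trans (.un (ih s' p (by omega) (Un.ok_premise ok) (Un.ok_premise ht) ?_ ?_))
      · exact Un.concl_eq ok ht (hs'.agree.concl.symm.trans hc)
      · rw [← hl, hs'.agree.linkings, Un.linkings_node]
    | bi β p q =>
      obtain ⟨p', q', hs', hp', hq'⟩ := splitAt_bi ih (by omega) hs ht hc hl
      obtain ⟨hp, hq, hcol, -⟩ := supp_splits ht
      have ok := hs'.ok hs
      have hw := hs'.agree.weight
      rw [Bi.weight_node] at hw
      have hl' := hs'.agree.linkings.symm.trans hl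
      have hc' := hs'.agree.concl.symm.trans hc
      have hlp : p'.linkings = p.linkings := by
        rw [linkings_eq_res_left (β := β) hp' hq', linkings_eq_res_left (β := β) hp hq, hl']
      have hlq : q'.linkings = q.linkings := by
        rw [linkings_eq_res_right (β := β) hp' hq', linkings_eq_res_right (β := β) hp hq, hl']
      -- Both proofs end with `β` and separate the same colours, so the context is divided between
      -- the premises in the same way. The general form also applies to `β.flip`, for the first
      -- premise.
      have side : ∀ (β : Bi V ι) (χ : Set (Loc V ι)) (p q p' q' : Tree V ι),
          (β.node p q).OK Γ m → (β.node p' q').OK Γ m →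
          (β.node p q).concl = (β.node p' q').concl → Col β χ (β.node p q) →
          AllIn χ p → AllIn χᶜ q → AllIn χ p' → AllIn χᶜ q' → q.concl = q'.concl := by
        intro β χ p q p' q' ok ok' hc hcol hp hq hp' hq'
        apply Finset.Subset.antisymm
        · refine right_subset ok ok' hq hp' fun x hx hxa => ?_
          have : x ∈ (β.node p q).concl := by simp [Bi.result, hx, hxa]
          exact ⟨hc ▸ this, hcol.concl x this fun ho =>
            Finset.disjoint_left.1 (Bi.ok_fits ok).outR ho hx⟩
        · refine right_subset ok' ok hq' hp fun x hx hxa => ?_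
          have : x ∈ (β.node p q).concl := by rw [hc]; simp [Bi.result, hx, hxa]
          exact ⟨this, hcol.concl x this fun ho =>
            Finset.disjoint_left.1 (Bi.ok_fits ok').outR ho hx⟩
      have hcq : q.concl = q'.concl := side β _ p q p' q' ht ok hc'.symm hcol hp hq hp' hq'
      have f1 := Conv.flip (Γ := Γ) (m := m) β p q
      have f2 := Conv.flip (Γ := Γ) (m := m) β p' q'
      have hcp : p.concl = p'.concl := side β.flip _ q p q' p' (f1.ok ht) (f2.ok ok)
        (f1.agree.concl.symm.trans (hc'.symm.trans f2.agree.concl))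
        (hcol.congr f1.agree.concl f1.agree.cuts).flip hq hp.compl hq' hp'.compl
      exact hs'.trans (.bi
        (ih p' p (by omega) (Bi.ok_left ok) (Bi.ok_left ht) hcp.symm hlp)
        (ih q' q (by omega) (Bi.ok_right ok) (Bi.ok_right ht) hcq.symm hlq))
    | wth a p q =>
      obtain ⟨p', q', hs'⟩ := wth_invert (wth_fits ht).typed hs
        (by rw [hc]; simp [Tree.concl])
      have ok := hs'.ok hs
      have hw := hs'.agree.weight
      rw [Tree.weight] at hw
      have hl' := hs'.agree.linkings.symm.trans hl
      obtain ⟨hcp, hcq⟩ := wth_concl_eq (wth_fits ok) (wth_fits ht)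
        (hs'.agree.concl.symm.trans hc)
      refine hs'.trans (.wth (ih p' p (by omega) (wth_ok_left ok) (wth_ok_left ht) hcp ?_)
        (ih q' q (by omega) (wth_ok_right ok) (wth_ok_right ht) hcq ?_))
      · rw [wth_linkings_left ok, wth_linkings_left ht, hl']
      · rw [wth_linkings_right ok, wth_linkings_right ht, hl']

/-! ### Proofs in the sense of the definitions -/

theorem Loc.formula_child {a : Loc V ι} {F A B : Formula V} (d : Side)
    (h : a.formula Γ = some F)
    (hF : F = .tensor A B ∨ F = .par A B ∨ F = .wth A B ∨ F = .plus A B) :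
    (a.child d).formula Γ = some (d.pick A B) := by
  simp only [Loc.formula] at h
  rcases hF with rfl | rfl | rfl | rfl <;> simp [Loc.formula, Loc.child, Formula.follow, h]

/-- The vertices of a sequent. -/
def Sequent.locs (S : Sequent V ι) : Finset (Loc V ι) := (S.map Prod.fst).toFinset

@[simp] theorem Sequent.locs_cons (x : Loc V ι × Formula V) (S : Sequent V ι) :
    Sequent.locs (x ::ₘ S) = insert x.1 S.locs := by
  simp [Sequent.locs]

@[simp] theorem Sequent.locs_add (S T : Sequent V ι) :
    Sequent.locs (S + T) = S.locs ∪ T.locs := by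
  simp [Sequent.locs]

theorem Sequent.mem_locs {S : Sequent V ι} {x : Loc V ι} : x ∈ S.locs ↔ ∃ F, (x, F) ∈ S := by
  simp [Sequent.locs]

variable (Γ) in
/-- The sequent consists of distinct incomparable vertices with their formulas. -/
structure Sequent.WF (S : Sequent V ι) : Prop where
  typed : ∀ x ∈ S, x.1.formula Γ = some x.2
  nodup : (S.map Prod.fst).Nodup
  anti : Anti S.locs

theorem Sequent.WF.notMem {x : Loc V ι × Formula V} {S : Sequent V ι}
    (h : Sequent.WF Γ (x ::ₘ S)) : x.1 ∉ S.locs := by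
  have := h.nodup
  rw [Multiset.map_cons, Multiset.nodup_cons] at this
  simpa [Sequent.locs] using this.1

theorem Sequent.WF.tail {x : Loc V ι × Formula V} {S : Sequent V ι}
    (h : Sequent.WF Γ (x ::ₘ S)) : Sequent.WF Γ S where
  typed y hy := h.typed y (Multiset.mem_cons_of_mem hy)
  nodup := by
    have := h.nodup
    rw [Multiset.map_cons, Multiset.nodup_cons] at this
    exact this.2
  anti := h.anti.mono (by simp)

theorem Sequent.WF.of_add_left {S T : Sequent V ι} (h : Sequent.WF Γ (S + T)) :
    Sequent.WF Γ S where
  typed y hy := h.typed y (Multiset.mem_add.2 (.inl hy))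
  nodup := by
    have := h.nodup
    rw [Multiset.map_add, Multiset.nodup_add] at this
    exact this.1
  anti := h.anti.mono (by simp)

theorem Sequent.WF.of_add_right {S T : Sequent V ι} (h : Sequent.WF Γ (S + T)) :
    Sequent.WF Γ T := by
  rw [add_comm] at h; exact h.of_add_left

theorem Sequent.WF.disjoint {S T : Sequent V ι} (h : Sequent.WF Γ (S + T)) :
    Disjoint S.locs T.locs := by
  have := h.nodup
  rw [Multiset.map_add, Multiset.nodup_add] at this
  rw [Finset.disjoint_left]
  intro x hx hy
  simp only [Sequent.locs, Multiset.mem_toFinset] at hx hy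
  exact Multiset.disjoint_left.1 this.2.2 hx hy

theorem Sequent.WF.cons {x : Loc V ι} {F : Formula V} {S : Sequent V ι} (h : Sequent.WF Γ S)
    (hF : x.formula Γ = some F) (hx : x ∉ S.locs) (ha : Anti (insert x S.locs)) :
    Sequent.WF Γ ((x, F) ::ₘ S) where
  typed y hy := by
    rcases Multiset.mem_cons.1 hy with rfl | hy
    · exact hF
    · exact h.typed y hy
  nodup := by
    rw [Multiset.map_cons, Multiset.nodup_cons]
    exact ⟨by simpa [Sequent.locs] using hx, h.nodup⟩
  anti := by simpa using ha

/-- Replacing a formula by its two arguments. -/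
theorem Sequent.WF.children {a : Loc V ι} {F A B : Formula V} {S : Sequent V ι}
    (h : Sequent.WF Γ ((a, F) ::ₘ S))
    (hF : F = .tensor A B ∨ F = .par A B ∨ F = .wth A B ∨ F = .plus A B) :
    Sequent.WF Γ ((a.child .left, A) ::ₘ (a.child .right, B) ::ₘ S) := by
  have ha := h.typed (a, F) (Multiset.mem_cons_self _ _)
  have hT : a ∈ Sequent.locs ((a, F) ::ₘ S) := by simp
  have hl := h.anti.child_notMem hT .left
  have hr := h.anti.child_notMem hT .right
  have hn := h.notMem
  have hanti := h.anti.children hT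
  simp only [Sequent.locs_cons, Finset.mem_insert, not_or] at hl hr hanti hn
  refine (h.tail.cons (Loc.formula_child .right ha hF) hr.2 (hanti.mono ?_)).cons
    (Loc.formula_child .left ha hF) ?_ (hanti.mono ?_)
  · grind
  · rw [Sequent.locs_cons, Finset.mem_insert, not_or]
    exact ⟨fun h => (by cases (Loc.child_inj h).2), hl.2⟩
  · simp only [Sequent.locs_cons]; grind

theorem Sequent.WF.child {a : Loc V ι} {F A B : Formula V} {S : Sequent V ι}
    (h : Sequent.WF Γ ((a, F) ::ₘ S))
    (hF : F = .tensor A B ∨ F = .par A B ∨ F = .wth A B ∨ F = .plus A B) (d : Side) :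
    Sequent.WF Γ ((a.child d, d.pick A B) ::ₘ S) := by
  have := h.children hF
  cases d
  · rw [Multiset.cons_swap] at this; exact this.tail
  · exact this.tail

theorem Sequent.WF.swap_tail {x y : Loc V ι × Formula V} {S : Sequent V ι}
    (h : Sequent.WF Γ (x ::ₘ y ::ₘ S)) : Sequent.WF Γ (x ::ₘ S) := by
  rw [Multiset.cons_swap] at h; exact h.tail

theorem Sequent.WF.ofCut {c : ℕ} {A : Formula V} {S : Sequent V ι} (h : Sequent.WF Γ S)
    (hc : S.Fresh c) : Sequent.WF Γ ((Loc.ofCut c A, A) ::ₘ S) := by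
  have hc' : ∀ x ∈ S.locs, c ∉ x.root.names := by
    intro x hx
    obtain ⟨F, hF⟩ := Sequent.mem_locs.1 hx
    exact hc _ hF
  refine h.cons rfl (fun hx => hc' _ hx (by simp [Root.names])) ?_
  have := Bi.anti_expand (β := .cut c A) h.anti (by simp [Bi.out])
    (by intro x hx k hk; simp only [Bi.cuts, Finset.mem_singleton] at hk; subst hk; exact hc' x hx)
  exact this.mono (by simp only [Bi.out, Bi.actL]; grind)

/-- From a well-formed conclusion all rules, read upwards, lead to well-formed sequents. There a
sequent is determined by its set of vertices, and the multisets of `Derives` may be replaced by the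
finite sets of `Tree.concl`. -/
theorem Derives.valid {t : Tree V ι} {S : Sequent V ι} (h : Derives m t S)
    (hS : Sequent.WF Γ S) : t.Valid Γ m ∧ t.concl = S.locs := by
  induction h with
  | ax a b P =>
    refine ⟨⟨P, hS.typed (a, .pos P) (by simp), hS.typed (b, .neg P) (by simp)⟩, ?_⟩
    ext x; simp [Tree.concl, Sequent.locs]
  | tensor a A B S T p q _ _ ihp ihq =>
    have ht := hS.typed _ (Multiset.mem_cons_self _ _)
    have hn := hS.notMem
    have hd := hS.tail.disjoint
    have hw := hS.children (.inl rfl)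
    have hl : Sequent.WF Γ ((a.child .left, A) ::ₘ S) := by
      have := hw.swap_tail
      rw [← Multiset.cons_add] at this; exact this.of_add_left
    have hr : Sequent.WF Γ ((a.child .right, B) ::ₘ T) := by
      have := hw.tail
      rw [add_comm, ← Multiset.cons_add] at this; exact this.of_add_left
    obtain ⟨vp, cp⟩ := ihp hl
    obtain ⟨vq, cq⟩ := ihq hr
    have nl := hl.notMem
    have nr := hr.notMem
    have n1 := (a.child_ne .left).symm
    have n2 := (a.child_ne .right).symm
    simp only [Sequent.locs_cons, Sequent.locs_add, Finset.mem_union, not_or] at *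
    have e1 : p.concl \ {a.child .left} = S.locs := by rw [cp]; grind
    have e2 : q.concl \ {a.child .right} = T.locs := by rw [cq]; grind
    refine ⟨⟨vp, vq, ⟨A, B, ht⟩, ?_, ?_, ?_, ?_, ?_, ?_⟩, ?_⟩
    · simp [Bi.actL, cp]
    · simp [Bi.actR, cq]
    · simpa only [Bi.actL, Bi.actR, e1, e2] using hd
    · simp [Bi.out, cp, n1, hn.1]
    · simp [Bi.out, cq, n2, hn.2]
    · simp [Bi.cuts]
    · simp only [Tree.concl, Bi.result, Bi.out, Bi.actL, Bi.actR, e1, e2]; grind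
  | par a A B S p _ ih =>
    have ht := hS.typed _ (Multiset.mem_cons_self _ _)
    have hn := hS.notMem
    have hw := hS.children (.inr (.inl rfl))
    obtain ⟨vp, cp⟩ := ih hw
    have nl := hw.notMem
    have nr := hw.tail.notMem
    have n1 := (a.child_ne .left).symm
    have n2 := (a.child_ne .right).symm
    simp only [Sequent.locs_cons, Finset.mem_insert, not_or] at *
    refine ⟨⟨vp, ⟨A, B, ht⟩, ?_, ?_⟩, ?_⟩
    · simp only [Un.act, cp]; grind
    · simp only [Un.out, cp]; grind
    · simp only [Tree.concl, Un.result, Un.out, Un.act, cp]; grind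
  | wth a A B S p q _ _ ihp ihq =>
    have ht := hS.typed _ (Multiset.mem_cons_self _ _)
    have hn := hS.notMem
    have hw := hS.children (.inr (.inr (.inl rfl)))
    have hl := hw.swap_tail
    obtain ⟨vp, cp⟩ := ihp hl
    obtain ⟨vq, cq⟩ := ihq hw.tail
    have nl := hl.notMem
    have nr := hw.tail.notMem
    have n1 := (a.child_ne .left).symm
    have n2 := (a.child_ne .right).symm
    simp only [Sequent.locs_cons] at *
    refine ⟨⟨vp, vq, ⟨A, B, ht⟩, ?_, ?_, ?_, ?_, ?_⟩, ?_⟩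
    · simp [cp]
    · simp [cq]
    · simp [cp, n1, hn]
    · simp [cq, n2, hn]
    · rw [cp, cq]; grind
    · simp only [Tree.concl, cp]; grind
  | plus d a A B S p _ ih =>
    have ht := hS.typed _ (Multiset.mem_cons_self _ _)
    have hn := hS.notMem
    have hw := hS.child (.inr (.inr (.inr rfl))) d
    obtain ⟨vp, cp⟩ := ih hw
    have nl := hw.notMem
    have n1 := (a.child_ne d).symm
    simp only [Sequent.locs_cons] at *
    refine ⟨⟨vp, ⟨A, B, ht⟩, ?_, ?_⟩, ?_⟩
    · simp [Un.act, cp]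
    · simp [Un.out, cp, n1, hn]
    · simp only [Tree.concl, Un.result, Un.out, Un.act, cp]; grind
  | mix S T p q hm _ _ ihp ihq =>
    obtain ⟨vp, cp⟩ := ihp hS.of_add_left
    obtain ⟨vq, cq⟩ := ihq hS.of_add_right
    refine ⟨⟨vp, vq, hm, ?_, ?_, ?_, ?_, ?_, ?_⟩, ?_⟩
    · simp [Bi.actL]
    · simp [Bi.actR]
    · simpa [Bi.actL, Bi.actR, cp, cq] using hS.disjoint
    · simp [Bi.out]
    · simp [Bi.out]
    · simp [Bi.cuts]
    · simp [Tree.concl, Bi.result, Bi.out, Bi.actL, Bi.actR, cp, cq]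
  | cut c A S T p q hc _ _ ihp ihq =>
    have hcS : S.Fresh c := fun x hx => hc x (Multiset.mem_add.2 (.inl hx))
    have hcT : T.Fresh c := fun x hx => hc x (Multiset.mem_add.2 (.inr hx))
    have hl := hS.of_add_left.ofCut (A := A) hcS
    have hr := hS.of_add_right.ofCut (A := A.dual) hcT
    obtain ⟨vp, cp⟩ := ihp hl
    obtain ⟨vq, cq⟩ := ihq hr
    have nl := hl.notMem
    have nr := hr.notMem
    have hd := hS.disjoint
    simp only [Sequent.locs_cons, Sequent.locs_add] at *
    have e1 : p.concl \ {Loc.ofCut c A} = S.locs := by rw [cp]; grind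
    have e2 : q.concl \ {Loc.ofCut c A.dual} = T.locs := by rw [cq]; grind
    refine ⟨⟨vp, vq, trivial, ?_, ?_, ?_, ?_, ?_, ?_⟩, ?_⟩
    · simp [Bi.actL, cp]
    · simp [Bi.actR, cq]
    · simpa only [Bi.actL, Bi.actR, e1, e2] using hd
    · simp [Bi.out]
    · simp [Bi.out]
    · intro k hk x hx
      simp only [Bi.cuts, Finset.mem_singleton] at hk
      subst hk
      simp only [Bi.actL, Bi.actR, e1, e2, Finset.mem_union] at hx
      rcases hx with hx | hx
      · obtain ⟨F, hF⟩ := Sequent.mem_locs.1 hx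
        exact hcS _ hF
      · obtain ⟨F, hF⟩ := Sequent.mem_locs.1 hx
        exact hcT _ hF
    · simp only [Tree.concl, Bi.result, Bi.out, Bi.actL, Bi.actR, e1, e2]; grind

/-! ### From well-formed trees back to derivations -/

variable (Γ) in
/-- The formula at a vertex, with an arbitrary value outside of the parse forest. -/
def Loc.form (x : Loc V ι) : Formula V := (x.formula Γ).getD (x.root.formula Γ)

theorem Loc.form_eq {x : Loc V ι} {F : Formula V} (h : x.formula Γ = some F) :
    x.form Γ = F := by
  simp [Loc.form, h]

variable (Γ) in
/-- The sequent with vertices `S`. -/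
def toSequent (S : Finset (Loc V ι)) : Sequent V ι := S.val.map fun x => (x, x.form Γ)

theorem toSequent_insert {S : Finset (Loc V ι)} {x : Loc V ι} (h : x ∉ S) :
    toSequent Γ (insert x S) = (x, x.form Γ) ::ₘ toSequent Γ S := by
  rw [toSequent, Finset.insert_val_of_notMem h, Multiset.map_cons]; rfl

theorem toSequent_sdiff {S : Finset (Loc V ι)} {x : Loc V ι} (h : x ∈ S) :
    toSequent Γ S = (x, x.form Γ) ::ₘ toSequent Γ (S \ {x}) := by
  rw [← toSequent_insert (by simp)]
  congr 1
  grind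

theorem val_union_of_disjoint {α : Type*} [DecidableEq α] {S T : Finset α} (h : Disjoint S T) :
    (S ∪ T).val = S.val + T.val := by
  rw [← Finset.disjUnion_eq_union S T h]; rfl

theorem toSequent_union {S T : Finset (Loc V ι)} (h : Disjoint S T) :
    toSequent Γ (S ∪ T) = toSequent Γ S + toSequent Γ T := by
  rw [toSequent, val_union_of_disjoint h, Multiset.map_add]; rfl

theorem NamesDisjoint.disjoint {C D : Finset (Cut V)} (h : NamesDisjoint C D) :
    Disjoint C D := by
  rw [Finset.disjoint_left]; exact fun k hk hk' => h k hk k hk' rfl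

theorem derivesStar {t : Tree V ι} (hv : t.Valid Γ m) (ha : t.Apart) :
    DerivesStar m t t.cuts.val (toSequent Γ t.concl) := by
  induction t with
  | ax a b =>
    obtain ⟨P, h1, h2⟩ := hv
    have hab : a ≠ b := by rintro rfl; simp [h1] at h2
    have : toSequent Γ (Tree.ax a b).concl = {(a, .pos P), (b, .neg P)} := by
      rw [Tree.concl, toSequent_insert (by simpa using hab), Loc.form_eq h1]
      simp [toSequent, Loc.form_eq h2]
    rw [this]
    exact .ax a b P
  | tensor a p q ihp ihq =>
    obtain ⟨vp, vq, ⟨A, B, ht⟩, l, r, d, ol, or, -⟩ := hv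
    obtain ⟨ap, aq, hn⟩ := ha
    simp only [Bi.actL, Bi.actR, Bi.out, Finset.singleton_subset_iff,
      Finset.disjoint_singleton_left] at l r d ol or
    have h1 := ihp vp ap
    have h2 := ihq vq aq
    rw [toSequent_sdiff l, Loc.form_eq (Loc.formula_child .left ht (.inl rfl))] at h1
    rw [toSequent_sdiff r, Loc.form_eq (Loc.formula_child .right ht (.inl rfl))] at h2
    have e : toSequent Γ (Tree.tensor a p q).concl = (a, A.tensor B) ::ₘ
        (toSequent Γ (p.concl \ {a.child .left}) + toSequent Γ (q.concl \ {a.child .right})) := by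
      rw [← toSequent_union d, ← Loc.form_eq ht, ← toSequent_insert (by grind)]
      rfl
    rw [e, Tree.cuts, val_union_of_disjoint hn.disjoint]
    exact .tensor a A B _ _ _ _ p q h1 h2
  | par a p ih =>
    obtain ⟨vp, ⟨A, B, ht⟩, l, o⟩ := hv
    have h1 := ih vp ha
    simp only [Un.act, Un.out] at l o
    have e1 : toSequent Γ p.concl = (a.child .left, A) ::ₘ (a.child .right, B) ::ₘ
        toSequent Γ (p.concl \ (Un.par a).act) := by
      have hne : a.child .left ≠ a.child .right := fun h => by cases (Loc.child_inj h).2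
      rw [toSequent_sdiff (x := a.child .left) (l (by simp)),
        Loc.form_eq (Loc.formula_child .left ht (.inr (.inl rfl))),
        toSequent_sdiff (S := p.concl \ {a.child .left}) (x := a.child .right) (by
          simp only [Finset.mem_sdiff, Finset.mem_singleton]
          exact ⟨l (by simp), hne.symm⟩),
        Loc.form_eq (Loc.formula_child .right ht (.inr (.inl rfl)))]
      simp only [Un.act, Side.pick]
      congr 3
      grind
    have e : toSequent Γ (Tree.par a p).concl = (a, A.par B) ::ₘ
        toSequent Γ (p.concl \ (Un.par a).act) := by
      rw [← Loc.form_eq ht, ← toSequent_insert (by grind)]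
      rfl
    rw [e, Tree.cuts]
    rw [e1] at h1
    exact .par a A B _ _ p h1
  | wth a p q ihp ihq =>
    obtain ⟨vp, vq, ⟨A, B, ht⟩, l, r, ol, or, e⟩ := hv
    obtain ⟨ap, aq⟩ := ha
    have h1 := ihp vp ap
    have h2 := ihq vq aq
    rw [toSequent_sdiff l, Loc.form_eq (Loc.formula_child .left ht (.inr (.inr (.inl rfl))))] at h1
    rw [toSequent_sdiff r, Loc.form_eq (Loc.formula_child .right ht (.inr (.inr (.inl rfl)))),
      ← e] at h2
    have e' : toSequent Γ (Tree.wth a p q).concl = (a, A.wth B) ::ₘ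
        toSequent Γ (p.concl \ {a.child .left}) := by
      rw [← Loc.form_eq ht, ← toSequent_insert (by grind)]
      rfl
    -- For the `wth` rule every cut common to the premises is superimposed, so `Ω` is the
    -- intersection, while `Ω₁` and `Ω₂` are the two differences.
    have c1 : p.cuts.val = (p.cuts \ q.cuts).val + (p.cuts ∩ q.cuts).val := by
      rw [← val_union_of_disjoint (by rw [Finset.disjoint_left]; grind)]; congr 1; grind
    have c2 : q.cuts.val = (q.cuts \ p.cuts).val + (p.cuts ∩ q.cuts).val := by
      rw [← val_union_of_disjoint (by rw [Finset.disjoint_left]; grind)]; congr 1; grind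
    have c3 : (Tree.wth a p q).cuts.val =
        (p.cuts \ q.cuts).val + (q.cuts \ p.cuts).val + (p.cuts ∩ q.cuts).val := by
      rw [← val_union_of_disjoint (by rw [Finset.disjoint_left]; grind),
        ← val_union_of_disjoint (by rw [Finset.disjoint_left]; grind), Tree.cuts]
      congr 1; grind
    rw [e', c3]
    rw [c1] at h1
    rw [c2] at h2
    exact .wth a A B _ _ _ _ p q h1 h2
  | plus d a p ih =>
    obtain ⟨vp, ⟨A, B, ht⟩, l, o⟩ := hv
    have h1 := ih vp ha
    simp only [Un.act, Un.out, Finset.singleton_subset_iff] at l o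
    rw [toSequent_sdiff l,
      Loc.form_eq (Loc.formula_child d ht (.inr (.inr (.inr rfl))))] at h1
    have e : toSequent Γ (Tree.plus d a p).concl = (a, A.plus B) ::ₘ
        toSequent Γ (p.concl \ {a.child d}) := by
      rw [← Loc.form_eq ht, ← toSequent_insert (by grind)]
      rfl
    rw [e, Tree.cuts]
    exact .plus d a A B _ _ p h1
  | mix p q ihp ihq =>
    obtain ⟨vp, vq, ht, -, -, d, -, -, -⟩ := hv
    obtain ⟨ap, aq, hn⟩ := ha
    have h1 := ihp vp ap
    have h2 := ihq vq aq
    simp only [Bi.actL, Bi.actR, Finset.sdiff_empty] at d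
    have e : toSequent Γ (Tree.mix p q).concl = toSequent Γ p.concl + toSequent Γ q.concl := by
      rw [← toSequent_union d]
      simp [Tree.concl, Bi.result, Bi.out, Bi.actL, Bi.actR]
    rw [e, Tree.cuts, val_union_of_disjoint hn.disjoint]
    exact .mix _ _ _ _ p q ht h1 h2
  | cut c A p q ihp ihq =>
    obtain ⟨vp, vq, -, l, r, d, -, -, hf⟩ := hv
    obtain ⟨ap, aq, hn, np, nq⟩ := ha
    have h1 := ihp vp ap
    have h2 := ihq vq aq
    simp only [Bi.actL, Bi.actR, Bi.cuts, Finset.singleton_subset_iff] at l r d hf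
    rw [toSequent_sdiff l, Loc.form_eq (F := A) rfl] at h1
    rw [toSequent_sdiff r, Loc.form_eq (F := A.dual) rfl] at h2
    have e : toSequent Γ (Tree.cut c A p q).concl =
        toSequent Γ (p.concl \ {.ofCut c A}) + toSequent Γ (q.concl \ {.ofCut c A.dual}) := by
      rw [← toSequent_union d]
      simp [Tree.concl, Bi.result, Bi.out, Bi.actL, Bi.actR]
    have hk : Disjoint {(c, s(A, A.dual))} (p.cuts ∪ q.cuts) :=
      (namesDisjoint_union_right.2 ⟨np, nq⟩).disjoint
    rw [e, Tree.cuts, val_union_of_disjoint hk, val_union_of_disjoint hn.disjoint,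
      Finset.singleton_val, Multiset.singleton_add]
    refine .cut c A _ _ _ _ p q ?_ h1 h2
    rw [← toSequent_union d]
    intro x hx
    obtain ⟨y, hy, rfl⟩ := Multiset.mem_map.1 hx
    exact hf _ (Finset.mem_singleton_self _) y hy

/-- Distinct names in the final sequent separate the names in the premises of every joining rule. In
the `wth` rule they also make the multiset sum of its three parts match the union of the sets of
cuts. -/
theorem DerivesStar.cuts {t : Tree V ι} {Ω : Multiset (Cut V)} {S : Sequent V ι}
    (h : DerivesStar m t Ω S) (hΩ : (Ω.map Prod.fst).Nodup) :
    t.Apart ∧ ∀ k, k ∈ t.cuts ↔ k ∈ Ω := by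
  have nd : ∀ {A B : Multiset (Cut V)}, ((A + B).map Prod.fst).Nodup →
      (A.map Prod.fst).Nodup ∧ (B.map Prod.fst).Nodup ∧
        ∀ k ∈ A, ∀ l ∈ B, k.1 ≠ l.1 := by
    intro A B h
    rw [Multiset.map_add, Multiset.nodup_add] at h
    exact ⟨h.1, h.2.1, fun k hk l hl e => Multiset.disjoint_left.1 h.2.2
      (Multiset.mem_map_of_mem _ hk) (e ▸ Multiset.mem_map_of_mem _ hl)⟩
  induction h with
  | ax a b P => exact ⟨trivial, by simp [Tree.cuts]⟩
  | tensor a A B Ω₁ Ω₂ S T p q _ _ ihp ihq =>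
    obtain ⟨n1, n2, n3⟩ := nd hΩ
    obtain ⟨a1, c1⟩ := ihp n1
    obtain ⟨a2, c2⟩ := ihq n2
    exact ⟨⟨a1, a2, fun k hk l hl => n3 k ((c1 k).1 hk) l ((c2 l).1 hl)⟩,
      by simp [Tree.cuts, c1, c2]⟩
  | par a A B Ω S p _ ih => exact ih hΩ
  | wth a A B Ω₁ Ω₂ Ω S p q _ _ ihp ihq =>
    have e1 : Ω₁ + Ω₂ + Ω = Ω₁ + Ω + Ω₂ := add_right_comm _ _ _
    have e2 : Ω₁ + Ω₂ + Ω = Ω₁ + (Ω₂ + Ω) := add_assoc _ _ _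
    obtain ⟨a1, c1⟩ := ihp (nd (e1 ▸ hΩ)).1
    obtain ⟨a2, c2⟩ := ihq (nd (e2 ▸ hΩ)).2.1
    refine ⟨⟨a1, a2⟩, fun k => ?_⟩
    simp only [Tree.cuts, Finset.mem_union, c1, c2, Multiset.mem_add]; tauto
  | plus d a A B Ω S p _ ih => exact ih hΩ
  | mix Ω₁ Ω₂ S T p q _ _ _ ihp ihq =>
    obtain ⟨n1, n2, n3⟩ := nd hΩ
    obtain ⟨a1, c1⟩ := ihp n1
    obtain ⟨a2, c2⟩ := ihq n2
    exact ⟨⟨a1, a2, fun k hk l hl => n3 k ((c1 k).1 hk) l ((c2 l).1 hl)⟩,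
      by simp [Tree.cuts, c1, c2]⟩
  | cut c A Ω₁ Ω₂ S T p q _ _ _ ihp ihq =>
    rw [← Multiset.singleton_add] at hΩ
    obtain ⟨-, n0, n0'⟩ := nd hΩ
    obtain ⟨n1, n2, n3⟩ := nd n0
    obtain ⟨a1, c1⟩ := ihp n1
    obtain ⟨a2, c2⟩ := ihq n2
    refine ⟨⟨a1, a2, fun k hk l hl => n3 k ((c1 k).1 hk) l ((c2 l).1 hl), fun k hk l hl => ?_,
      fun k hk l hl => ?_⟩, by simp [Tree.cuts, c1, c2]⟩
    · rw [Finset.mem_singleton] at hk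
      exact n0' k (by simp [hk]) l (by simp [(c1 l).1 hl])
    · rw [Finset.mem_singleton] at hk
      exact n0' k (by simp [hk]) l (by simp [(c2 l).1 hl])

/-! ### Conversions as series of commutations -/

/-- The vertices of the conclusion. -/
def rootLocs (V : Type u) (ι : Type v) [Fintype ι] : Finset (Loc V ι) :=
  Finset.univ.image fun i => ⟨.concl i, []⟩

theorem mem_rootLocs [Fintype ι] {x : Loc V ι} :
    x ∈ rootLocs V ι ↔ ∃ i, (⟨.concl i, []⟩ : Loc V ι) = x := by
  simp [rootLocs]

theorem toSequent_rootLocs [Fintype ι] : toSequent Γ (rootLocs V ι) = Sequent.ofFamily Γ := by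
  have hinj : Function.Injective fun i : ι => (⟨.concl i, []⟩ : Loc V ι) := by
    intro i j h; simpa using h
  rw [toSequent, rootLocs, Finset.image_val_of_injOn hinj.injOn, Multiset.map_map]
  rfl

theorem anti_rootLocs [Fintype ι] : Anti (rootLocs V ι) := by
  intro x hx y hy hle
  obtain ⟨i, rfl⟩ := mem_rootLocs.1 hx
  obtain ⟨j, rfl⟩ := mem_rootLocs.1 hy
  have := Loc.root_eq_of_le hle
  simpa using this

theorem locs_ofFamily [Fintype ι] : (Sequent.ofFamily Γ).locs = rootLocs V ι := by
  ext x; simp [Sequent.mem_locs, mem_rootLocs, Sequent.ofFamily]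

theorem wf_ofFamily [Fintype ι] : Sequent.WF Γ (Sequent.ofFamily Γ) where
  typed x hx := by
    obtain ⟨i, -, rfl⟩ := Multiset.mem_map.1 hx
    rfl
  nodup := by
    rw [Sequent.ofFamily, Multiset.map_map]
    refine Multiset.Nodup.map ?_ Finset.univ.nodup
    intro i j h; simpa using h
  anti := by rw [locs_ofFamily]; exact anti_rootLocs

theorem sep_rootLocs [Fintype ι] (C : Finset (Cut V)) : Sep (rootLocs V ι) C := by
  intro x hx k _
  obtain ⟨i, rfl⟩ := mem_rootLocs.1 hx
  simp [Root.names]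

theorem Tree.OK.derives [Fintype ι] {t : Tree V ι} (h : t.OK Γ m)
    (hc : t.concl = rootLocs V ι) : Derives m t (Sequent.ofFamily Γ) := by
  have := (derivesStar h.valid h.apart).derives
  rwa [hc, toSequent_rootLocs] at this

theorem StarProof.ok [Fintype ι] {Ω : Multiset (Cut V)} (t : StarProof m Ω Γ) :
    t.tree.OK Γ m ∧ t.tree.concl = rootLocs V ι := by
  obtain ⟨hv, hc⟩ := t.derives.derives.valid wf_ofFamily
  obtain ⟨ha, hk⟩ := t.derives.cuts t.names_nodup
  rw [locs_ofFamily] at hc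
  refine ⟨⟨hv, ha, ?_, ?_, ?_⟩, hc⟩
  · rw [hc]; exact anti_rootLocs
  · rw [hc]; exact sep_rootLocs _
  · intro k h l h' e
    exact Multiset.inj_on_of_nodup_map t.names_nodup k ((hk k).1 h) l ((hk l).1 h') e

variable (Γ m) in
/-- A single commutation, or the identification of two representations of a proof. -/
def Step (p q : Tree V ι) : Prop :=
  p.OK Γ m ∧ Agree Γ m p q ∧ (Same p q ∨ CommStep p q ∨ CommStep q p)

theorem Step.ok {p q : Tree V ι} (h : Step Γ m p q) : q.OK Γ m := h.2.1.ok h.1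

theorem Agree.symm {p q : Tree V ι} (h : Agree Γ m p q) : Agree Γ m q p :=
  ⟨h.1.symm, h.2.symm, h.3.symm, h.4.symm, h.5.symm, h.6.symm⟩

theorem Agree.refl (p : Tree V ι) : Agree Γ m p p := ⟨rfl, rfl, rfl, rfl, .rfl, .rfl⟩

theorem Step.symm {p q : Tree V ι} (h : Step Γ m p q) : Step Γ m q p :=
  ⟨h.ok, h.2.1.symm, h.2.2.imp .symm Or.symm⟩

theorem Step.star_symm {p q : Tree V ι} (h : Relation.ReflTransGen (Step Γ m) p q) :
    Relation.ReflTransGen (Step Γ m) q p := by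
  induction h with
  | refl => exact .refl
  | tail _ h ih => exact .head h.symm ih

theorem Step.lift {f : Tree V ι → Tree V ι} (hA : ∀ p q, Agree Γ m p q → Agree Γ m (f p) (f q))
    (hS : ∀ p q, Same p q → Same (f p) (f q)) (hC : ∀ p q, CommStep p q → CommStep (f p) (f q))
    {p q : Tree V ι} (h : Relation.ReflTransGen (Step Γ m) p q) (hp : (f p).OK Γ m) :
    Relation.ReflTransGen (Step Γ m) (f p) (f q) := by
  induction h with
  | refl => exact .refl
  | tail _ hbc ih =>
    obtain ⟨-, ha, hs⟩ := hbc
    refine ih.tail ⟨?_, hA _ _ ha, hs.imp (hS _ _) (Or.imp (hC _ _) (hC _ _))⟩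
    rcases Relation.ReflTransGen.cases_tail ih with h | ⟨c, -, h⟩
    · rw [h]; exact hp
    · exact h.ok

/-- Conversions preserve well-formedness, so a conversion unfolds into single steps between trees
that all represent proofs of the same sequent. -/
theorem Conv.steps {p q : Tree V ι} (h : Conv Γ m p q) (hp : p.OK Γ m) :
    Relation.ReflTransGen (Step Γ m) p q := by
  induction h with
  | refl p => exact .refl
  | symm h ih => exact Step.star_symm (ih (h.symm.ok hp))
  | trans h _ ih ih' => exact (ih hp).trans (ih' (h.ok hp))
  | comm h hp hq hc => exact .single ⟨hp, (Conv.comm h hp hq hc).agree, .inr (.inl (.here h))⟩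
  | mix_swap p q => exact .single ⟨hp, (Conv.mix_swap p q).agree, .inl (.mix_swap p q)⟩
  | cut_swap c A p q =>
    exact .single ⟨hp, (Conv.cut_swap c A p q).agree, .inl (.cut_swap c A p q)⟩
  | @tensor a p p' q q' h k ih ih' =>
    have h1 : Conv Γ m (.tensor a p q) (.tensor a p' q) := .tensor h (.refl _)
    refine (Step.lift (f := fun p => .tensor a p q) (fun _ _ g => .bi (β := .tensor a) g (.refl _))
      (fun _ _ g => .tensor g (.refl _)) (fun _ _ g => .tensor_left g)
      (ih (Bi.ok_left (β := .tensor a) hp)) hp).trans ?_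
    exact Step.lift (f := fun q => .tensor a p' q) (fun _ _ g => .bi (β := .tensor a) (.refl _) g)
      (fun _ _ g => .tensor (.refl _) g) (fun _ _ g => .tensor_right g)
      (ih' (Bi.ok_right (β := .tensor a) hp)) (h1.ok hp)
  | @par a p p' h ih =>
    exact Step.lift (f := fun p => .par a p) (fun _ _ g => .un (u := .par a) g)
      (fun _ _ g => .par g) (fun _ _ g => .par g) (ih (Un.ok_premise (u := .par a) hp)) hp
  | @wth a p p' q q' h k ih ih' =>
    have h1 : Conv Γ m (.wth a p q) (.wth a p' q) := .wth h (.refl _)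
    refine (Step.lift (f := fun p => .wth a p q) (fun _ _ g => .wth g (.refl _))
      (fun _ _ g => .wth g (.refl _)) (fun _ _ g => .wth_left g) (ih (wth_ok_left hp)) hp).trans ?_
    exact Step.lift (f := fun q => .wth a p' q) (fun _ _ g => .wth (.refl _) g)
      (fun _ _ g => .wth (.refl _) g) (fun _ _ g => .wth_right g) (ih' (wth_ok_right hp)) (h1.ok hp)
  | @plus d a p p' h ih =>
    exact Step.lift (f := fun p => .plus d a p) (fun _ _ g => .un (u := .plus d a) g)
      (fun _ _ g => .plus g) (fun _ _ g => .plus g) (ih (Un.ok_premise (u := .plus d a) hp)) hp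
  | @mix p p' q q' h k ih ih' =>
    have h1 : Conv Γ m (.mix p q) (.mix p' q) := .mix h (.refl _)
    refine (Step.lift (f := fun p => .mix p q) (fun _ _ g => .bi (β := .mix) g (.refl _))
      (fun _ _ g => .mix g (.refl _)) (fun _ _ g => .mix_left g)
      (ih (Bi.ok_left (β := .mix) hp)) hp).trans ?_
    exact Step.lift (f := fun q => .mix p' q) (fun _ _ g => .bi (β := .mix) (.refl _) g)
      (fun _ _ g => .mix (.refl _) g) (fun _ _ g => .mix_right g)
      (ih' (Bi.ok_right (β := .mix) hp)) (h1.ok hp)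
  | @cut c A p p' q q' h k ih ih' =>
    have h1 : Conv Γ m (.cut c A p q) (.cut c A p' q) := .cut h (.refl _)
    refine (Step.lift (f := fun p => .cut c A p q) (fun _ _ g => .bi (β := .cut c A) g (.refl _))
      (fun _ _ g => .cut g (.refl _)) (fun _ _ g => .cut_left g)
      (ih (Bi.ok_left (β := .cut c A) hp)) hp).trans ?_
    exact Step.lift (f := fun q => .cut c A p' q) (fun _ _ g => .bi (β := .cut c A) (.refl _) g)
      (fun _ _ g => .cut (.refl _) g) (fun _ _ g => .cut_right g)
      (ih' (Bi.ok_right (β := .cut c A) hp)) (h1.ok hp)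

/-- A swap of premises is an equality in the quotient; only the proper commutations contribute to
the series. -/
theorem interconvertible_of_steps [Fintype ι] {p q : Tree V ι}
    (h : Relation.ReflTransGen (Step Γ m) p q) (hp : p.OK Γ m) (hc : p.concl = rootLocs V ι)
    (hdp : Derives m p (Sequent.ofFamily Γ)) (hdq : Derives m q (Sequent.ofFamily Γ)) :
    Interconvertible (m := m) (Γ := Γ) (Quotient.mk _ ⟨p, hdp⟩) (Quotient.mk _ ⟨q, hdq⟩) := by
  induction h using Relation.ReflTransGen.head_induction_on with
  | refl => exact .refl
  | head h _ ih =>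
    obtain ⟨-, ha, hs⟩ := h
    have ok := ha.ok hp
    have hc' := ha.concl.symm.trans hc
    have hd := ok.derives hc'
    refine .trans ?_ (ih ok hc' hd)
    rcases hs with hs | hs
    · have e : (Quotient.mk _ ⟨_, hdp⟩ : Proof m Γ) = Quotient.mk _ ⟨_, hd⟩ :=
        Quotient.sound (s := RawProof.setoid m Γ) (a := ⟨_, hdp⟩) (b := ⟨_, hd⟩) hs
      exact e ▸ .refl
    · exact .single ⟨⟨_, hdp⟩, ⟨_, hd⟩, rfl, rfl, hs⟩

theorem interconvertible_of_commonTranslation [Fintype ι] {x y : Proof m Γ}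
    (h : CommonTranslation x y) : Interconvertible x y := by
  obtain ⟨Ω, θ, ⟨s, hs, rfl⟩, ⟨t, ht, rfl⟩⟩ := h
  obtain ⟨oks, cs⟩ := s.ok
  obtain ⟨okt, ct⟩ := t.ok
  have hc := determined _ s.tree t.tree (Nat.lt_succ_self _) oks okt (cs.trans ct.symm)
    (hs.trans ht.symm)
  exact interconvertible_of_steps (hc.steps oks) oks cs _ _

/-! ### Renaming of cuts -/

theorem Root.rename_injective (π : Equiv.Perm ℕ) :
    Function.Injective (Root.rename π : Root V ι → Root V ι) := by
  intro r s h
  cases r <;> cases s <;> simp_all [Root.rename]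

theorem Loc.rename_injective (π : Equiv.Perm ℕ) :
    Function.Injective (Loc.rename π : Loc V ι → Loc V ι) := by
  rintro ⟨r, l⟩ ⟨s, k⟩ h
  simp only [Loc.rename, Loc.mk.injEq] at h
  obtain ⟨h, rfl⟩ := h
  rw [Root.rename_injective π h]

@[simp] theorem Loc.rename_formula (π : Equiv.Perm ℕ) (a : Loc V ι) :
    (a.rename π).formula Γ = a.formula Γ := by
  obtain ⟨r, l⟩ := a
  cases r <;> rfl

theorem Loc.rename_child (π : Equiv.Perm ℕ) (d : Side) (a : Loc V ι) :
    (a.child d).rename π = (a.rename π).child d := rfl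

theorem Root.mem_names_rename {π : Equiv.Perm ℕ} {r : Root V ι} {c : ℕ} :
    π c ∈ (r.rename π).names ↔ c ∈ r.names := by
  cases r <;> simp [Root.rename, Root.names]

/-- Renaming of cuts. -/
def Cut.rename (π : Equiv.Perm ℕ) (k : Cut V) : Cut V := (π k.1, k.2)

theorem namesDisjoint_rename {π : Equiv.Perm ℕ} {C D : Finset (Cut V)} :
    NamesDisjoint (C.image (Cut.rename π)) (D.image (Cut.rename π)) ↔ NamesDisjoint C D := by
  simp only [NamesDisjoint, Finset.forall_mem_image, Cut.rename, ne_eq, π.injective.eq_iff]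

theorem Func.rename {π : Equiv.Perm ℕ} {C : Finset (Cut V)} (h : Func C) :
    Func (C.image (Cut.rename π)) := by
  intro k hk' l hl' e
  obtain ⟨k, hk, rfl⟩ := Finset.mem_image.1 hk'
  obtain ⟨l, hl, rfl⟩ := Finset.mem_image.1 hl'
  rw [h k hk l hl (π.injective e)]

/-- Renaming of the occurrence that the rule generates. -/
def Un.rename (π : Equiv.Perm ℕ) : Un V ι → Un V ι
  | par a => par (a.rename π)
  | plus d a => plus d (a.rename π)

/-- Renaming of the occurrence or the cut that the rule generates. -/
def Bi.rename (π : Equiv.Perm ℕ) : Bi V ι → Bi V ι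
  | tensor a => tensor (a.rename π)
  | tensor' a => tensor' (a.rename π)
  | mix => mix
  | cut c A => cut (π c) A

theorem Un.node_rename (π : Equiv.Perm ℕ) (u : Un V ι) (p : Tree V ι) :
    (u.node p).rename π = (u.rename π).node (p.rename π) := by
  cases u <;> rfl

theorem Bi.node_rename (π : Equiv.Perm ℕ) (β : Bi V ι) (p q : Tree V ι) :
    (β.node p q).rename π = (β.rename π).node (p.rename π) (q.rename π) := by
  cases β <;> rfl

theorem Un.act_rename (π : Equiv.Perm ℕ) (u : Un V ι) :
    (u.rename π).act = u.act.image (Loc.rename π) := by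
  cases u <;> simp [Un.rename, Un.act, Loc.rename_child, Finset.image_insert]

theorem Un.out_rename (π : Equiv.Perm ℕ) (u : Un V ι) :
    (u.rename π).out = u.out.rename π := by
  cases u <;> rfl

theorem Un.result_rename (π : Equiv.Perm ℕ) (u : Un V ι) (S : Finset (Loc V ι)) :
    (u.rename π).result (S.image (Loc.rename π)) = (u.result S).image (Loc.rename π) := by
  simp only [Un.result, Un.act_rename, Un.out_rename, Finset.image_insert,
    Finset.image_sdiff _ _ (Loc.rename_injective π)]

theorem Un.Fits.rename {π : Equiv.Perm ℕ} {u : Un V ι} {S : Finset (Loc V ι)}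
    (h : u.Fits Γ S) : (u.rename π).Fits Γ (S.image (Loc.rename π)) := by
  obtain ⟨t, a, o⟩ := h
  refine ⟨?_, ?_, ?_⟩
  · cases u <;> simpa [Un.rename, Un.Typed] using t
  · rw [Un.act_rename]; exact Finset.image_subset_image a
  · rw [Un.out_rename, (Loc.rename_injective π).mem_finset_image]; exact o

theorem Bi.actL_rename (π : Equiv.Perm ℕ) (β : Bi V ι) :
    (β.rename π).actL = β.actL.image (Loc.rename π) := by
  cases β <;> simp [Bi.rename, Bi.actL, Loc.rename_child]
  rfl

theorem Bi.actR_rename (π : Equiv.Perm ℕ) (β : Bi V ι) :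
    (β.rename π).actR = β.actR.image (Loc.rename π) := by
  cases β <;> simp [Bi.rename, Bi.actR, Loc.rename_child]
  rfl

theorem Bi.out_rename (π : Equiv.Perm ℕ) (β : Bi V ι) :
    (β.rename π).out = β.out.image (Loc.rename π) := by
  cases β <;> simp [Bi.rename, Bi.out]

theorem Bi.cuts_rename (π : Equiv.Perm ℕ) (β : Bi V ι) :
    (β.rename π).cuts = β.cuts.image (Cut.rename π) := by
  cases β <;> simp [Bi.rename, Bi.cuts, Cut.rename]

theorem Bi.result_rename (π : Equiv.Perm ℕ) (β : Bi V ι) (S T : Finset (Loc V ι)) :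
    (β.rename π).result (S.image (Loc.rename π)) (T.image (Loc.rename π)) =
      (β.result S T).image (Loc.rename π) := by
  simp only [Bi.result, Bi.actL_rename, Bi.actR_rename, Bi.out_rename, Finset.image_union,
    Finset.image_sdiff _ _ (Loc.rename_injective π)]

theorem Sep.rename {π : Equiv.Perm ℕ} {S : Finset (Loc V ι)} {C : Finset (Cut V)} (h : Sep S C) :
    Sep (S.image (Loc.rename π)) (C.image (Cut.rename π)) := by
  intro x hx' k hk'
  obtain ⟨x, hx, rfl⟩ := Finset.mem_image.1 hx'
  obtain ⟨k, hk, rfl⟩ := Finset.mem_image.1 hk'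
  exact fun hn => h x hx k hk (Root.mem_names_rename.1 hn)

theorem Bi.Fits.rename {π : Equiv.Perm ℕ} {β : Bi V ι} {S T : Finset (Loc V ι)}
    (h : β.Fits Γ m S T) :
    (β.rename π).Fits Γ m (S.image (Loc.rename π)) (T.image (Loc.rename π)) := by
  have hi := Loc.rename_injective (V := V) (ι := ι) π
  obtain ⟨t, al, ar, d, ol, or, f⟩ := h
  refine ⟨?_, ?_, ?_, ?_, ?_, ?_, ?_⟩
  · cases β <;> simpa [Bi.rename, Bi.Typed] using t
  · rw [Bi.actL_rename]; exact Finset.image_subset_image al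
  · rw [Bi.actR_rename]; exact Finset.image_subset_image ar
  · rw [Bi.actL_rename, Bi.actR_rename, ← Finset.image_sdiff _ _ hi, ← Finset.image_sdiff _ _ hi]
    exact (Finset.disjoint_image hi).2 d
  · rw [Bi.out_rename]; exact (Finset.disjoint_image hi).2 ol
  · rw [Bi.out_rename]; exact (Finset.disjoint_image hi).2 or
  · rw [Bi.actL_rename, Bi.actR_rename, ← Finset.image_sdiff _ _ hi, ← Finset.image_sdiff _ _ hi,
      ← Finset.image_union, Bi.cuts_rename]
    intro k hk x hx
    exact Sep.rename (fun x hx k hk => f k hk x hx) x hx k hk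

@[simp] theorem Tree.concl_rename (π : Equiv.Perm ℕ) (t : Tree V ι) :
    (t.rename π).concl = t.concl.image (Loc.rename π) := by
  induction t using Tree.rec_rules with
  | ax a b => simp [Tree.rename, Tree.concl, Finset.image_insert]
  | un u p ih => rw [Un.node_rename, Un.concl_node, Un.concl_node, ih, Un.result_rename]
  | bi β p q ih ih' =>
    rw [Bi.node_rename, Bi.concl_node, Bi.concl_node, ih, ih', Bi.result_rename]
  | wth a p q ih ih' =>
    rw [Tree.rename, Tree.concl, Tree.concl, ih, Finset.image_insert,
      Finset.image_sdiff _ _ (Loc.rename_injective π), Finset.image_singleton, Loc.rename_child]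

@[simp] theorem Tree.cuts_rename (π : Equiv.Perm ℕ) (t : Tree V ι) :
    (t.rename π).cuts = t.cuts.image (Cut.rename π) := by
  induction t using Tree.rec_rules with
  | ax a b => simp [Tree.rename, Tree.cuts]
  | un u p ih => rw [Un.node_rename, Un.cuts_node, Un.cuts_node, ih]
  | bi β p q ih ih' =>
    rw [Bi.node_rename, Bi.cuts_node, Bi.cuts_node, ih, ih', Bi.cuts_rename, Finset.image_union,
      Finset.image_union]
  | wth a p q ih ih' => rw [Tree.rename, Tree.cuts, Tree.cuts, ih, ih', Finset.image_union]

theorem Tree.linkings_rename (π : Equiv.Perm ℕ) (t : Tree V ι) :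
    (t.rename π).linkings = (fun lk => Sym2.map (Loc.rename π) '' lk) '' t.linkings := by
  induction t using Tree.rec_rules with
  | ax a b => simp [Tree.rename, Tree.linkings]
  | un u p ih => rw [Un.node_rename, Un.linkings_node, Un.linkings_node, ih]
  | bi β p q ih ih' =>
    rw [Bi.node_rename, Bi.linkings_node, Bi.linkings_node, ih, ih']
    exact (Set.image_image2_distrib fun _ _ => Set.image_union _ _ _).symm
  | wth a p q ih ih' => rw [Tree.rename, Tree.linkings, Tree.linkings, ih, ih', Set.image_union]

theorem Tree.Valid.rename (π : Equiv.Perm ℕ) {t : Tree V ι} (h : t.Valid Γ m) :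
    (t.rename π).Valid Γ m := by
  induction t using Tree.rec_rules with
  | ax a b => simpa [Tree.rename, Tree.Valid] using h
  | un u p ih =>
    obtain ⟨hp, hF⟩ := Un.valid_node.1 h
    rw [Un.node_rename, Un.valid_node, Tree.concl_rename]
    exact ⟨ih hp, hF.rename⟩
  | bi β p q ih ih' =>
    obtain ⟨hp, hq, hF⟩ := Bi.valid_node.1 h
    rw [Bi.node_rename, Bi.valid_node, Tree.concl_rename, Tree.concl_rename]
    exact ⟨ih hp, ih' hq, hF.rename⟩
  | wth a p q ih ih' =>
    obtain ⟨hp, hq, hF⟩ := wth_valid.1 h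
    have hi := Loc.rename_injective (V := V) (ι := ι) π
    rw [Tree.rename, wth_valid]
    refine ⟨ih hp, ih' hq, ?_, ?_, ?_, ?_, ?_, ?_⟩
    · simpa using hF.typed
    · rw [Tree.concl_rename]; exact Finset.mem_image_of_mem _ hF.left
    · rw [Tree.concl_rename]; exact Finset.mem_image_of_mem _ hF.right
    · rw [Tree.concl_rename, hi.mem_finset_image]; exact hF.notMem_left
    · rw [Tree.concl_rename, hi.mem_finset_image]; exact hF.notMem_right
    · have := congrArg (Finset.image (Loc.rename π)) hF.eq
      rwa [Finset.image_sdiff _ _ hi, Finset.image_sdiff _ _ hi, Finset.image_singleton,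
        Finset.image_singleton, Loc.rename_child, Loc.rename_child, ← Tree.concl_rename,
        ← Tree.concl_rename] at this

theorem Tree.Apart.rename (π : Equiv.Perm ℕ) {t : Tree V ι} (h : t.Apart) :
    (t.rename π).Apart := by
  induction t using Tree.rec_rules with
  | ax a b => trivial
  | un u p ih => rw [Un.node_rename, Un.apart_node]; exact ih (Un.apart_node.1 h)
  | bi β p q ih ih' =>
    obtain ⟨hp, hq, h1, h2, h3⟩ := Bi.apart_node.1 h
    rw [Bi.node_rename, Bi.apart_node, Tree.cuts_rename, Tree.cuts_rename, Bi.cuts_rename]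
    exact ⟨ih hp, ih' hq, namesDisjoint_rename.2 h1, namesDisjoint_rename.2 h2,
      namesDisjoint_rename.2 h3⟩
  | wth a p q ih ih' => exact ⟨ih h.1, ih' h.2⟩

/-- A consumed occurrence passes its name on to the generated one, except at the cut that binds it.
Hence a renaming that fixes the names in the conclusion gives the same proof. -/
theorem exists_name_of_mem_freeNames {t : Tree V ι} (ht : t.Valid Γ m) {c : ℕ}
    (h : c ∈ t.freeNames) : ∃ x ∈ t.concl, c ∈ x.root.names := by
  have key : ∀ (β : Bi V ι) (p q : Tree V ι), β.Fits Γ m p.concl q.concl →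
      (∀ k ∈ β.cuts, c ≠ k.1) →
      ((∃ x ∈ p.concl, c ∈ x.root.names) ∨ ∃ x ∈ q.concl, c ∈ x.root.names) →
      ∃ x ∈ (β.node p q).concl, c ∈ x.root.names := by
    intro β p q hF hc hx
    have h1 : ∀ x, x ∈ β.actL ∨ x ∈ β.actR → c ∈ x.root.names →
        ∃ x ∈ (β.node p q).concl, c ∈ x.root.names := by
      intro x hx hcx
      rcases Bi.act_root hx with ⟨y, hy, e⟩ | ⟨k, hk, e⟩
      · exact ⟨y, by simp [Bi.result, hy], e ▸ hcx⟩
      · exact absurd (e _ hcx) (hc k hk)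
    rcases hx with ⟨x, hx, hcx⟩ | ⟨x, hx, hcx⟩
    · by_cases ha : x ∈ β.actL
      · exact h1 x (.inl ha) hcx
      · exact ⟨x, by simp [Bi.result, hx, ha], hcx⟩
    · by_cases ha : x ∈ β.actR
      · exact h1 x (.inr ha) hcx
      · exact ⟨x, by simp [Bi.result, hx, ha], hcx⟩
  have key' : ∀ (u : Un V ι) (p : Tree V ι), (∃ x ∈ p.concl, c ∈ x.root.names) →
      ∃ x ∈ (u.node p).concl, c ∈ x.root.names := by
    rintro u p ⟨x, hx, hcx⟩
    by_cases ha : x ∈ u.act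
    · obtain ⟨d, rfl⟩ := Un.child_of_mem_act ha
      exact ⟨u.out, by simp [Un.result], hcx⟩
    · exact ⟨x, by simp [Un.result, hx, ha], hcx⟩
  induction t with
  | ax a b =>
    rcases h with h | h
    · exact ⟨a, by simp [Tree.concl], h⟩
    · exact ⟨b, by simp [Tree.concl], h⟩
  | tensor a p q ih ih' =>
    exact key (.tensor a) p q ht.2.2 (by simp [Bi.cuts]) (h.imp (ih ht.1) (ih' ht.2.1))
  | par a p ih => exact key' (.par a) p (ih ht.1 h)
  | wth a p q ih ih' =>
    obtain ⟨hp, hq, hF⟩ := wth_valid.1 ht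
    rcases h with h | h
    · obtain ⟨x, hx, hcx⟩ := ih hp h
      by_cases ha : x = a.child .left
      · subst ha; exact ⟨a, by simp [Tree.concl], hcx⟩
      · exact ⟨x, by simp [Tree.concl, hx, ha], hcx⟩
    · obtain ⟨x, hx, hcx⟩ := ih' hq h
      by_cases ha : x = a.child .right
      · subst ha; exact ⟨a, by simp [Tree.concl], hcx⟩
      · exact ⟨x, by rw [Tree.concl, hF.eq]; simp [hx, ha], hcx⟩
  | plus d a p ih => exact key' (.plus d a) p (ih ht.1 h)
  | mix p q ih ih' =>
    exact key .mix p q ht.2.2 (by simp [Bi.cuts]) (h.imp (ih ht.1) (ih' ht.2.1))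
  | cut c A p q ih ih' =>
    exact key (.cut c A) p q ht.2.2 (by simpa [Bi.cuts] using h.2)
      (h.1.imp (ih ht.1) (ih' ht.2.1))

/-- The names of cuts that occur in a sequent. -/
def namesOf (S : Finset (Loc V ι)) : Set ℕ := {c | ∃ x ∈ S, c ∈ x.root.names}

theorem finite_namesOf (S : Finset (Loc V ι)) : (namesOf S).Finite := by
  have : namesOf S = ⋃ x ∈ S, x.root.names := by ext; simp [namesOf]
  rw [this]
  refine S.finite_toSet.biUnion fun x _ => ?_
  cases x.root with
  | concl i => exact Set.finite_empty
  | cut c A => exact Set.finite_singleton c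

theorem sep_of_names {S : Finset (Loc V ι)} {C : Finset (Cut V)}
    (h : ∀ k ∈ C, k.1 ∉ namesOf S) : Sep S C :=
  fun x hx k hk hn => h k hk ⟨x, hx, hn⟩

theorem finite_names (C : Finset (Cut V)) : (Prod.fst '' (C : Set (Cut V))).Finite :=
  C.finite_toSet.image _

theorem namesDisjoint_of_names {C D : Finset (Cut V)}
    (h : ∀ k ∈ C, k.1 ∉ Prod.fst '' (D : Set (Cut V))) : NamesDisjoint D C :=
  fun l hl k hk e => h k hk ⟨l, hl, e⟩

/-- With `K` a bound for all three sets, exchange `n` and `n + (K + 1)` for each `n` in `N`. The new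
values exceed everything in `X`, and the elements of `F` are not moved. -/
theorem exists_perm_avoiding {N F X : Set ℕ} (hN : N.Finite) (hF : F.Finite) (hX : X.Finite)
    (h : Disjoint N F) : ∃ π : Equiv.Perm ℕ, (∀ c ∈ F, π c = c) ∧ ∀ n ∈ N, π n ∉ X := by
  obtain ⟨K, hK⟩ := ((hN.union hF).union hX).bddAbove
  have hlt : ∀ n ∈ N ∪ F ∪ X, n < K + 1 := fun n hn => Nat.lt_succ_of_le (hK hn)
  let f : ℕ → ℕ := fun n =>
    if n ∈ N then n + (K + 1) else if K + 1 ≤ n ∧ n - (K + 1) ∈ N then n - (K + 1) else n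
  have f1 : ∀ n ∈ N, f n = n + (K + 1) := fun n hn => if_pos hn
  have f2 : ∀ n, n ∉ N → ¬ (K + 1 ≤ n ∧ n - (K + 1) ∈ N) → f n = n := fun n hn hn' => by
    simp only [f, if_neg hn, if_neg hn']
  have f3 : ∀ n ∈ N, f (n + (K + 1)) = n := fun n hn => by
    have h2 : n + (K + 1) ∉ N := fun h => by
      have := hlt _ (.inl (.inl h)); omega
    have h3 : K + 1 ≤ n + (K + 1) ∧ n + (K + 1) - (K + 1) ∈ N :=
      ⟨by omega, by rwa [Nat.add_sub_cancel]⟩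
    simp only [f]
    rw [if_neg h2, if_pos h3, Nat.add_sub_cancel]
  have hf : Function.Involutive f := by
    intro n
    by_cases h1 : n ∈ N
    · rw [f1 n h1, f3 n h1]
    · by_cases h2 : K + 1 ≤ n ∧ n - (K + 1) ∈ N
      · have e : n - (K + 1) + (K + 1) = n := by omega
        have := f3 _ h2.2
        rw [e] at this
        rw [this, f1 _ h2.2, e]
      · rw [f2 n h1 h2, f2 n h1 h2]
  refine ⟨hf.toPerm, fun c hc => ?_, fun n hn hx => ?_⟩
  · exact f2 c (fun hn => Set.disjoint_left.1 h hn hc) fun h => by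
      have := hlt _ (.inl (.inr hc)); omega
  · have := hlt _ (.inr hx)
    rw [Function.Involutive.coe_toPerm, f1 n hn] at this
    omega

theorem image_rename_eq {π : Equiv.Perm ℕ} {S : Finset (Loc V ι)}
    (h : ∀ c ∈ namesOf S, π c = c) : S.image (Loc.rename π) = S := by
  have : ∀ x ∈ S, x.rename π = x := by
    rintro ⟨r, l⟩ hx
    cases r with
    | concl i => rfl
    | cut c A =>
      have := h c ⟨_, hx, by simp [Root.names]⟩
      simp [Loc.rename, Root.rename, this]
  rw [Finset.image_congr (g := id) (fun x hx => this x hx), Finset.image_id]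

/-! ### Representatives with distinct names of cuts -/

/-- Distinct rules of the tree do not share the name of a cut. -/
def Tree.Linear : Tree V ι → Prop
  | ax _ _ => True
  | tensor _ p q => p.Linear ∧ q.Linear ∧ NamesDisjoint p.cuts q.cuts
  | par _ p => p.Linear
  | wth _ p q => p.Linear ∧ q.Linear ∧ NamesDisjoint p.cuts q.cuts
  | plus _ _ p => p.Linear
  | mix p q => p.Linear ∧ q.Linear ∧ NamesDisjoint p.cuts q.cuts
  | cut c A p q => p.Linear ∧ q.Linear ∧ NamesDisjoint p.cuts q.cuts ∧
      NamesDisjoint {(c, s(A, A.dual))} p.cuts ∧ NamesDisjoint {(c, s(A, A.dual))} q.cuts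

theorem Un.linear_node {u : Un V ι} {p : Tree V ι} : (u.node p).Linear ↔ p.Linear := by
  cases u <;> rfl

theorem Bi.linear_node {β : Bi V ι} {p q : Tree V ι} :
    (β.node p q).Linear ↔ p.Linear ∧ q.Linear ∧ NamesDisjoint p.cuts q.cuts ∧
      NamesDisjoint β.cuts p.cuts ∧ NamesDisjoint β.cuts q.cuts := by
  have : NamesDisjoint q.cuts p.cuts ↔ NamesDisjoint p.cuts q.cuts :=
    ⟨NamesDisjoint.symm, NamesDisjoint.symm⟩
  cases β <;> simp [Bi.node, Tree.Linear, Bi.cuts, this]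
  tauto

theorem Tree.Linear.rename (π : Equiv.Perm ℕ) {t : Tree V ι} (h : t.Linear) :
    (t.rename π).Linear := by
  induction t using Tree.rec_rules with
  | ax a b => trivial
  | un u p ih => rw [Un.node_rename, Un.linear_node]; exact ih (Un.linear_node.1 h)
  | bi β p q ih ih' =>
    obtain ⟨hp, hq, h1, h2, h3⟩ := Bi.linear_node.1 h
    rw [Bi.node_rename, Bi.linear_node, Tree.cuts_rename, Tree.cuts_rename, Bi.cuts_rename]
    exact ⟨ih hp, ih' hq, namesDisjoint_rename.2 h1, namesDisjoint_rename.2 h2,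
      namesDisjoint_rename.2 h3⟩
  | wth a p q ih ih' =>
    refine ⟨ih h.1, ih' h.2.1, ?_⟩
    rw [Tree.cuts_rename, Tree.cuts_rename]
    exact namesDisjoint_rename.2 h.2.2

theorem Func.union {C D : Finset (Cut V)} (hC : Func C) (hD : Func D) (h : NamesDisjoint C D) :
    Func (C ∪ D) := by
  intro k hk l hl e
  rcases Finset.mem_union.1 hk with hk | hk <;> rcases Finset.mem_union.1 hl with hl | hl
  · exact hC k hk l hl e
  · exact absurd e (h k hk l hl)
  · exact absurd e.symm (h l hl k hk)
  · exact hD k hk l hl e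

theorem Bi.func_cuts (β : Bi V ι) : Func β.cuts := by
  cases β <;> simp [Func, Bi.cuts]

theorem Tree.Linear.func {t : Tree V ι} (h : t.Linear) : Func t.cuts := by
  induction t using Tree.rec_rules with
  | ax a b => simp [Tree.cuts, Func]
  | un u p ih => rw [Un.cuts_node]; exact ih (Un.linear_node.1 h)
  | bi β p q ih ih' =>
    obtain ⟨hp, hq, h1, h2, h3⟩ := Bi.linear_node.1 h
    rw [Bi.cuts_node]
    exact β.func_cuts.union ((ih hp).union (ih' hq) h1) (namesDisjoint_union_right.2 ⟨h2, h3⟩)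
  | wth a p q ih ih' => exact (ih h.1).union (ih' h.2.1) h.2.2

theorem Tree.Linear.apart {t : Tree V ι} (h : t.Linear) : t.Apart := by
  induction t using Tree.rec_rules with
  | ax a b => trivial
  | un u p ih => exact Un.apart_node.2 (ih (Un.linear_node.1 h))
  | bi β p q ih ih' =>
    obtain ⟨hp, hq, h1⟩ := Bi.linear_node.1 h
    exact Bi.apart_node.2 ⟨ih hp, ih' hq, h1⟩
  | wth a p q ih ih' => exact ⟨ih h.1, ih' h.2.1⟩

/-! ### Representatives of one proof -/

variable (Γ m) in
/-- The trees denote the same proof. -/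
structure Rep (p p' : Tree V ι) : Prop where
  same : Same p p'
  valid : p.Valid Γ m → p'.Valid Γ m
  concl : p'.concl = p.concl

theorem Rep.refl (p : Tree V ι) : Rep Γ m p p := ⟨.refl p, id, rfl⟩

theorem Rep.trans {p q r : Tree V ι} (h : Rep Γ m p q) (k : Rep Γ m q r) : Rep Γ m p r :=
  ⟨h.same.trans k.same, k.valid ∘ h.valid, k.concl.trans h.concl⟩

theorem Rep.un {u : Un V ι} {p p' : Tree V ι} (h : Rep Γ m p p') :
    Rep Γ m (u.node p) (u.node p') where
  same := by
    cases u
    · exact .par h.same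
    · exact .plus h.same
  valid := by
    rw [Un.valid_node, Un.valid_node, h.concl]
    exact fun k => ⟨h.valid k.1, k.2⟩
  concl := by simp [h.concl]

theorem Rep.bi {β : Bi V ι} {p p' q q' : Tree V ι} (h : Rep Γ m p p') (k : Rep Γ m q q') :
    Rep Γ m (β.node p q) (β.node p' q') where
  same := by
    cases β
    · exact .tensor h.same k.same
    · exact .tensor k.same h.same
    · exact .mix h.same k.same
    · exact .cut h.same k.same
  valid := by
    rw [Bi.valid_node, Bi.valid_node, h.concl, k.concl]
    exact fun g => ⟨h.valid g.1, k.valid g.2.1, g.2.2⟩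
  concl := by simp [h.concl, k.concl]

theorem Rep.wth {a : Loc V ι} {p p' q q' : Tree V ι} (h : Rep Γ m p p') (k : Rep Γ m q q') :
    Rep Γ m (.wth a p q) (.wth a p' q') where
  same := .wth h.same k.same
  valid := by
    rw [wth_valid, wth_valid, h.concl, k.concl]
    exact fun g => ⟨h.valid g.1, k.valid g.2.1, g.2.2⟩
  concl := by simp [Tree.concl, h.concl]

theorem Rep.flip (β : Bi V ι) (p q : Tree V ι) :
    Rep Γ m (β.node p q) (β.flip.node q p) where
  same := by
    cases β
    · exact .refl _
    · exact .refl _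
    · exact .mix_swap _ _
    · exact .cut_swap _ _ _ _
  valid := (Agree.flip β p q).valid.1
  concl := (Agree.flip (Γ := Γ) (m := m) β p q).concl.symm

theorem Rep.rename {π : Equiv.Perm ℕ} {p : Tree V ι} (hp : p.Valid Γ m)
    (h : ∀ c ∈ namesOf p.concl, π c = c) : Rep Γ m p (p.rename π) where
  same := .rename π p fun c hc => h c (exists_name_of_mem_freeNames hp hc)
  valid hp := hp.rename π
  concl := by rw [Tree.concl_rename, image_rename_eq h]

/-- The retained cuts have names that are not free in `S`, so they can be moved away from `X` while
the free names stay fixed. -/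
theorem exists_rename {S : Finset (Loc V ι)} {C : Finset (Cut V)} (h : Sep S C) {X : Set ℕ}
    (hX : X.Finite) : ∃ π : Equiv.Perm ℕ, (∀ c ∈ namesOf S, π c = c) ∧
      ∀ k ∈ C.image (Cut.rename π), k.1 ∉ X := by
  obtain ⟨π, h1, h2⟩ := exists_perm_avoiding (finite_names C) (finite_namesOf S) hX (by
    rw [Set.disjoint_left]
    rintro _ ⟨k, hk, rfl⟩ ⟨x, hx, hn⟩
    exact h x hx k hk hn)
  refine ⟨π, h1, ?_⟩
  rw [Finset.forall_mem_image]
  exact fun k hk => h2 k.1 ⟨k, hk, rfl⟩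

theorem Bi.sep_result {β : Bi V ι} {S T : Finset (Loc V ι)} (h : β.Fits Γ m S T) :
    Sep (β.result S T) β.cuts := by
  intro x hx k hk
  obtain ⟨A, rfl, -⟩ := Bi.mem_cuts hk
  refine h.fresh k hk x ?_
  simpa [Bi.result, Bi.out] using hx

theorem sep_union {S : Finset (Loc V ι)} {C D : Finset (Cut V)} (h : Sep S C) (k : Sep S D) :
    Sep S (C ∪ D) := by
  intro x hx l hl
  rcases Finset.mem_union.1 hl with hl | hl
  · exact h x hx l hl
  · exact k x hx l hl

/-- Every proof has a representative with distinct names of cuts, which avoid a given finite set. -/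
theorem exists_linear {t : Tree V ι} (ht : t.Valid Γ m) {X : Set ℕ} (hX : X.Finite) :
    ∃ t', Rep Γ m t t' ∧ t'.Linear ∧ ∀ k ∈ t'.cuts, k.1 ∉ X := by
  induction t using Tree.rec_rules generalizing X with
  | ax a b => exact ⟨_, .refl _, trivial, by simp [Tree.cuts]⟩
  | un u p ih =>
    obtain ⟨p', h1, h2, h3⟩ := ih (Un.valid_node.1 ht).1 hX
    exact ⟨u.node p', h1.un, Un.linear_node.2 h2, by simpa using h3⟩
  | bi β p q ih ih' =>
    obtain ⟨hp, hq, hF⟩ := Bi.valid_node.1 ht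
    have f1 := finite_names β.cuts
    have f2 := finite_namesOf (β.node p q).concl
    obtain ⟨p', r1, l1, a1⟩ := ih hp (f1.union f2)
    obtain ⟨q', r2, l2, a2⟩ := ih' hq ((f1.union f2).union (finite_names p'.cuts))
    have r : Rep Γ m (β.node p q) (β.node p' q') := r1.bi r2
    have hl : (β.node p' q').Linear := Bi.linear_node.2 ⟨l1, l2,
      namesDisjoint_of_names fun k hk hn => a2 k hk (.inr hn),
      namesDisjoint_of_names fun k hk hn => a1 k hk (.inl hn),
      namesDisjoint_of_names fun k hk hn => a2 k hk (.inl (.inl hn))⟩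
    have hs : Sep (β.node p' q').concl (β.node p' q').cuts := by
      rw [r.concl, Bi.cuts_node]
      refine sep_union ?_ (sep_union ?_ ?_)
      · rw [Bi.concl_node]; exact Bi.sep_result hF
      · exact sep_of_names fun k hk hn => a1 k hk (.inr hn)
      · exact sep_of_names fun k hk hn => a2 k hk (.inl (.inr hn))
    -- The premises can be chosen to avoid given names, but the name of the cut introduced by `β`
    -- itself may lie in `X`; therefore the whole tree is renamed at the end.
    obtain ⟨π, h1, h2⟩ := exists_rename hs hX
    exact ⟨_, r.trans (.rename (r.valid ht) h1), hl.rename π, by rwa [Tree.cuts_rename]⟩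
  | wth a p q ih ih' =>
    obtain ⟨hp, hq, hF⟩ := wth_valid.1 ht
    obtain ⟨p', r1, l1, a1⟩ := ih hp hX
    obtain ⟨q', r2, l2, a2⟩ := ih' hq (hX.union (finite_names p'.cuts))
    refine ⟨.wth a p' q', r1.wth r2,
      ⟨l1, l2, namesDisjoint_of_names fun k hk hn => a2 k hk (.inr hn)⟩, fun k hk => ?_⟩
    rcases Finset.mem_union.1 hk with hk | hk
    · exact a1 k hk
    · exact fun hn => a2 k hk (.inl hn)

/-! ### Pairs of proofs with representatives that define the same linkings -/

variable (Γ m) in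
/-- Representatives of two proofs with the same cuts and the same linkings. -/
structure Twins (p q p' q' : Tree V ι) : Prop where
  rep_left : Rep Γ m p p'
  rep_right : Rep Γ m q q'
  apart_left : p'.Apart
  apart_right : q'.Apart
  func : Func p'.cuts
  cuts : p'.cuts = q'.cuts
  linkings : p'.linkings = q'.linkings

variable (Γ m) in
/-- The proofs have representatives with the same cuts and the same linkings. -/
def Twin (p q : Tree V ι) : Prop :=
  ∀ X : Set ℕ, X.Finite → ∃ p' q', Twins Γ m p q p' q' ∧ ∀ k ∈ p'.cuts, k.1 ∉ X

/-- One pair is enough: applying the same renaming to both members preserves the equality of cuts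
and of linkings, and fixing the names in the conclusion preserves the two proofs. -/
theorem Twins.twin {p q p' q' : Tree V ι} (h : Twins Γ m p q p' q') (hp : p.Valid Γ m)
    (hq : q.Valid Γ m) (hc : p.concl = q.concl) (hs : Sep p.concl p'.cuts) : Twin Γ m p q := by
  intro X hX
  obtain ⟨π, h1, h2⟩ := exists_rename hs hX
  have h1' := h1
  rw [← h.rep_left.concl] at h1
  rw [hc, ← h.rep_right.concl] at h1'
  exact ⟨p'.rename π, q'.rename π, ⟨h.rep_left.trans (.rename (h.rep_left.valid hp) h1),
    h.rep_right.trans (.rename (h.rep_right.valid hq) h1'), h.apart_left.rename π,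
    h.apart_right.rename π, by rw [Tree.cuts_rename]; exact h.func.rename, by simp [h.cuts],
    by simp [Tree.linkings_rename, h.linkings]⟩, by rwa [Tree.cuts_rename]⟩

theorem Twin.symm {p q : Tree V ι} (h : Twin Γ m p q) : Twin Γ m q p := by
  intro X hX
  obtain ⟨p', q', t, a⟩ := h X hX
  exact ⟨q', p', ⟨t.rep_right, t.rep_left, t.apart_right, t.apart_left, t.cuts ▸ t.func,
    t.cuts.symm, t.linkings.symm⟩, t.cuts ▸ a⟩

theorem Twin.of_rep {p q p' q' : Tree V ι} (h : Twin Γ m p' q') (hp : Rep Γ m p p')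
    (hq : Rep Γ m q q') : Twin Γ m p q := by
  intro X hX
  obtain ⟨p'', q'', t, a⟩ := h X hX
  exact ⟨p'', q'', ⟨hp.trans t.rep_left, hq.trans t.rep_right, t.apart_left, t.apart_right,
    t.func, t.cuts, t.linkings⟩, a⟩

theorem Twin.un {u : Un V ι} {p q : Tree V ι} (h : Twin Γ m p q) :
    Twin Γ m (u.node p) (u.node q) := by
  intro X hX
  obtain ⟨p', q', t, a⟩ := h X hX
  exact ⟨u.node p', u.node q', ⟨t.rep_left.un, t.rep_right.un, Un.apart_node.2 t.apart_left,
    Un.apart_node.2 t.apart_right, by simpa using t.func, by simpa using t.cuts,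
    by simpa using t.linkings⟩, by simpa using a⟩

/-- The untouched premise gets one representative, with names distinct from those of the pair, and
the same representative is used on both sides. -/
theorem Twin.bi {β : Bi V ι} {p q r : Tree V ι} (h : Twin Γ m p q)
    (hp : (β.node p r).Valid Γ m) (hq : (β.node q r).Valid Γ m)
    (hc : (β.node p r).concl = (β.node q r).concl) :
    Twin Γ m (β.node p r) (β.node q r) := by
  obtain ⟨-, hr, hF⟩ := Bi.valid_node.1 hp
  have f1 := finite_names β.cuts
  have f2 := finite_namesOf (β.node p r).concl
  obtain ⟨p', q', t, a⟩ := h _ (f1.union f2)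
  obtain ⟨r', rr, lr, ar⟩ := exists_linear hr ((f1.union f2).union (finite_names p'.cuts))
  have n1 : NamesDisjoint p'.cuts r'.cuts :=
    namesDisjoint_of_names fun k hk hn => ar k hk (.inr hn)
  have n2 : NamesDisjoint β.cuts p'.cuts := namesDisjoint_of_names fun k hk hn => a k hk (.inl hn)
  have n3 : NamesDisjoint β.cuts r'.cuts :=
    namesDisjoint_of_names fun k hk hn => ar k hk (.inl (.inl hn))
  refine Twins.twin (p' := β.node p' r') (q' := β.node q' r') ⟨t.rep_left.bi rr, t.rep_right.bi rr,
    Bi.apart_node.2 ⟨t.apart_left, lr.apart, n1, n2, n3⟩,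
    Bi.apart_node.2 ⟨t.apart_right, lr.apart, t.cuts ▸ n1, t.cuts ▸ n2, n3⟩, ?_, ?_, ?_⟩ hp hq hc ?_
  · rw [Bi.cuts_node]
    exact β.func_cuts.union (t.func.union lr.func n1) (namesDisjoint_union_right.2 ⟨n2, n3⟩)
  · simp [t.cuts]
  · simp [t.linkings]
  · rw [Bi.cuts_node]
    refine sep_union ?_ (sep_union ?_ ?_)
    · rw [Bi.concl_node]; exact Bi.sep_result hF
    · exact sep_of_names fun k hk hn => a k hk (.inr hn)
    · exact sep_of_names fun k hk hn => ar k hk (.inl (.inr hn))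

theorem Twin.wth_left {a : Loc V ι} {p q r : Tree V ι} (h : Twin Γ m p q) (hr : r.Valid Γ m) :
    Twin Γ m (.wth a p r) (.wth a q r) := by
  intro X hX
  obtain ⟨p', q', t, ha⟩ := h X hX
  obtain ⟨r', rr, lr, ar⟩ := exists_linear hr (hX.union (finite_names p'.cuts))
  refine ⟨.wth a p' r', .wth a q' r', ⟨t.rep_left.wth rr, t.rep_right.wth rr,
    ⟨t.apart_left, lr.apart⟩, ⟨t.apart_right, lr.apart⟩,
    t.func.union lr.func (namesDisjoint_of_names fun k hk hn => ar k hk (.inr hn)),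
    by simp [Tree.cuts, t.cuts], by simp [Tree.linkings, t.linkings]⟩, fun k hk => ?_⟩
  rcases Finset.mem_union.1 hk with hk | hk
  · exact ha k hk
  · exact fun hn => ar k hk (.inl hn)

theorem Twin.wth_right {a : Loc V ι} {p q r : Tree V ι} (h : Twin Γ m p q) (hr : r.Valid Γ m) :
    Twin Γ m (.wth a r p) (.wth a r q) := by
  intro X hX
  obtain ⟨p', q', t, ha⟩ := h X hX
  obtain ⟨r', rr, lr, ar⟩ := exists_linear hr (hX.union (finite_names p'.cuts))
  refine ⟨.wth a r' p', .wth a r' q', ⟨rr.wth t.rep_left, rr.wth t.rep_right,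
    ⟨lr.apart, t.apart_left⟩, ⟨lr.apart, t.apart_right⟩,
    lr.func.union t.func (namesDisjoint_of_names fun k hk hn => ar k hk (.inr hn)).symm,
    by simp [Tree.cuts, t.cuts], by simp [Tree.linkings, t.linkings]⟩, fun k hk => ?_⟩
  rcases Finset.mem_union.1 hk with hk | hk
  · exact fun hn => ar k hk (.inl hn)
  · exact ha k hk

/-- In the application to a commutation, `S` is the common conclusion and `D` consists of the cuts
made by the two commuting rules. The versions for several subproofs also make the names of different
subproofs disjoint. -/
theorem exists_linear₁ (S : Finset (Loc V ι)) (D : Finset (Cut V)) {p : Tree V ι}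
    (h : p.Valid Γ m) : ∃ p', Rep Γ m p p' ∧ p'.Linear ∧ Sep S p'.cuts ∧
      NamesDisjoint D p'.cuts := by
  obtain ⟨p', r, l, a⟩ := exists_linear h ((finite_namesOf S).union (finite_names D))
  exact ⟨p', r, l, sep_of_names fun k hk hn => a k hk (.inl hn),
    namesDisjoint_of_names fun k hk hn => a k hk (.inr hn)⟩

theorem exists_linear₂ (S : Finset (Loc V ι)) (D : Finset (Cut V)) {p q : Tree V ι}
    (h : p.Valid Γ m ∧ q.Valid Γ m) : ∃ p' q',
      (Rep Γ m p p' ∧ p'.Linear ∧ Sep S p'.cuts ∧ NamesDisjoint D p'.cuts) ∧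
      Rep Γ m q q' ∧ q'.Linear ∧ Sep S q'.cuts ∧ NamesDisjoint (D ∪ p'.cuts) q'.cuts := by
  obtain ⟨p', hp⟩ := exists_linear₁ S D h.1
  obtain ⟨q', hq⟩ := exists_linear₁ S (D ∪ p'.cuts) h.2
  exact ⟨p', q', hp, hq⟩

theorem exists_linear₃ (S : Finset (Loc V ι)) (D : Finset (Cut V)) {p q r : Tree V ι}
    (h : p.Valid Γ m ∧ q.Valid Γ m ∧ r.Valid Γ m) : ∃ p' q' r',
      (Rep Γ m p p' ∧ p'.Linear ∧ Sep S p'.cuts ∧ NamesDisjoint D p'.cuts) ∧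
      (Rep Γ m q q' ∧ q'.Linear ∧ Sep S q'.cuts ∧ NamesDisjoint (D ∪ p'.cuts) q'.cuts) ∧
      Rep Γ m r r' ∧ r'.Linear ∧ Sep S r'.cuts ∧
        NamesDisjoint (D ∪ p'.cuts ∪ q'.cuts) r'.cuts := by
  obtain ⟨p', hp⟩ := exists_linear₁ S D h.1
  obtain ⟨q', r', h⟩ := exists_linear₂ S (D ∪ p'.cuts) h.2
  exact ⟨p', q', r', hp, h⟩

theorem exists_linear₄ (S : Finset (Loc V ι)) (D : Finset (Cut V)) {p q r s : Tree V ι}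
    (h : p.Valid Γ m ∧ q.Valid Γ m ∧ r.Valid Γ m ∧ s.Valid Γ m) : ∃ p' q' r' s',
      (Rep Γ m p p' ∧ p'.Linear ∧ Sep S p'.cuts ∧ NamesDisjoint D p'.cuts) ∧
      (Rep Γ m q q' ∧ q'.Linear ∧ Sep S q'.cuts ∧ NamesDisjoint (D ∪ p'.cuts) q'.cuts) ∧
      (Rep Γ m r r' ∧ r'.Linear ∧ Sep S r'.cuts ∧
        NamesDisjoint (D ∪ p'.cuts ∪ q'.cuts) r'.cuts) ∧
      Rep Γ m s s' ∧ s'.Linear ∧ Sep S s'.cuts ∧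
        NamesDisjoint (D ∪ p'.cuts ∪ q'.cuts ∪ r'.cuts) s'.cuts := by
  obtain ⟨p', hp⟩ := exists_linear₁ S D h.1
  obtain ⟨q', r', s', h⟩ := exists_linear₃ S (D ∪ p'.cuts) h.2
  exact ⟨p', q', r', s', hp, h⟩

/-- In the listed direction, the left side contains each subproof and each commuting cut once, so it
can be linear. The right side may repeat them in both branches of a `wth`, so only `Apart` is asked
of it. -/
theorem Twin.of_comm {p q p' q' : Tree V ι} (h : Comm p' q') (hp : p.Valid Γ m)
    (hq : q.Valid Γ m) (hc : p.concl = q.concl) {S : Finset (Loc V ι)} (hS : S = p.concl)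
    (rp : Rep Γ m p p') (rq : Rep Γ m q q')
    (lp : p'.Linear) (lq : q'.Apart) (hs : Sep S p'.cuts) : Twin Γ m p q :=
  Twins.twin ⟨rp, rq, lp.apart, lq, lp.func, h.cuts_eq, h.linkings_eq⟩ hp hq hc (hS ▸ hs)

theorem sep_cut {c : ℕ} {A : Formula V} {p q : Tree V ι} (h : (Tree.cut c A p q).Valid Γ m) :
    Sep (Tree.cut c A p q).concl {(c, s(A, A.dual))} :=
  Bi.sep_result (β := .cut c A) h.2.2

theorem Comm.twin {p q : Tree V ι} (h : Comm p q) (hp : p.Valid Γ m) (hq : q.Valid Γ m)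
    (hc : p.concl = q.concl) : Twin Γ m p q := by
  have tensor : ∀ {a : Loc V ι} {p p' q q' : Tree V ι}, Rep Γ m p p' → Rep Γ m q q' →
    Rep Γ m (.tensor a p q) (.tensor a p' q') := fun h k => Rep.bi (β := .tensor _) h k
  have mix : ∀ {p p' q q' : Tree V ι}, Rep Γ m p p' → Rep Γ m q q' →
    Rep Γ m (.mix p q) (.mix p' q') := fun h k => Rep.bi (β := .mix) h k
  have cut : ∀ {c : ℕ} {A : Formula V} {p p' q q' : Tree V ι}, Rep Γ m p p' → Rep Γ m q q' →
    Rep Γ m (.cut c A p q) (.cut c A p' q') := fun h k => Rep.bi (β := .cut _ _) h k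
  have par : ∀ {a : Loc V ι} {p p' : Tree V ι}, Rep Γ m p p' →
    Rep Γ m (.par a p) (.par a p') := fun h => Rep.un (u := .par _) h
  have plus : ∀ {d : Side} {a : Loc V ι} {p p' : Tree V ι}, Rep Γ m p p' →
    Rep Γ m (.plus d a p) (.plus d a p') := fun h => Rep.un (u := .plus _ _) h
  obtain ⟨S, hS⟩ : ∃ S, S = p.concl := ⟨_, rfl⟩
  cases h
  case' par_par a b p =>
    obtain ⟨p', F⟩ := exists_linear₁ S ∅ (show p.Valid Γ m by simp only [Tree.Valid] at hp; tauto)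
    refine .of_comm (.par_par a b p') hp hq hc hS ?_ ?_ ?_ ?_ ?_
  case' plus_plus i j a b p =>
    obtain ⟨p', F⟩ := exists_linear₁ S ∅ (show p.Valid Γ m by simp only [Tree.Valid] at hp; tauto)
    refine .of_comm (.plus_plus i j a b p') hp hq hc hS ?_ ?_ ?_ ?_ ?_
  case' tensor_tensor a b p q r =>
    obtain ⟨p', q', r', F⟩ := exists_linear₃ S ∅
      (show p.Valid Γ m ∧ q.Valid Γ m ∧ r.Valid Γ m by simp only [Tree.Valid] at hp; tauto)
    refine .of_comm (.tensor_tensor a b p' q' r') hp hq hc hS ?_ ?_ ?_ ?_ ?_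
  case' tensor_tensor_left a b p q r =>
    obtain ⟨p', q', r', F⟩ := exists_linear₃ S ∅
      (show p.Valid Γ m ∧ q.Valid Γ m ∧ r.Valid Γ m by simp only [Tree.Valid] at hp; tauto)
    refine .of_comm (.tensor_tensor_left a b p' q' r') hp hq hc hS ?_ ?_ ?_ ?_ ?_
  case' tensor_tensor_right a b p q r =>
    obtain ⟨p', q', r', F⟩ := exists_linear₃ S ∅
      (show p.Valid Γ m ∧ q.Valid Γ m ∧ r.Valid Γ m by simp only [Tree.Valid] at hp; tauto)
    refine .of_comm (.tensor_tensor_right a b p' q' r') hp hq hc hS ?_ ?_ ?_ ?_ ?_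
  case' wth_wth a b p₁ p₂ p₃ p₄ =>
    obtain ⟨p', q', r', s', F⟩ := exists_linear₄ S ∅
      (show p₁.Valid Γ m ∧ p₂.Valid Γ m ∧ p₃.Valid Γ m ∧ p₄.Valid Γ m by
        simp only [Tree.Valid] at hp; tauto)
    refine .of_comm (.wth_wth a b p' q' r' s') hp hq hc hS ?_ ?_ ?_ ?_ ?_
  case' plus_par i a b p =>
    obtain ⟨p', F⟩ := exists_linear₁ S ∅ (show p.Valid Γ m by simp only [Tree.Valid] at hp; tauto)
    refine .of_comm (.plus_par i a b p') hp hq hc hS ?_ ?_ ?_ ?_ ?_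
  case' plus_wth i a b p q =>
    obtain ⟨p', q', F⟩ := exists_linear₂ S ∅
      (show p.Valid Γ m ∧ q.Valid Γ m by simp only [Tree.Valid] at hp; tauto)
    refine .of_comm (.plus_wth i a b p' q') hp hq hc hS ?_ ?_ ?_ ?_ ?_
  case' par_wth a b p q =>
    obtain ⟨p', q', F⟩ := exists_linear₂ S ∅
      (show p.Valid Γ m ∧ q.Valid Γ m by simp only [Tree.Valid] at hp; tauto)
    refine .of_comm (.par_wth a b p' q') hp hq hc hS ?_ ?_ ?_ ?_ ?_
  case' plus_tensor i a b p q =>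
    obtain ⟨p', q', F⟩ := exists_linear₂ S ∅
      (show p.Valid Γ m ∧ q.Valid Γ m by simp only [Tree.Valid] at hp; tauto)
    refine .of_comm (.plus_tensor i a b p' q') hp hq hc hS ?_ ?_ ?_ ?_ ?_
  case' plus_tensor' i a b p q =>
    obtain ⟨p', q', F⟩ := exists_linear₂ S ∅
      (show p.Valid Γ m ∧ q.Valid Γ m by simp only [Tree.Valid] at hp; tauto)
    refine .of_comm (.plus_tensor' i a b p' q') hp hq hc hS ?_ ?_ ?_ ?_ ?_
  case' par_tensor a b p q =>
    obtain ⟨p', q', F⟩ := exists_linear₂ S ∅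
      (show p.Valid Γ m ∧ q.Valid Γ m by simp only [Tree.Valid] at hp; tauto)
    refine .of_comm (.par_tensor a b p' q') hp hq hc hS ?_ ?_ ?_ ?_ ?_
  case' par_tensor' a b p q =>
    obtain ⟨p', q', F⟩ := exists_linear₂ S ∅
      (show p.Valid Γ m ∧ q.Valid Γ m by simp only [Tree.Valid] at hp; tauto)
    refine .of_comm (.par_tensor' a b p' q') hp hq hc hS ?_ ?_ ?_ ?_ ?_
  case' wth_tensor a b p q r =>
    obtain ⟨p', q', r', F⟩ := exists_linear₃ S ∅
      (show p.Valid Γ m ∧ q.Valid Γ m ∧ r.Valid Γ m by simp only [Tree.Valid] at hp; tauto)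
    refine .of_comm (.wth_tensor a b p' q' r') hp hq hc hS ?_ ?_ ?_ ?_ ?_
  case' wth_tensor' a b p q r =>
    obtain ⟨p', q', r', F⟩ := exists_linear₃ S ∅
      (show p.Valid Γ m ∧ q.Valid Γ m ∧ r.Valid Γ m by simp only [Tree.Valid] at hp; tauto)
    refine .of_comm (.wth_tensor' a b p' q' r') hp hq hc hS ?_ ?_ ?_ ?_ ?_
  case' mix_mix p q r =>
    obtain ⟨p', q', r', F⟩ := exists_linear₃ S ∅
      (show p.Valid Γ m ∧ q.Valid Γ m ∧ r.Valid Γ m by simp only [Tree.Valid] at hp; tauto)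
    refine .of_comm (.mix_mix p' q' r') hp hq hc hS ?_ ?_ ?_ ?_ ?_
  case' tensor_mix b p q r =>
    obtain ⟨p', q', r', F⟩ := exists_linear₃ S ∅
      (show p.Valid Γ m ∧ q.Valid Γ m ∧ r.Valid Γ m by simp only [Tree.Valid] at hp; tauto)
    refine .of_comm (.tensor_mix b p' q' r') hp hq hc hS ?_ ?_ ?_ ?_ ?_
  case' tensor_mix' b p q r =>
    obtain ⟨p', q', r', F⟩ := exists_linear₃ S ∅
      (show p.Valid Γ m ∧ q.Valid Γ m ∧ r.Valid Γ m by simp only [Tree.Valid] at hp; tauto)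
    refine .of_comm (.tensor_mix' b p' q' r') hp hq hc hS ?_ ?_ ?_ ?_ ?_
  case' plus_mix i b p q =>
    obtain ⟨p', q', F⟩ := exists_linear₂ S ∅
      (show p.Valid Γ m ∧ q.Valid Γ m by simp only [Tree.Valid] at hp; tauto)
    refine .of_comm (.plus_mix i b p' q') hp hq hc hS ?_ ?_ ?_ ?_ ?_
  case' par_mix b p q =>
    obtain ⟨p', q', F⟩ := exists_linear₂ S ∅
      (show p.Valid Γ m ∧ q.Valid Γ m by simp only [Tree.Valid] at hp; tauto)
    refine .of_comm (.par_mix b p' q') hp hq hc hS ?_ ?_ ?_ ?_ ?_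
  case' wth_mix b p q r =>
    obtain ⟨p', q', r', F⟩ := exists_linear₃ S ∅
      (show p.Valid Γ m ∧ q.Valid Γ m ∧ r.Valid Γ m by simp only [Tree.Valid] at hp; tauto)
    refine .of_comm (.wth_mix b p' q' r') hp hq hc hS ?_ ?_ ?_ ?_ ?_
  case' cut_cut c d A B p q r =>
    have hs := hS ▸ sep_cut hp
    -- On the right side the cut named `d` is the last rule, which shows that `d` is not free in the
    -- conclusion.
    have hs' := (hS.trans hc) ▸ sep_cut hq
    -- The argument of the outer cut is a conclusion of the inner one, where `d` is not free; hence
    -- the two names differ.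
    have hd : NamesDisjoint {(c, s(A, A.dual))} {(d, s(B, B.dual))} := by
      have h1 := hp.2.2.actR (Finset.mem_singleton_self _)
      have h2 := sep_cut hp.2.1 _ h1 _ (Finset.mem_singleton_self _)
      simpa [NamesDisjoint, Root.names, eq_comm] using h2
    obtain ⟨p', q', r', F⟩ := exists_linear₃ S ({(c, s(A, A.dual))} ∪ {(d, s(B, B.dual))})
      (show p.Valid Γ m ∧ q.Valid Γ m ∧ r.Valid Γ m by simp only [Tree.Valid] at hp; tauto)
    refine .of_comm (.cut_cut c d A B p' q' r') hp hq hc hS ?_ ?_ ?_ ?_ ?_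
  case' tensor_cut c A b p q r =>
    have hs := hS ▸ sep_cut hp
    obtain ⟨p', q', r', F⟩ := exists_linear₃ S {(c, s(A, A.dual))}
      (show p.Valid Γ m ∧ q.Valid Γ m ∧ r.Valid Γ m by simp only [Tree.Valid] at hp; tauto)
    refine .of_comm (.tensor_cut c A b p' q' r') hp hq hc hS ?_ ?_ ?_ ?_ ?_
  case' tensor_cut' c A b p q r =>
    have hs := hS ▸ sep_cut hp
    obtain ⟨p', q', r', F⟩ := exists_linear₃ S {(c, s(A, A.dual))}
      (show p.Valid Γ m ∧ q.Valid Γ m ∧ r.Valid Γ m by simp only [Tree.Valid] at hp; tauto)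
    refine .of_comm (.tensor_cut' c A b p' q' r') hp hq hc hS ?_ ?_ ?_ ?_ ?_
  case' plus_cut c A i b p q =>
    have hs := hS ▸ sep_cut hp
    obtain ⟨p', q', F⟩ := exists_linear₂ S {(c, s(A, A.dual))}
      (show p.Valid Γ m ∧ q.Valid Γ m by simp only [Tree.Valid] at hp; tauto)
    refine .of_comm (.plus_cut c A i b p' q') hp hq hc hS ?_ ?_ ?_ ?_ ?_
  case' par_cut c A b p q =>
    have hs := hS ▸ sep_cut hp
    obtain ⟨p', q', F⟩ := exists_linear₂ S {(c, s(A, A.dual))}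
      (show p.Valid Γ m ∧ q.Valid Γ m by simp only [Tree.Valid] at hp; tauto)
    refine .of_comm (.par_cut c A b p' q') hp hq hc hS ?_ ?_ ?_ ?_ ?_
  case' wth_cut c A b p q r =>
    have hs := hS ▸ sep_cut hp
    obtain ⟨p', q', r', F⟩ := exists_linear₃ S {(c, s(A, A.dual))}
      (show p.Valid Γ m ∧ q.Valid Γ m ∧ r.Valid Γ m by simp only [Tree.Valid] at hp; tauto)
    refine .of_comm (.wth_cut c A b p' q' r') hp hq hc hS ?_ ?_ ?_ ?_ ?_
  case' cut_mix c A p q r =>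
    have hs := (hS.trans hc) ▸ sep_cut hq
    obtain ⟨p', q', r', F⟩ := exists_linear₃ S {(c, s(A, A.dual))}
      (show p.Valid Γ m ∧ q.Valid Γ m ∧ r.Valid Γ m by simp only [Tree.Valid] at hp; tauto)
    refine .of_comm (.cut_mix c A p' q' r') hp hq hc hS ?_ ?_ ?_ ?_ ?_
  all_goals
    try simp only [namesDisjoint_union_left] at F
    casesm* _ ∧ _
    try simp only [Tree.Linear, Tree.Apart, Tree.cuts, namesDisjoint_union_left,
      namesDisjoint_union_right]
    repeat' first
      | assumption
      | apply And.intro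
      | exact Tree.Linear.apart ‹_›
      | exact NamesDisjoint.symm ‹_›
      | apply sep_union
      | apply tensor
      | apply par
      | apply Rep.wth
      | apply plus
      | apply mix
      | apply cut

theorem Un.result_inj {u : Un V ι} {S T : Finset (Loc V ι)} (hS : u.Fits Γ S) (hT : u.Fits Γ T)
    (h : u.result S = u.result T) : S = T := by
  obtain ⟨-, a1, o1⟩ := hS
  obtain ⟨-, a2, o2⟩ := hT
  ext x
  have h1 := @a1 x
  have h2 := @a2 x
  have h3 := Finset.ext_iff.1 h x
  simp only [Un.result, Finset.mem_insert, Finset.mem_sdiff] at h3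
  by_cases hx : x = u.out
  · subst hx; tauto
  · tauto

theorem Bi.subset_of_result_eq {β : Bi V ι} {S T R : Finset (Loc V ι)} (hS : β.Fits Γ m S R)
    (hT : β.Fits Γ m T R) (h : β.result S R = β.result T R) : S ⊆ T := by
  intro x hx
  by_cases ha : x ∈ β.actL
  · exact hT.actL ha
  · have h1 : x ∈ β.result T R := by rw [← h]; simp [Bi.result, hx, ha]
    have h2 := Finset.disjoint_left.1 hS.disj (Finset.mem_sdiff.2 ⟨hx, ha⟩)
    have h3 : x ∉ β.out := fun ho => Finset.disjoint_left.1 hS.outL ho hx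
    simp only [Bi.result, Finset.mem_union] at h1
    exact (Finset.mem_sdiff.1 ((h1.resolve_left h3).resolve_right h2)).1

theorem Bi.result_inj {β : Bi V ι} {S T R : Finset (Loc V ι)} (hS : β.Fits Γ m S R)
    (hT : β.Fits Γ m T R) (h : β.result S R = β.result T R) : S = T :=
  (Bi.subset_of_result_eq hS hT h).antisymm (Bi.subset_of_result_eq hT hS h.symm)

theorem Twin.bi_of_twin {β : Bi V ι} {p q r : Tree V ι}
    (h : p.Valid Γ m → q.Valid Γ m → p.concl = q.concl → Twin Γ m p q)
    (hp : (β.node p r).Valid Γ m) (hq : (β.node q r).Valid Γ m)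
    (hc : (β.node p r).concl = (β.node q r).concl) :
    Twin Γ m (β.node p r) (β.node q r) := by
  obtain ⟨vp, -, fp⟩ := Bi.valid_node.1 hp
  obtain ⟨vq, -, fq⟩ := Bi.valid_node.1 hq
  refine (h vp vq (Bi.result_inj fp fq ?_)).bi hp hq hc
  rwa [← Bi.concl_node, ← Bi.concl_node]

theorem Twin.bi_of_twin_right {β : Bi V ι} {p q r : Tree V ι}
    (h : p.Valid Γ m → q.Valid Γ m → p.concl = q.concl → Twin Γ m p q)
    (hp : (β.node r p).Valid Γ m) (hq : (β.node r q).Valid Γ m)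
    (hc : (β.node r p).concl = (β.node r q).concl) :
    Twin Γ m (β.node r p) (β.node r q) := by
  have r1 := Rep.flip (Γ := Γ) (m := m) β r p
  have r2 := Rep.flip (Γ := Γ) (m := m) β r q
  exact (Twin.bi_of_twin h (r1.valid hp) (r2.valid hq)
    (r1.concl.trans (hc.trans r2.concl.symm))).of_rep r1 r2

theorem Twin.un_of_twin {u : Un V ι} {p q : Tree V ι}
    (h : p.Valid Γ m → q.Valid Γ m → p.concl = q.concl → Twin Γ m p q)
    (hp : (u.node p).Valid Γ m) (hq : (u.node q).Valid Γ m)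
    (hc : (u.node p).concl = (u.node q).concl) : Twin Γ m (u.node p) (u.node q) := by
  obtain ⟨vp, fp⟩ := Un.valid_node.1 hp
  obtain ⟨vq, fq⟩ := Un.valid_node.1 hq
  refine (h vp vq (Un.result_inj fp fq ?_)).un
  rwa [← Un.concl_node, ← Un.concl_node]

/-- Rules determine the conclusion of a premise from their own conclusion and the other premise, so
the two versions of the altered subproof prove the same sequent and the induction applies to them.
-/
theorem CommStep.twin {p q : Tree V ι} (h : CommStep p q) (hp : p.Valid Γ m)
    (hq : q.Valid Γ m) (hc : p.concl = q.concl) : Twin Γ m p q := by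
  induction h with
  | here h => exact h.twin hp hq hc
  | tensor_left _ ih => exact Twin.bi_of_twin (β := .tensor _) ih hp hq hc
  | tensor_right _ ih => exact Twin.bi_of_twin_right (β := .tensor _) ih hp hq hc
  | par _ ih => exact Twin.un_of_twin (u := .par _) ih hp hq hc
  | @wth_left a p p' q _ ih =>
    obtain ⟨vp, vr, fp⟩ := wth_valid.1 hp
    obtain ⟨vq, -, fq⟩ := wth_valid.1 hq
    refine (ih vp vq ?_).wth_left vr
    have h1 := fp.left
    have h2 := fq.left
    have e := fp.eq.trans fq.eq.symm
    rw [← Finset.insert_sdiff_self_of_mem h1, e, Finset.insert_sdiff_self_of_mem h2]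
  | @wth_right a r p p' _ ih =>
    obtain ⟨vr, vp, fp⟩ := wth_valid.1 hp
    obtain ⟨-, vq, fq⟩ := wth_valid.1 hq
    refine (ih vp vq ?_).wth_right vr
    have h1 := fp.right
    have h2 := fq.right
    have e := fp.eq.symm.trans fq.eq
    rw [← Finset.insert_sdiff_self_of_mem h1, e, Finset.insert_sdiff_self_of_mem h2]
  | plus _ ih => exact Twin.un_of_twin (u := .plus _ _) ih hp hq hc
  | mix_left _ ih => exact Twin.bi_of_twin (β := .mix) ih hp hq hc
  | mix_right _ ih => exact Twin.bi_of_twin_right (β := .mix) ih hp hq hc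
  | cut_left _ ih => exact Twin.bi_of_twin (β := .cut _ _) ih hp hq hc
  | cut_right _ ih => exact Twin.bi_of_twin_right (β := .cut _ _) ih hp hq hc

/-- A well-formed proof of `Γ`, with all of its cuts retained. -/
def Tree.toStar [Fintype ι] {t : Tree V ι} (hv : t.Valid Γ m) (ha : t.Apart) (hf : Func t.cuts)
    (hc : t.concl = rootLocs V ι) : StarProof m t.cuts.val Γ where
  tree := t
  names_nodup := (Multiset.nodup_map_iff_inj_on t.cuts.nodup).2 fun k hk l hl => hf k hk l hl
  derives := by rw [← toSequent_rootLocs, ← hc]; exact derivesStar hv ha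

/-- Two representatives with the same cuts and linkings are proofs of one sequent with all cuts
retained, and they project to the two given proofs. -/
theorem commonTranslation_of_differByCommutation [Fintype ι] {x y : Proof m Γ}
    (h : DifferByCommutation x y) : CommonTranslation x y := by
  obtain ⟨⟨p, dp⟩, ⟨q, dq⟩, rfl, rfl, h⟩ := h
  obtain ⟨vp, cp⟩ := dp.valid wf_ofFamily
  obtain ⟨vq, cq⟩ := dq.valid wf_ofFamily
  rw [locs_ofFamily] at cp cq
  have ht : Twin Γ m p q := by
    rcases h with h | h
    · exact h.twin vp vq (cp.trans cq.symm)
    · exact (h.twin vq vp (cq.trans cp.symm)).symm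
  obtain ⟨p', q', t, -⟩ := ht ∅ Set.finite_empty
  refine ⟨p'.cuts.val, p'.linkings, ⟨Tree.toStar (t.rep_left.valid vp) t.apart_left t.func
    (t.rep_left.concl.trans cp), rfl, ?_⟩, ?_⟩
  · exact Quotient.sound (s := RawProof.setoid m Γ) t.rep_left.same.symm
  · rw [t.cuts, t.linkings]
    exact ⟨Tree.toStar (t.rep_right.valid vq) t.apart_right (t.cuts ▸ t.func)
      (t.rep_right.concl.trans cq), rfl,
      Quotient.sound (s := RawProof.setoid m Γ) t.rep_right.same.symm⟩

theorem DifferByCommutation.symm [Fintype ι] {x y : Proof m Γ} (h : DifferByCommutation x y) :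
    DifferByCommutation y x := by
  obtain ⟨p, q, hp, hq, h⟩ := h
  exact ⟨q, p, hq, hp, h.symm⟩

theorem Interconvertible.symm [Fintype ι] {x y : Proof m Γ} (h : Interconvertible x y) :
    Interconvertible y x := by
  induction h with
  | refl => exact .refl
  | tail _ h ih => exact .head h.symm ih

/-- Interconvertibility is an equivalence relation that contains the generators of proof-net
equivalence, by (a); conversely each commutation is one of those generators, by (b). -/
theorem proofNetEquivalent_iff_interconvertible [Fintype ι] {x y : Proof m Γ} :
    ProofNetEquivalent x y ↔ Interconvertible x y := by
  constructor
  · intro h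
    induction h with
    | rel _ _ h => exact interconvertible_of_commonTranslation h
    | refl => exact .refl
    | symm _ _ _ ih => exact ih.symm
    | trans _ _ _ _ _ ih ih' => exact ih.trans ih'
  · intro h
    induction h with
    | refl => exact .refl _
    | tail _ h ih => exact ih.trans _ _ _ (.rel _ _ (commonTranslation_of_differByCommutation h))

end

end MALL

theorem mainTheorem3 {V : Type*} {ι : Type*} [Fintype ι] (m : Bool) (Γ : ι → MALL.Formula V) :
    (∀ x y : MALL.Proof m Γ, MALL.ProofNetEquivalent x y ↔ MALL.Interconvertible x y) ∧
    (∀ x y : MALL.Proof m Γ, MALL.CommonTranslation x y → MALL.Interconvertible x y) ∧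
    (∀ x y : MALL.Proof m Γ, MALL.DifferByCommutation x y → MALL.CommonTranslation x y) :=
  ⟨fun _ _ => MALL.proofNetEquivalent_iff_interconvertible,
    fun _ _ => MALL.interconvertible_of_commonTranslation,
    fun _ _ => MALL.commonTranslation_of_differByCommutation⟩
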